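/- Let $q$ be a complex number with $0<|q|<1$. Write $(a;q)_n=\prod_{j=0}^{n-1}(1-aq^j)$ for $n\in\{0,1,2,\dots\}\cup\{\infty\}$ and $(a_1,\dots,a_m;q)_n=(a_1;q)_n\cdots(a_m;q)_n$. Let $$F(u,v,w)=\sum_{i,j,k=0}^\infty\frac{(-1)^kq^{3k(k-1)+(i+2j+3k)(i+2j+3k-1)}u^iv^jw^k}{(q;q)_i(q^4;q^4)_j(q^6;q^6)_k}$$ and $${}_r\phi_s\left(\begin{matrix}a_1,\dots,a_r\\b_1,\dots,b_s\end{matrix};q,z\right)=\sum_{n=0}^\infty\frac{(a_1,\dots,a_r;q)_n}{(q,b_1,\dots,b_s;q)_n}\left((-1)^nq^{\binom n2}\right)^{1+s-r}z^n.$$ (1) The following triple series converge absolutely, and $$F(q^3,q^5,q^{12})=\frac1{(q^3;q^4)_\infty(q^4,q^5;q^{12})_\infty},\qquad F(q,q^3,q^6)=\frac1{(q;q^4)_\infty(q^4,q^{11};q^{12})_\infty},$$ $$F(q,q,q^6)=\frac1{(q^3;q^4)_\infty(q,q^8;q^{12})_\infty},\qquad F(q^2,q^{-1},q^6)=\frac1{(q;q^4)_\infty(q^7,q^8;q^{12})_\infty}.$$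 (2) Let $\omega$ be a primitive cube root of unity, fix any fourth root $q^{1/4}$ of $q$, and put $q^{m/4}=(q^{1/4})^m$ for $m\in\mathbb Z$. Then the following series converge absolutely, and $${}_2\phi_1\left(\begin{matrix}q^{3/4}\omega,-q^{3/4}\omega\\-q^{3/2}\end{matrix};q,q^{1/2}\omega^2\right)=\frac{(1+q^{1/2})(q^{1/2},q^{9/2};q^6)_\infty}{(q^{1/2}\omega^2;q)_\infty(q;q^2)_\infty(q^2;q^6)_\infty},$$ $${}_2\phi_1\left(\begin{matrix}q^{1/4}\omega,-q^{1/4}\omega\\-q^{1/2}\end{matrix};q,q^{1/2}\omega^2\right)=\frac{(q^{3/2},q^{7/2};q^6)_\infty}{(q^{1/2}\omega^2;q)_\infty(q;q^2)_\infty(q^2;q^6)_\infty},$$ $${}_2\phi_2\left(\begin{matrix}q^{1/2}\omega,q^{1/2}\omega^2\\q^{5/4},-q^{5/4}\end{matrix};q,-q^{1/2}\right)=\frac{1-q^{1/2}}{(q^{1/2};q)_\infty(q^{1/2},q^4;q^6)_\infty},$$ $${}_2\phi_2\left(\begin{matrix}q^{-1/2}\omega,q^{-1/2}\omega^2\\q^{3/4},-q^{3/4}\end{matrix};q,-q^{3/2}\right)=\frac1{(q^{1/2};q)_\infty(q^{7/2},q^4;q^6)_\infty}.$$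 -/

import Mathlib

namespace KanadeRussell

noncomputable section

/-- The finite `q`-shifted factorial `(a; q)_n = ∏_{j=0}^{n-1} (1 - a q^j)`. -/
def qPoch (a q : ℂ) (n : ℕ) : ℂ := ∏ j ∈ Finset.range n, (1 - a * q ^ j)

/-- The infinite `q`-shifted factorial `(a; q)_∞ = ∏_{j=0}^∞ (1 - a q^j)`, for `|q| < 1`. -/
def qPochInf (a q : ℂ) : ℂ := ∏' j : ℕ, (1 - a * q ^ j)

/-- For `|q| < 1` the product defining `(a; q)_∞` converges. -/
theorem multipliable_qPochInf (a : ℂ) {q : ℂ} (hq : ‖q‖ < 1) :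
    Multipliable fun j : ℕ => 1 - a * q ^ j := by
  have h : Summable fun j : ℕ => ‖-(a * q ^ j)‖ := by
    simpa [norm_mul, norm_pow] using
      (summable_geometric_of_lt_one (norm_nonneg q) hq).mul_left ‖a‖
  simpa [sub_eq_add_neg] using multipliable_one_add_of_summable h

/-- The multiple symbol `(a₁, …, a_m; q)_n = (a₁; q)_n ⋯ (a_m; q)_n`. -/
def qPochList (as : List ℂ) (q : ℂ) (n : ℕ) : ℂ := (as.map fun a => qPoch a q n).prod

/-- The multiple symbol `(a₁, …, a_m; q)_∞ = (a₁; q)_∞ ⋯ (a_m; q)_∞`. -/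
def qPochInfList (as : List ℂ) (q : ℂ) : ℂ := (as.map fun a => qPochInf a q).prod

/-- The `(i, j, k)` term of the triple series `F(u, v, w)`. The natural-number subtractions are
harmless: each of them occurs in a product `m * (m - 1)`, which is `0` for `m = 0`. -/
def tripleTerm (q u v w : ℂ) (p : ℕ × ℕ × ℕ) : ℂ :=
  let i := p.1
  let j := p.2.1
  let k := p.2.2
  (-1) ^ k
      * q ^ (3 * (k * (k - 1)) + (i + 2 * j + 3 * k) * (i + 2 * j + 3 * k - 1))
      * u ^ i * v ^ j * w ^ k
    / (qPoch q q i * qPoch (q ^ 4) (q ^ 4) j * qPoch (q ^ 6) (q ^ 6) k)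

/-- The triple series `F(u, v, w)`, in base `q`. -/
def F (q u v w : ℂ) : ℂ := ∑' p : ℕ × ℕ × ℕ, tripleTerm q u v w p

/-- The `n`-th term of the basic hypergeometric series
`ᵣφₛ(a₁, …, aᵣ; b₁, …, bₛ; q, z)`; the factor `(q; q)_n` belongs to the denominator. -/
def phiTerm (as bs : List ℂ) (q z : ℂ) (n : ℕ) : ℂ :=
  qPochList as q n / (qPoch q q n * qPochList bs q n)
    * ((-1) ^ n * q ^ n.choose 2) ^ (1 + (bs.length : ℤ) - (as.length : ℤ)) * z ^ n

/-- The basic hypergeometric series `ᵣφₛ(a₁, …, aᵣ; b₁, …, bₛ; q, z)`. -/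
def phi (as bs : List ℂ) (q z : ℂ) : ℂ := ∑' n : ℕ, phiTerm as bs q z n

end

end KanadeRussell

/-!
The four triple series are reduced to four instances of the series
`Φ(t, b, c) = ₂φ₂(t ω, t ω²; √b, -√b; p², -c)` (`seriesPhi`), where `ω` is a primitive cube root of
unity, and the four one-variable identities are equivalent forms of the same four evaluations.

*From three variables to one* (`summable_and_F_eq`, with `p` for the base of `F`). In the bookkeeping
variable `z`, the sum over `i` and `k` has the generating function `(s³ z³; p⁶)_∞ / (u z; p)_∞`, where
`w = s³`. In all four cases `u` and `u p` are `A` and `s = α A` in some order, so the factor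
`(s z; p²)_∞` cancels, and `(s ω z, s ω² z; p²)_∞ / (A z; p²)_∞` remains. Its coefficients are given
by the coefficient form of the `q`-Gauss summation (`qGauss_coeff`), which produces the numerators of
`Φ`; the remaining double sum is an Euler expansion of `(γ p ^ (4 k); p⁴)_∞`, hence
`F = (γ; p⁴)_∞ Φ(α, γ, A)`.

*Evaluation of `Φ`.* Three applications of Jackson's transformation turn `Φ` into a `₂φ₁` with
numerator parameters `√β ω, -√β ω` (`seriesA_eq_seriesPhi`); this is also the form in which two of the
one-variable identities are stated. A quadratic transformation of `1 / ((q; q)_N (-β; q)_N)`, proved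
by comparing `q`-difference equations of power series, passes from base `q` to base `q²`
(`seriesA_eq_tsum_coeffC`) and yields `∑ C_m a^m (l; q²)_m / (β²; q²)_m`, where `∑ C_m r^m` equals
`(β r ω, β r ω²; q²)_∞ / (r ω, r ω²; q²)_∞`. A series `∑ C_m a^m (l; q)_m / (a l; q)_m` with
`β a = q`, where `C_m` is now taken in base `q`, has a product evaluation (`tsum_coeffC_mul_div`):
for `|l| < 1`, expanding the quotient in powers of `l` merges the cube roots of unity into factorials
of base `q³`, summed by the `q`-binomial theorem; both sides being entire in `l`, the identity holds
everywhere.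

Two of the instances of `Φ` lead directly to this cubic summation. The other two are first written
by contiguous relations as combinations of two series, which become a single one after the change of
base, in one case through summation by parts against the recurrence for `C_m`
(`tsum_coeffC_by_parts`).
-/

namespace KanadeRussell

open Filter Topology
open Finset.HasAntidiagonal (antidiagonal)

/-! ### Finite and infinite `q`-shifted factorials -/

theorem qPoch_zero (a q : ℂ) : qPoch a q 0 = 1 := by simp [qPoch]

theorem qPoch_succ (a q : ℂ) (n : ℕ) : qPoch a q (n + 1) = qPoch a q n * (1 - a * q ^ n) := by
  simp [qPoch, Finset.prod_range_succ]

theorem qPoch_one (a q : ℂ) : qPoch a q 1 = 1 - a := by simp [qPoch]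

theorem qPoch_zero_left (q : ℂ) (n : ℕ) : qPoch 0 q n = 1 := by simp [qPoch]

theorem qPoch_add (a q : ℂ) (m n : ℕ) :
    qPoch a q (m + n) = qPoch a q m * qPoch (a * q ^ m) q n := by
  simp only [qPoch, Finset.prod_range_add]
  congr 1
  refine Finset.prod_congr rfl fun j _ => ?_
  ring

theorem qPoch_succ' (a q : ℂ) (n : ℕ) : qPoch a q (n + 1) = (1 - a) * qPoch (a * q) q n := by
  rw [add_comm, qPoch_add, qPoch_one, pow_one]

theorem tendsto_qPoch (a : ℂ) {q : ℂ} (hq : ‖q‖ < 1) :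
    Tendsto (qPoch a q) atTop (𝓝 (qPochInf a q)) :=
  (multipliable_qPochInf a hq).hasProd.tendsto_prod_nat

theorem tendsto_geom {q : ℂ} (hq : ‖q‖ < 1) : Tendsto (fun n : ℕ => q ^ n) atTop (𝓝 0) :=
  tendsto_pow_atTop_nhds_zero_of_norm_lt_one hq

theorem qPochInf_eq_mul (a : ℂ) {q : ℂ} (hq : ‖q‖ < 1) (n : ℕ) :
    qPochInf a q = qPoch a q n * qPochInf (a * q ^ n) q := by
  have h1 : Tendsto (fun m => qPoch a q (m + n)) atTop (𝓝 (qPochInf a q)) :=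
    (tendsto_add_atTop_iff_nat n).2 (tendsto_qPoch a hq)
  have h2 := (tendsto_qPoch (a * q ^ n) hq).const_mul (qPoch a q n)
  refine tendsto_nhds_unique h1 (h2.congr fun m => ?_)
  rw [add_comm m n, qPoch_add]

theorem qPochInf_succ (a : ℂ) {q : ℂ} (hq : ‖q‖ < 1) :
    qPochInf a q = (1 - a) * qPochInf (a * q) q := by
  simpa [qPoch_one] using qPochInf_eq_mul a hq 1

theorem mul_pow_ne_one {a q : ℂ} (hq : ‖q‖ < 1) (ha : ‖a‖ < 1) (n : ℕ) : a * q ^ n ≠ 1 := by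
  intro h
  have h1 : ‖a * q ^ n‖ = 1 := by rw [h, norm_one]
  rw [norm_mul, norm_pow] at h1
  have h2 : ‖q‖ ^ n ≤ 1 := pow_le_one₀ (norm_nonneg q) hq.le
  nlinarith [norm_nonneg a]

theorem qPoch_ne_zero {a q : ℂ} (h : ∀ n : ℕ, a * q ^ n ≠ 1) (n : ℕ) : qPoch a q n ≠ 0 := by
  rw [qPoch, Finset.prod_ne_zero_iff]
  exact fun j _ => sub_ne_zero.2 (h j).symm

theorem qPochInf_ne_zero {a q : ℂ} (hq : ‖q‖ < 1) (h : ∀ n : ℕ, a * q ^ n ≠ 1) :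
    qPochInf a q ≠ 0 := by
  have hs : Summable fun j : ℕ => ‖-(a * q ^ j)‖ := by
    simpa [norm_mul, norm_pow] using
      (summable_geometric_of_lt_one (norm_nonneg q) hq).mul_left ‖a‖
  have := tprod_one_add_ne_zero_of_summable (f := fun j : ℕ => -(a * q ^ j))
    (fun j => by simpa [← sub_eq_add_neg, sub_ne_zero] using (h j).symm) hs
  simpa [qPochInf, sub_eq_add_neg] using this

theorem qPoch_ne_zero_of_norm {a q : ℂ} (hq : ‖q‖ < 1) (ha : ‖a‖ < 1) (n : ℕ) :
    qPoch a q n ≠ 0 := qPoch_ne_zero (mul_pow_ne_one hq ha) n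

theorem qPochInf_ne_zero_of_norm {a q : ℂ} (hq : ‖q‖ < 1) (ha : ‖a‖ < 1) :
    qPochInf a q ≠ 0 := qPochInf_ne_zero hq (mul_pow_ne_one hq ha)

theorem exists_norm_qPoch_le (a : ℂ) {q : ℂ} (hq : ‖q‖ < 1) :
    ∃ C : ℝ, 0 < C ∧ ∀ n, ‖qPoch a q n‖ ≤ C := by
  obtain ⟨C, hC⟩ := (Metric.isBounded_range_of_tendsto _ (tendsto_qPoch a hq)).exists_norm_le
  exact ⟨max C 1, by positivity, fun n => (hC _ ⟨n, rfl⟩).trans (le_max_left _ _)⟩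

theorem exists_norm_inv_qPoch_le {a q : ℂ} (hq : ‖q‖ < 1) (h : ∀ n : ℕ, a * q ^ n ≠ 1) :
    ∃ C : ℝ, 0 < C ∧ ∀ n, ‖(qPoch a q n)⁻¹‖ ≤ C := by
  obtain ⟨C, hC⟩ := (Metric.isBounded_range_of_tendsto _
    ((tendsto_qPoch a hq).inv₀ (qPochInf_ne_zero hq h))).exists_norm_le
  exact ⟨max C 1, by positivity, fun n => (hC _ ⟨n, rfl⟩).trans (le_max_left _ _)⟩

/-! ### Dissections of infinite products -/

theorem norm_pow_lt_one {q : ℂ} (hq : ‖q‖ < 1) {n : ℕ} (hn : n ≠ 0) : ‖q ^ n‖ < 1 := by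
  rw [norm_pow]; exact pow_lt_one₀ (norm_nonneg q) hq hn

theorem qPochInf_two (a : ℂ) {q : ℂ} (hq : ‖q‖ < 1) :
    qPochInf a q = qPochInf a (q ^ 2) * qPochInf (a * q) (q ^ 2) := by
  have hq2 := norm_pow_lt_one hq (n := 2) (by norm_num)
  have h1 : Tendsto (fun m => qPoch a q (2 * m)) atTop (𝓝 (qPochInf a q)) :=
    (tendsto_qPoch a hq).comp (tendsto_id.const_mul_atTop' (by norm_num))
  refine tendsto_nhds_unique h1 (((tendsto_qPoch a hq2).mul (tendsto_qPoch (a * q) hq2)).congr ?_)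
  intro m
  induction m with
  | zero => simp [qPoch_zero]
  | succ m ih =>
    rw [show 2 * (m + 1) = 2 * m + 1 + 1 by ring, qPoch_succ a q (2 * m + 1),
      qPoch_succ a q (2 * m),
      ← ih, qPoch_succ, qPoch_succ]
    ring

theorem qPochInf_three (a : ℂ) {q : ℂ} (hq : ‖q‖ < 1) :
    qPochInf a q =
      qPochInf a (q ^ 3) * qPochInf (a * q) (q ^ 3) * qPochInf (a * q ^ 2) (q ^ 3) := by
  have hq3 := norm_pow_lt_one hq (n := 3) (by norm_num)
  have h1 : Tendsto (fun m => qPoch a q (3 * m)) atTop (𝓝 (qPochInf a q)) :=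
    (tendsto_qPoch a hq).comp (tendsto_id.const_mul_atTop' (by norm_num))
  refine tendsto_nhds_unique h1 ((((tendsto_qPoch a hq3).mul (tendsto_qPoch (a * q) hq3)).mul
    (tendsto_qPoch (a * q ^ 2) hq3)).congr ?_)
  intro m
  induction m with
  | zero => simp [qPoch_zero]
  | succ m ih =>
    rw [show 3 * (m + 1) = 3 * m + 1 + 1 + 1 by ring, qPoch_succ a q (3 * m + 1 + 1),
      qPoch_succ a q (3 * m + 1), qPoch_succ a q (3 * m),
      ← ih, qPoch_succ, qPoch_succ, qPoch_succ]
    ring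

theorem qPoch_mul_neg (a q : ℂ) (n : ℕ) :
    qPoch a q n * qPoch (-a) q n = qPoch (a ^ 2) (q ^ 2) n := by
  simp only [qPoch, ← Finset.prod_mul_distrib]
  refine Finset.prod_congr rfl fun j _ => ?_
  ring

theorem qPochInf_mul_neg (a : ℂ) {q : ℂ} (hq : ‖q‖ < 1) :
    qPochInf a q * qPochInf (-a) q = qPochInf (a ^ 2) (q ^ 2) :=
  tendsto_nhds_unique ((tendsto_qPoch a hq).mul (tendsto_qPoch (-a) hq))
    ((tendsto_qPoch (a ^ 2) (norm_pow_lt_one hq (by norm_num))).congr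
      fun n => (qPoch_mul_neg a q n).symm)

/-- The three cube roots of unity merge three `q`-shifted factorials into one of base `q ^ 3`. -/
theorem qPoch_cube {ω : ℂ} (hω : ω ^ 2 + ω + 1 = 0) (a q : ℂ) (n : ℕ) :
    qPoch a q n * (qPoch (a * ω) q n * qPoch (a * ω ^ 2) q n) = qPoch (a ^ 3) (q ^ 3) n := by
  simp only [qPoch, ← Finset.prod_mul_distrib]
  refine Finset.prod_congr rfl fun j _ => ?_
  linear_combination (-(a * q ^ j) + (a * q ^ j) ^ 2 * ω
    - (a * q ^ j) ^ 3 * (ω - 1)) * hω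

theorem qPochInf_cube {ω : ℂ} (hω : ω ^ 2 + ω + 1 = 0) (a : ℂ) {q : ℂ} (hq : ‖q‖ < 1) :
    qPochInf a q * (qPochInf (a * ω) q * qPochInf (a * ω ^ 2) q) = qPochInf (a ^ 3) (q ^ 3) :=
  tendsto_nhds_unique ((tendsto_qPoch a hq).mul
      ((tendsto_qPoch (a * ω) hq).mul (tendsto_qPoch (a * ω ^ 2) hq)))
    ((tendsto_qPoch (a ^ 3) (norm_pow_lt_one hq (by norm_num))).congr
      fun n => (qPoch_cube hω a q n).symm)

/-! ### Summability and rearrangement -/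

theorem summable_of_norm_le_geom {f : ℕ → ℂ} {C ρ : ℝ} (h0 : 0 ≤ ρ) (h1 : ρ < 1)
    (h : ∀ n, ‖f n‖ ≤ C * ρ ^ n) : Summable f :=
  Summable.of_norm_bounded ((summable_geometric_of_lt_one h0 h1).mul_left C) h

theorem summable_of_norm_le_geom₂ {f : ℕ × ℕ → ℂ} {C ρ σ : ℝ} (h0 : 0 ≤ ρ) (h1 : ρ < 1)
    (h2 : 0 ≤ σ) (h3 : σ < 1) (h : ∀ m n, ‖f (m, n)‖ ≤ C * (ρ ^ m * σ ^ n)) : Summable f := by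
  refine Summable.of_norm_bounded (g := fun x : ℕ × ℕ => C * (ρ ^ x.1 * σ ^ x.2)) ?_
    fun x => h x.1 x.2
  exact ((summable_geometric_of_lt_one h0 h1).mul_of_nonneg (summable_geometric_of_lt_one h2 h3)
    (fun n => pow_nonneg h0 n) (fun n => pow_nonneg h2 n)).mul_left C

/-- Summation of a double series along antidiagonals. -/
theorem tsum_antidiagonal {f : ℕ × ℕ → ℂ} (hf : Summable f) :
    ∑' N, ∑ x ∈ antidiagonal N, f x = ∑' x, f x := by
  rw [← Finset.HasAntidiagonal.sigmaAntidiagonalEquivProd.tsum_eq f]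
  have hs : Summable fun x : Σ n, antidiagonal n =>
      f (Finset.HasAntidiagonal.sigmaAntidiagonalEquivProd x) :=
    Finset.HasAntidiagonal.sigmaAntidiagonalEquivProd.summable_iff.2 hf
  rw [hs.tsum_sigma]
  refine tsum_congr fun N => ?_
  rw [tsum_fintype]
  exact (Finset.sum_coe_sort (antidiagonal N) f).symm

/-- Interchange of a double series, from antidiagonals to rows. -/
theorem tsum_antidiagonal_eq_tsum_tsum {f : ℕ × ℕ → ℂ} (hf : Summable f) :
    ∑' N, ∑ x ∈ antidiagonal N, f x = ∑' m, ∑' n, f (m, n) := by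
  rw [tsum_antidiagonal hf, hf.tsum_prod]

/-! ### The classical summations of Euler, Cauchy and Gauss -/

/-- A Gaussian factor `x ^ (n choose 2)` beats every geometric growth. -/
theorem exists_pow_choose_two_le {x : ℝ} (hx0 : 0 ≤ x) (hx : x < 1) {M : ℝ} (hM : 0 ≤ M) :
    ∃ C : ℝ, 0 < C ∧ ∀ n : ℕ, x ^ n.choose 2 * M ^ n ≤ C * (1 / 2) ^ n := by
  -- The sequence `b n = x ^ (n choose 2) (2 M) ^ n` has ratios tending to `0`, hence is bounded.
  have h0 : Tendsto (fun n : ℕ => x ^ n * (2 * M)) atTop (𝓝 0) := by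
    simpa using (tendsto_pow_atTop_nhds_zero_of_lt_one hx0 hx).mul_const (2 * M)
  obtain ⟨N, hN⟩ := eventually_atTop.1 (h0.eventually (gt_mem_nhds zero_lt_one))
  set b : ℕ → ℝ := fun n => x ^ n.choose 2 * (2 * M) ^ n with hb
  have hb0 : ∀ n, 0 ≤ b n := fun n => by positivity
  have hstep : ∀ n, b (n + 1) = b n * (x ^ n * (2 * M)) := by
    intro n
    simp only [hb, Nat.choose_succ_succ' n 1, Nat.choose_one_right, pow_add, pow_succ]
    ring
  have hle : ∀ n, b n ≤ ∑ i ∈ Finset.range (N + 1), b i := by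
    intro n
    induction n with
    | zero => exact Finset.single_le_sum (fun i _ => hb0 i) (by simp)
    | succ n ih =>
      rcases le_or_gt (n + 1) N with h | h
      · exact Finset.single_le_sum (f := b) (fun i _ => hb0 i) (by simp; omega)
      · rw [hstep]
        exact (mul_le_of_le_one_right (hb0 n) (hN n (by omega)).le).trans ih
  refine ⟨∑ i ∈ Finset.range (N + 1), b i + 1,
    by have := Finset.sum_nonneg (fun i (_ : i ∈ Finset.range (N + 1)) => hb0 i); linarith,
    fun n => ?_⟩
  have h2 : x ^ n.choose 2 * M ^ n = b n * (1 / 2) ^ n := by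
    simp only [hb, mul_pow, one_div, inv_pow]
    field_simp
  rw [h2]
  gcongr
  linarith [hle n]

/-- A power series tends to its constant term along `z q ^ N`. -/
theorem tendsto_tsum_mul_pow {c : ℕ → ℂ} {q z : ℂ} (hq : ‖q‖ < 1)
    (hc : Summable fun n => ‖c n * z ^ n‖) :
    Tendsto (fun N : ℕ => ∑' n, c n * (z * q ^ N) ^ n) atTop (𝓝 (c 0)) := by
  have h : Tendsto (fun N : ℕ => ∑' n, c n * (z * q ^ N) ^ n) atTop
      (𝓝 (∑' n, if n = 0 then c 0 else 0)) := by
    refine tendsto_tsum_of_dominated_convergence hc (fun n => ?_) (Eventually.of_forall ?_)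
    · rcases Nat.eq_zero_or_pos n with rfl | hn
      · simp
      · have h1 : Tendsto (fun N : ℕ => c n * (z * q ^ N) ^ n) atTop (𝓝 (c n * (z * 0) ^ n)) :=
          (((tendsto_geom hq).const_mul z).pow n).const_mul (c n)
        simpa [hn.ne'] using h1
    · intro N n
      rw [mul_pow, norm_mul, norm_mul, norm_mul, ← mul_assoc]
      refine mul_le_of_le_one_right (by positivity) ?_
      rw [norm_pow, norm_pow]
      exact pow_le_one₀ (by positivity) (pow_le_one₀ (norm_nonneg q) hq.le)
  simpa using h

theorem summable_qbinomial (a : ℂ) {q z : ℂ} (hq : ‖q‖ < 1) (hz : ‖z‖ < 1) :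
    Summable fun n => ‖qPoch a q n / qPoch q q n * z ^ n‖ := by
  obtain ⟨C, hC0, hC⟩ := exists_norm_qPoch_le a hq
  obtain ⟨K, hK0, hK⟩ := exists_norm_inv_qPoch_le hq (mul_pow_ne_one hq hq)
  refine Summable.of_nonneg_of_le (fun n => norm_nonneg _) (fun n => ?_)
    ((summable_geometric_of_lt_one (norm_nonneg z) hz).mul_left (C * K))
  rw [norm_mul, div_eq_mul_inv, norm_mul, norm_pow]
  gcongr
  exacts [hC n, hK n]

theorem qPoch_self_ne_zero {q : ℂ} (hq : ‖q‖ < 1) (n : ℕ) : qPoch q q n ≠ 0 :=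
  qPoch_ne_zero_of_norm hq hq n

theorem one_sub_pow_succ_ne_zero {q : ℂ} (hq : ‖q‖ < 1) (n : ℕ) : 1 - q ^ (n + 1) ≠ 0 := by
  have := sub_ne_zero.2 (mul_pow_ne_one hq hq n).symm
  rwa [← pow_succ'] at this

theorem qPoch_self_succ (q : ℂ) (n : ℕ) :
    qPoch q q (n + 1) = qPoch q q n * (1 - q ^ (n + 1)) := by
  rw [qPoch_succ, ← pow_succ']

/-- Cauchy's `q`-binomial theorem. -/
theorem qbinomial (a : ℂ) {q z : ℂ} (hq : ‖q‖ < 1) (hz : ‖z‖ < 1) :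
    ∑' n, qPoch a q n / qPoch q q n * z ^ n = qPochInf (a * z) q / qPochInf z q := by
  set c : ℕ → ℂ := fun n => qPoch a q n / qPoch q q n with hc
  have hzq : ∀ N : ℕ, ‖z * q ^ N‖ < 1 := fun N => by
    rw [norm_mul, norm_pow]
    exact mul_lt_one_of_nonneg_of_lt_one_left (norm_nonneg _) hz
      (pow_le_one₀ (norm_nonneg q) hq.le)
  have hs : ∀ y : ℂ, ‖y‖ < 1 → Summable fun n => c n * y ^ n := fun y hy =>
    (summable_qbinomial a hq hy).of_norm
  -- The `q`-difference equation of the series is iterated along `z q ^ N`, where the series tends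
  -- to its constant term.
  have hrec : ∀ y : ℂ, ‖y‖ < 1 → ‖y * q‖ < 1 →
      (1 - y) * ∑' n, c n * y ^ n = (1 - a * y) * ∑' n, c n * (y * q) ^ n := by
    intro y hy hyq
    have h1 : ∑' n, c n * y ^ n - ∑' n, c n * (y * q) ^ n
        = y * ∑' n, c n * y ^ n - a * y * ∑' n, c n * (y * q) ^ n := by
      rw [← (hs y hy).tsum_sub (hs _ hyq), ← tsum_mul_left, ← tsum_mul_left,
        ← ((hs y hy).mul_left y).tsum_sub ((hs _ hyq).mul_left (a * y)),
        ((hs y hy).sub (hs _ hyq)).tsum_eq_zero_add]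
      simp only [pow_zero, sub_self, zero_add]
      refine tsum_congr fun n => ?_
      have h2 := qPoch_self_ne_zero hq n
      have h4 := one_sub_pow_succ_ne_zero hq n
      simp only [hc]
      rw [qPoch_self_succ, qPoch_succ]
      field_simp
      ring
    linear_combination h1
  have hN : ∀ N : ℕ, qPoch z q N * ∑' n, c n * z ^ n
      = qPoch (a * z) q N * ∑' n, c n * (z * q ^ N) ^ n := by
    intro N
    induction N with
    | zero => simp [qPoch_zero]
    | succ N ih =>
      have := hrec (z * q ^ N) (hzq N) (by simpa [pow_succ, mul_assoc] using hzq (N + 1))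
      rw [mul_assoc z, ← pow_succ] at this
      rw [qPoch_succ, qPoch_succ]
      linear_combination (1 - z * q ^ N) * ih + qPoch (a * z) q N * this
  have h0 : c 0 = 1 := by simp [hc, qPoch_zero]
  have hlim := (tendsto_qPoch (a * z) hq).mul (tendsto_tsum_mul_pow hq (summable_qbinomial a hq hz))
  have := tendsto_nhds_unique ((tendsto_qPoch z hq).mul_const (∑' n, c n * z ^ n))
    (hlim.congr fun N => (hN N).symm)
  rw [eq_div_iff (qPochInf_ne_zero_of_norm hq hz)]
  change _ = _ * c 0 at this
  rw [h0] at this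
  linear_combination this

theorem summable_euler {q : ℂ} (hq : ‖q‖ < 1) (z : ℂ) :
    Summable fun n : ℕ => ‖(-1) ^ n * q ^ n.choose 2 / qPoch q q n * z ^ n‖ := by
  obtain ⟨C, hC0, hC⟩ := exists_pow_choose_two_le (norm_nonneg q) hq (norm_nonneg z)
  obtain ⟨K, hK0, hK⟩ := exists_norm_inv_qPoch_le hq (mul_pow_ne_one hq hq)
  refine Summable.of_nonneg_of_le (fun n => norm_nonneg _) (fun n => ?_)
    ((summable_geometric_of_lt_one (r := 1 / 2) (by norm_num) (by norm_num)).mul_left (K * C))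
  have : ‖(-1) ^ n * q ^ n.choose 2 / qPoch q q n * z ^ n‖
      = ‖(qPoch q q n)⁻¹‖ * (‖q‖ ^ n.choose 2 * ‖z‖ ^ n) := by
    simp only [norm_mul, norm_div, norm_pow, norm_neg, norm_one, one_pow, norm_inv]
    ring
  rw [this, mul_assoc]
  exact mul_le_mul (hK n) (hC n) (by positivity) hK0.le

/-- Euler's expansion of `(z; q)_∞`. -/
theorem euler {q : ℂ} (hq : ‖q‖ < 1) (z : ℂ) :
    ∑' n : ℕ, (-1) ^ n * q ^ n.choose 2 / qPoch q q n * z ^ n = qPochInf z q := by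
  set c : ℕ → ℂ := fun n => (-1) ^ n * q ^ n.choose 2 / qPoch q q n with hc
  have hs : ∀ y : ℂ, Summable fun n => c n * y ^ n := fun y => (summable_euler hq y).of_norm
  have hrec : ∀ y : ℂ, ∑' n, c n * y ^ n = (1 - y) * ∑' n, c n * (y * q) ^ n := by
    intro y
    have h1 : ∑' n, c n * y ^ n - ∑' n, c n * (y * q) ^ n = -y * ∑' n, c n * (y * q) ^ n := by
      rw [← (hs y).tsum_sub (hs _), ← tsum_mul_left, ((hs y).sub (hs _)).tsum_eq_zero_add]
      simp only [pow_zero, sub_self, zero_add]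
      refine tsum_congr fun n => ?_
      have h2 := qPoch_self_ne_zero hq n
      have h4 := one_sub_pow_succ_ne_zero hq n
      simp only [hc, Nat.choose_succ_succ' n 1, Nat.choose_one_right, qPoch_self_succ]
      field_simp
      ring
    linear_combination h1
  have hN : ∀ N : ℕ, ∑' n, c n * z ^ n = qPoch z q N * ∑' n, c n * (z * q ^ N) ^ n := by
    intro N
    induction N with
    | zero => simp [qPoch_zero]
    | succ N ih =>
      have := hrec (z * q ^ N)
      rw [mul_assoc z, ← pow_succ] at this
      rw [qPoch_succ]
      linear_combination ih + qPoch z q N * this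
  have h0 : c 0 = 1 := by simp [hc, qPoch_zero]
  have hlim := (tendsto_qPoch z hq).mul (tendsto_tsum_mul_pow hq (summable_euler hq z))
  have := tendsto_nhds_unique tendsto_const_nhds (hlim.congr fun N => (hN N).symm)
  change _ = _ * c 0 at this
  rw [this, h0, mul_one]

/-- Summation along an antidiagonal of an expression that telescopes. The function `g` is the
certificate, and the three hypotheses are `f k l = p k (l - 1) + g k (l - 1) - g (k - 1) l` with
the terms of negative index left out. -/
theorem sum_antidiagonal_succ_of_telescope {f p g : ℕ → ℕ → ℂ}
    (h00 : ∀ n, f 0 (n + 1) = p 0 n + g 0 n)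
    (h10 : ∀ k, f (k + 1) 0 = -g k 0)
    (h11 : ∀ k l, f (k + 1) (l + 1) = p (k + 1) l + g (k + 1) l - g k (l + 1)) (n : ℕ) :
    ∑ x ∈ antidiagonal (n + 1), f x.1 x.2 = ∑ x ∈ antidiagonal n, p x.1 x.2 := by
  have e1 : ∑ x ∈ antidiagonal (n + 1), (if x.1 = 0 then 0 else g (x.1 - 1) x.2)
      = ∑ x ∈ antidiagonal n, g x.1 x.2 := by
    rw [Finset.Nat.sum_antidiagonal_succ]; simp
  have e2 : ∑ x ∈ antidiagonal (n + 1), (if x.2 = 0 then 0 else p x.1 (x.2 - 1) + g x.1 (x.2 - 1))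
      = ∑ x ∈ antidiagonal n, (p x.1 x.2 + g x.1 x.2) := by
    rw [Finset.Nat.sum_antidiagonal_succ']; simp
  have e3 : ∑ x ∈ antidiagonal (n + 1), f x.1 x.2
      = ∑ x ∈ antidiagonal (n + 1), ((if x.2 = 0 then 0 else p x.1 (x.2 - 1) + g x.1 (x.2 - 1))
        - (if x.1 = 0 then 0 else g (x.1 - 1) x.2)) := by
    refine Finset.sum_congr rfl fun x hx => ?_
    obtain ⟨k, l⟩ := x
    have hkl : k + l = n + 1 := by simpa using hx
    rcases k with _ | k <;> rcases l with _ | l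
    · omega
    · simp [h00]
    · simp [h10]
    · simp [h11]
  rw [e3, Finset.sum_sub_distrib, e1, e2, Finset.sum_add_distrib]
  ring

/-- The coefficient form of the `q`-Gauss summation: both sides are the coefficient of `z ^ n` in
`(b z; q)_∞ (c z; q)_∞ / (z; q)_∞`. -/
theorem qGauss_coeff {q : ℂ} (hq : ‖q‖ < 1) (b c : ℂ) (n : ℕ) :
    ∑ x ∈ antidiagonal n, qPoch b q x.1 / qPoch q q x.1
        * ((-c) ^ x.2 * q ^ x.2.choose 2 / qPoch q q x.2)
      = ∑ x ∈ antidiagonal n, qPoch b q x.1 * qPoch c q x.1 / qPoch q q x.1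
        * ((-(b * c * q ^ x.1)) ^ x.2 * q ^ x.2.choose 2 / qPoch q q x.2) := by
  set L : ℂ → ℕ → ℕ → ℂ := fun c k l => qPoch b q k / qPoch q q k
        * ((-c) ^ l * q ^ l.choose 2 / qPoch q q l) with hL
  set R : ℂ → ℕ → ℕ → ℂ := fun c k l => qPoch b q k * qPoch c q k / qPoch q q k
        * ((-(b * c * q ^ k)) ^ l * q ^ l.choose 2 / qPoch q q l) with hR
  have hch : ∀ l : ℕ, (l + 1).choose 2 = l + l.choose 2 := fun l => by
    rw [Nat.choose_succ_succ' l 1, Nat.choose_one_right]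
  have hne : ∀ k : ℕ, 1 - q ^ (k + 1) ≠ 0 := one_sub_pow_succ_ne_zero hq
  have hLrec : ∀ c n, ∑ x ∈ antidiagonal (n + 1), (L c x.1 x.2 - L (c * q) x.1 x.2)
      = ∑ x ∈ antidiagonal n, -c * L (c * q) x.1 x.2 := by
    intro c n
    refine sum_antidiagonal_succ_of_telescope (f := fun k l => L c k l - L (c * q) k l)
      (p := fun k l => -c * L (c * q) k l) (g := fun _ _ => 0) (fun l => ?_) (fun k => ?_)
      (fun k l => ?_) n
    · have h2 := qPoch_self_ne_zero hq l
      have h4 := hne l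
      simp only [hL, hch, qPoch_self_succ, qPoch_zero]
      field_simp
      ring
    · simp [hL]
    · have h2 := qPoch_self_ne_zero hq l
      have h4 := hne l
      have h3 := qPoch_self_ne_zero hq (k + 1)
      simp only [hL, hch, qPoch_self_succ q l]
      field_simp
      ring
  have hRrec : ∀ c n, ∑ x ∈ antidiagonal (n + 1), (R c x.1 x.2 - R (c * q) x.1 x.2)
      = ∑ x ∈ antidiagonal n, -c * R (c * q) x.1 x.2 := by
    intro c n
    refine sum_antidiagonal_succ_of_telescope (f := fun k l => R c k l - R (c * q) k l)
      (p := fun k l => -c * R (c * q) k l)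
      (g := fun k l => c * qPoch b q (k + 1) * qPoch (c * q) q k / qPoch q q k
        * ((-(b * c * q ^ (k + 1))) ^ l * q ^ l.choose 2 / qPoch q q l)) (fun l => ?_)
      (fun k => ?_) (fun k l => ?_) n
    · have h2 := qPoch_self_ne_zero hq l
      have h4 := hne l
      simp only [hR, hch, qPoch_self_succ, zero_add, qPoch_one, qPoch_zero]
      field_simp
      ring
    · have h2 := qPoch_self_ne_zero hq k
      have h4 := hne k
      simp only [hR, qPoch_succ' c, qPoch_succ (c * q), qPoch_self_succ, qPoch_zero]
      field_simp
      ring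
    · have h2 := qPoch_self_ne_zero hq l
      have h4 := hne l
      have h5 := qPoch_self_ne_zero hq k
      have h6 := hne k
      simp only [hR, hch, qPoch_succ' c, qPoch_succ b, qPoch_succ (c * q), qPoch_self_succ]
      field_simp
      ring
  -- By induction on `n`, the difference of the two sides is invariant under `c ↦ c q`. It is
  -- continuous in `c` and vanishes at `c = 0`, hence everywhere.
  set d : ℕ → ℂ → ℂ := fun n c => ∑ x ∈ antidiagonal n, L c x.1 x.2
    - ∑ x ∈ antidiagonal n, R c x.1 x.2 with hd
  have hd0 : ∀ n, d n 0 = 0 := by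
    intro n
    simp only [hd, ← Finset.sum_sub_distrib]
    refine Finset.sum_eq_zero fun x _ => ?_
    simp only [hL, hR, qPoch_zero_left, neg_zero, mul_zero, zero_mul]
    ring
  have hcont : ∀ n, Continuous (d n) := by
    intro n
    simp only [hd, hL, hR, qPoch]
    fun_prop
  suffices h : ∀ n c, d n c = 0 from sub_eq_zero.1 (h n c)
  intro n
  induction n with
  | zero => intro c; simp [hd, hL, hR, qPoch_zero]
  | succ n ih =>
    have hstep : ∀ c, d (n + 1) c = d (n + 1) (c * q) := by
      intro c
      have h1 := hLrec c n
      have h2 := hRrec c n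
      have h3 := ih (c * q)
      simp only [hd] at h3 ⊢
      simp only [Finset.sum_sub_distrib, ← Finset.mul_sum] at h1 h2
      linear_combination h1 - h2 - c * h3
    intro c
    have hN : ∀ N : ℕ, d (n + 1) c = d (n + 1) (c * q ^ N) := by
      intro N
      induction N with
      | zero => simp
      | succ N ihN => rw [ihN, hstep, pow_succ, mul_assoc]
    have hlim : Tendsto (fun N : ℕ => d (n + 1) (c * q ^ N)) atTop (𝓝 (d (n + 1) (c * 0))) :=
      ((hcont (n + 1)).tendsto _).comp ((tendsto_geom hq).const_mul c)
    rw [mul_zero, hd0] at hlim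
    exact tendsto_nhds_unique (tendsto_const_nhds.congr hN) hlim

/-- The terms of Euler's series are dominated uniformly for `z` in a disc. -/
theorem exists_norm_euler_le {q : ℂ} (hq : ‖q‖ < 1) (M : ℝ) :
    ∃ C : ℝ, 0 < C ∧ ∀ (n : ℕ) (z : ℂ), ‖z‖ ≤ M →
      ‖(-1) ^ n * q ^ n.choose 2 / qPoch q q n * z ^ n‖ ≤ C * (1 / 2) ^ n := by
  obtain ⟨C, hC0, hC⟩ := exists_pow_choose_two_le (norm_nonneg q) hq (abs_nonneg M)
  obtain ⟨K, hK0, hK⟩ := exists_norm_inv_qPoch_le hq (mul_pow_ne_one hq hq)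
  refine ⟨K * C, by positivity, fun n z hz => ?_⟩
  have : ‖(-1) ^ n * q ^ n.choose 2 / qPoch q q n * z ^ n‖
      = ‖(qPoch q q n)⁻¹‖ * (‖q‖ ^ n.choose 2 * ‖z‖ ^ n) := by
    simp only [norm_mul, norm_div, norm_pow, norm_neg, norm_one, one_pow, norm_inv]
    ring
  rw [this, mul_assoc]
  refine mul_le_mul (hK n) ((mul_le_mul_of_nonneg_left ?_ (by positivity)).trans (hC n))
    (by positivity) hK0.le
  exact pow_le_pow_left₀ (norm_nonneg z) (hz.trans (le_abs_self M)) n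

/-- The `q`-Gauss summation, with the limit parameter written as an infinite product. -/
theorem qGauss {q z : ℂ} (hq : ‖q‖ < 1) (hz : ‖z‖ < 1) (b c : ℂ) :
    ∑' k, qPoch b q k * qPoch c q k / qPoch q q k * z ^ k * qPochInf (b * c * z * q ^ k) q
      = qPochInf (b * z) q * qPochInf (c * z) q / qPochInf z q := by
  set f : ℕ × ℕ → ℂ := fun x => qPoch b q x.1 / qPoch q q x.1 * z ^ x.1
    * ((-1) ^ x.2 * q ^ x.2.choose 2 / qPoch q q x.2 * (c * z) ^ x.2) with hf
  set g : ℕ × ℕ → ℂ := fun x => qPoch b q x.1 * qPoch c q x.1 / qPoch q q x.1 * z ^ x.1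
    * ((-1) ^ x.2 * q ^ x.2.choose 2 / qPoch q q x.2 * (b * c * z * q ^ x.1) ^ x.2) with hg
  have hfs : Summable f :=
    summable_mul_of_summable_norm (f := fun n => qPoch b q n / qPoch q q n * z ^ n)
      (g := fun n : ℕ => (-1) ^ n * q ^ n.choose 2 / qPoch q q n * (c * z) ^ n)
      (summable_qbinomial b hq hz) (summable_euler hq (c * z))
  have hgs : Summable g := by
    obtain ⟨B, hB0, hB⟩ := exists_norm_qPoch_le b hq
    obtain ⟨C, hC0, hC⟩ := exists_norm_qPoch_le c hq
    obtain ⟨K, hK0, hK⟩ := exists_norm_inv_qPoch_le hq (mul_pow_ne_one hq hq)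
    obtain ⟨E, hE0, hE⟩ := exists_norm_euler_le hq ‖b * c * z‖
    refine summable_of_norm_le_geom₂ (C := B * C * K * E) (norm_nonneg z) hz
      (σ := 1 / 2) (by norm_num) (by norm_num) fun k l => ?_
    have h1 : ‖b * c * z * q ^ k‖ ≤ ‖b * c * z‖ := by
      rw [norm_mul, norm_pow]
      exact mul_le_of_le_one_right (norm_nonneg _) (pow_le_one₀ (norm_nonneg q) hq.le)
    have h2 := hE l _ h1
    simp only [hg]
    rw [norm_mul, norm_mul, div_eq_mul_inv, norm_mul, norm_mul, norm_pow]
    calc _ ≤ B * C * K * ‖z‖ ^ k * (E * (1 / 2) ^ l) := by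
          gcongr
          exacts [hB k, hC k, hK k]
      _ = _ := by ring
  -- Compare the coefficients of `z ^ n`.
  have hfg : ∑' x, f x = ∑' x, g x := by
    rw [← tsum_antidiagonal hfs, ← tsum_antidiagonal hgs]
    refine tsum_congr fun n => ?_
    have h := congrArg (· * z ^ n) (qGauss_coeff hq b c n)
    simp only [Finset.sum_mul] at h
    convert h using 1 <;> refine Finset.sum_congr rfl fun x hx => ?_ <;>
      rw [← Finset.HasAntidiagonal.mem_antidiagonal.1 hx]
    · simp only [hf]
      rw [neg_pow c]
      ring
    · simp only [hg]
      rw [neg_pow (b * c * q ^ x.1)]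
      ring
  have h1 : ∑' x, f x = qPochInf (b * z) q * qPochInf (c * z) q / qPochInf z q := by
    rw [← tsum_mul_tsum_of_summable_norm (summable_qbinomial b hq hz) (summable_euler hq (c * z)),
      qbinomial b hq hz, euler hq]
    ring
  rw [← h1, hfg, hgs.tsum_prod]
  refine tsum_congr fun k => ?_
  simp only [hg]
  rw [tsum_mul_left, euler hq]

/-- The `q`-Chu–Vandermonde summation. -/
theorem qVandermonde {q : ℂ} (hq : ‖q‖ < 1) (b d : ℂ) (n : ℕ) :
    ∑ x ∈ antidiagonal n, qPoch d q x.1 * (-b) ^ x.1 * q ^ x.1.choose 2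
        * qPoch (b * d * q ^ x.1) q x.2 / (qPoch q q x.1 * qPoch q q x.2)
      = qPoch b q n / qPoch q q n := by
  set s : ℕ → ℕ → ℂ := fun k l => qPoch d q k * (-b) ^ k * q ^ k.choose 2
        * qPoch (b * d * q ^ k) q l / (qPoch q q k * qPoch q q l) with hs
  change ∑ x ∈ antidiagonal n, s x.1 x.2 = _
  have hch : ∀ l : ℕ, (l + 1).choose 2 = l + l.choose 2 := fun l => by
    rw [Nat.choose_succ_succ' l 1, Nat.choose_one_right]
  induction n with
  | zero => simp [hs, qPoch_zero]
  | succ n ih =>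
    -- The sum satisfies the first-order recurrence of `(b; q)_n / (q; q)_n`.
    have h := sum_antidiagonal_succ_of_telescope (f := fun k l => (1 - q ^ (k + l)) * s k l)
      (p := fun k l => (1 - b * q ^ (k + l)) * s k l)
      (g := fun k l => b * (-b) ^ k * qPoch d q (k + 1) * q ^ (k.choose 2 + k + l)
        * qPoch (b * d * q ^ k) q l / (qPoch q q k * qPoch q q l)) (fun l => ?_) (fun k => ?_)
      (fun k l => ?_) n
    · have e1 : ∑ x ∈ antidiagonal (n + 1), (1 - q ^ (x.1 + x.2)) * s x.1 x.2
          = (1 - q ^ (n + 1)) * ∑ x ∈ antidiagonal (n + 1), s x.1 x.2 := by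
        rw [Finset.mul_sum]
        exact Finset.sum_congr rfl fun x hx => by rw [Finset.HasAntidiagonal.mem_antidiagonal.1 hx]
      have e2 : ∑ x ∈ antidiagonal n, (1 - b * q ^ (x.1 + x.2)) * s x.1 x.2
          = (1 - b * q ^ n) * ∑ x ∈ antidiagonal n, s x.1 x.2 := by
        rw [Finset.mul_sum]
        exact Finset.sum_congr rfl fun x hx => by rw [Finset.HasAntidiagonal.mem_antidiagonal.1 hx]
      rw [e1, e2, ih] at h
      have h1 := qPoch_self_ne_zero hq n
      have h2 := one_sub_pow_succ_ne_zero hq n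
      rw [qPoch_succ, qPoch_self_succ, eq_div_iff (mul_ne_zero h1 h2)]
      field_simp at h
      linear_combination h
    · have h1 := qPoch_self_ne_zero hq l
      have h2 := one_sub_pow_succ_ne_zero hq l
      simp only [hs, qPoch_self_succ, zero_add, qPoch_zero, qPoch_one, pow_zero, mul_one,
        Nat.choose_zero_succ, qPoch_succ (b * d)]
      field_simp
      ring
    · have h1 := qPoch_self_ne_zero hq k
      have h2 := one_sub_pow_succ_ne_zero hq k
      simp only [hs, qPoch_self_succ, qPoch_zero, hch]
      field_simp
      ring
    · have h1 := qPoch_self_ne_zero hq k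
      have h2 := one_sub_pow_succ_ne_zero hq k
      have h3 := qPoch_self_ne_zero hq l
      have h4 := one_sub_pow_succ_ne_zero hq l
      simp only [hs, qPoch_self_succ, hch, qPoch_succ' (b * d * q ^ k),
        qPoch_succ (b * d * q ^ (k + 1)),
        qPoch_succ d, mul_assoc (b * d) (q ^ k) q, ← pow_succ q k]
      field_simp
      ring

/-! ### Jackson's transformation -/

/-- Jackson's transformation of a `₂φ₁` into a `₂φ₂`. -/
theorem jackson {q z : ℂ} (hq : ‖q‖ < 1) (hz : ‖z‖ < 1) (a b d : ℂ)
    (hbd : ∀ n : ℕ, b * d * q ^ n ≠ 1) :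
    qPochInf z q * ∑' n, qPoch a q n * qPoch b q n / (qPoch q q n * qPoch (b * d) q n) * z ^ n
      = ∑' k, qPoch a q k * qPoch d q k / (qPoch q q k * qPoch (b * d) q k)
        * ((-1) ^ k * q ^ k.choose 2) * (b * z) ^ k * qPochInf (a * z * q ^ k) q := by
  set f : ℕ × ℕ → ℂ := fun x => qPoch a q x.1 * qPoch d q x.1
        / (qPoch q q x.1 * qPoch (b * d) q x.1)
        * ((-1) ^ x.1 * q ^ x.1.choose 2) * (b * z) ^ x.1
        * (qPoch (a * q ^ x.1) q x.2 / qPoch q q x.2 * z ^ x.2) with hf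
  have hfs : Summable f := by
    obtain ⟨A, hA0, hA⟩ := exists_norm_qPoch_le a hq
    obtain ⟨B, hB0, hB⟩ := exists_norm_inv_qPoch_le hq hbd
    obtain ⟨D, hD0, hD⟩ := exists_norm_qPoch_le d hq
    obtain ⟨K, hK0, hK⟩ := exists_norm_inv_qPoch_le hq (mul_pow_ne_one hq hq)
    obtain ⟨E, hE0, hE⟩ := exists_norm_euler_le hq ‖b * z‖
    refine summable_of_norm_le_geom₂ (C := D * B * E * A * K) (ρ := 1 / 2) (by norm_num)
      (by norm_num) (norm_nonneg z) hz fun k l => ?_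
    have h2 := hE k _ le_rfl
    have h3 : f (k, l) = qPoch d q k * (qPoch (b * d) q k)⁻¹
        * ((-1) ^ k * q ^ k.choose 2 / qPoch q q k * (b * z) ^ k)
        * (qPoch a q (k + l) * (qPoch q q l)⁻¹ * z ^ l) := by
      simp only [hf, qPoch_add]
      ring
    rw [h3]
    calc _ = ‖qPoch d q k‖ * ‖(qPoch (b * d) q k)⁻¹‖
        * ‖(-1) ^ k * q ^ k.choose 2 / qPoch q q k * (b * z) ^ k‖
        * (‖qPoch a q (k + l)‖ * ‖(qPoch q q l)⁻¹‖ * ‖z‖ ^ l) := by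
          simp only [norm_mul, norm_pow]
      _ ≤ D * B * (E * (1 / 2) ^ k) * (A * K * ‖z‖ ^ l) := by
          gcongr
          exacts [hD k, hB k, hA _, hK l]
      _ = _ := by ring
  -- Expand `(b; q)_n / (q; q)_n` by the `q`-Chu–Vandermonde summation and interchange the sums.
  have h1 : ∑' n, qPoch a q n * qPoch b q n / (qPoch q q n * qPoch (b * d) q n) * z ^ n
      = ∑' x, f x := by
    rw [← tsum_antidiagonal hfs]
    refine tsum_congr fun n => ?_
    have hn := qPoch_ne_zero hbd n
    have h := congrArg (· * (qPoch a q n / qPoch (b * d) q n * z ^ n)) (qVandermonde hq b d n)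
    simp only [Finset.sum_mul] at h
    calc _ = _ := by ring
      _ = _ := h.symm
      _ = _ := Finset.sum_congr rfl fun x hx => ?_
    rw [← Finset.HasAntidiagonal.mem_antidiagonal.1 hx] at hn ⊢
    rw [qPoch_add (b * d)] at hn
    have hn1 := left_ne_zero_of_mul hn
    have hn2 := right_ne_zero_of_mul hn
    have hn3 := qPoch_self_ne_zero hq x.1
    have hn4 := qPoch_self_ne_zero hq x.2
    simp only [hf]
    rw [qPoch_add (b * d), qPoch_add a, neg_pow b]
    field_simp
    ring
  rw [h1, hfs.tsum_prod, ← tsum_mul_left]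
  refine tsum_congr fun k => ?_
  simp only [hf]
  rw [tsum_mul_left, qbinomial _ hq hz]
  have := qPochInf_ne_zero_of_norm hq hz
  rw [show a * q ^ k * z = a * z * q ^ k by ring]
  field_simp

/-! ### Power series and `q`-difference equations -/

theorem rescale_C (q a : ℂ) :
    PowerSeries.rescale q (PowerSeries.C a) = PowerSeries.C a := by
  ext m
  rcases m with _ | m <;> simp [PowerSeries.coeff_rescale, PowerSeries.coeff_C]

theorem constantCoeff_rescale (q : ℂ) (G : PowerSeries ℂ) :
    PowerSeries.constantCoeff (PowerSeries.rescale q G) = PowerSeries.constantCoeff G := by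
  rw [← PowerSeries.coeff_zero_eq_constantCoeff_apply, PowerSeries.coeff_rescale]
  simp

/-- Power series solutions of a linear `q`-difference equation of order at most two are
determined by their constant coefficient, if the polynomial `P₀(0) - P₁(0) x - P₂(0) x ^ 2` has no
root among the positive powers of `q`. -/
theorem eq_zero_of_rescale {q : ℂ} {P₀ P₁ P₂ H : PowerSeries ℂ}
    (h : P₀ * H = P₁ * PowerSeries.rescale q H
      + P₂ * PowerSeries.rescale q (PowerSeries.rescale q H))
    (h0 : PowerSeries.constantCoeff H = 0)
    (hn : ∀ n : ℕ, PowerSeries.constantCoeff P₀ - PowerSeries.constantCoeff P₁ * q ^ (n + 1)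
      - PowerSeries.constantCoeff P₂ * (q ^ (n + 1)) ^ 2 ≠ 0) : H = 0 := by
  have key : ∀ n : ℕ, (PowerSeries.X : PowerSeries ℂ) ^ (n + 1) ∣ H := by
    intro n
    induction n with
    | zero => simpa [PowerSeries.X_dvd_iff] using h0
    | succ n ih =>
      obtain ⟨K, rfl⟩ := ih
      have e1 : PowerSeries.rescale q (PowerSeries.X ^ (n + 1) * K)
          = PowerSeries.X ^ (n + 1) * (PowerSeries.C (q ^ (n + 1)) * PowerSeries.rescale q K) := by
        rw [map_mul, map_pow, PowerSeries.rescale_X, mul_pow, map_pow]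
        ring
      have e2 : PowerSeries.rescale q (PowerSeries.rescale q (PowerSeries.X ^ (n + 1) * K))
          = PowerSeries.X ^ (n + 1) * (PowerSeries.C ((q ^ (n + 1)) ^ 2)
            * PowerSeries.rescale q (PowerSeries.rescale q K)) := by
        rw [e1, map_mul, map_mul, map_pow, PowerSeries.rescale_X, rescale_C, mul_pow]
        simp only [map_pow]
        ring
      rw [e2, e1] at h
      have h' : P₀ * K = P₁ * (PowerSeries.C (q ^ (n + 1)) * PowerSeries.rescale q K)
          + P₂ * (PowerSeries.C ((q ^ (n + 1)) ^ 2)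
            * PowerSeries.rescale q (PowerSeries.rescale q K)) := by
        have hX : (PowerSeries.X : PowerSeries ℂ) ^ (n + 1) ≠ 0 :=
          pow_ne_zero _ PowerSeries.X_ne_zero
        apply mul_left_cancel₀ hX
        linear_combination h
      have hc := congrArg PowerSeries.constantCoeff h'
      simp only [map_mul, map_add, constantCoeff_rescale, PowerSeries.constantCoeff_C] at hc
      have hK : PowerSeries.constantCoeff K = 0 := by
        have : (PowerSeries.constantCoeff P₀ - PowerSeries.constantCoeff P₁ * q ^ (n + 1)
            - PowerSeries.constantCoeff P₂ * (q ^ (n + 1)) ^ 2) * PowerSeries.constantCoeff K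
              = 0 := by
          linear_combination hc
        exact (mul_eq_zero.1 this).resolve_left (hn n)
      obtain ⟨G, rfl⟩ := PowerSeries.X_dvd_iff.2 hK
      exact ⟨G, by ring⟩
  ext n
  exact PowerSeries.X_pow_dvd_iff.1 (key n) n (Nat.lt_succ_self n)

/-! ### Two series and the transformation connecting them -/

/-- The series `(t ω²; q)_∞ · ₂φ₁(√β ω, -√β ω; -β; q, t ω²)`, written without the square root
of `β`. -/
noncomputable def seriesA (ω q β t : ℂ) : ℂ :=
  qPochInf (t * ω ^ 2) q
    * ∑' N, qPoch (β * ω ^ 2) (q ^ 2) N / (qPoch q q N * qPoch (-β) q N) * (t * ω ^ 2) ^ N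

/-- The `k`-th term of `₂φ₂(t ω, t ω²; √b, -√b; q, -c)`, written without the square root of `b`. -/
noncomputable def termPhi (ω q t b c : ℂ) (k : ℕ) : ℂ :=
  qPoch (t * ω) q k * qPoch (t * ω ^ 2) q k / (qPoch q q k * qPoch b (q ^ 2) k)
    * (c ^ k * q ^ k.choose 2)

/-- The series `₂φ₂(t ω, t ω²; √b, -√b; q, -c)`. -/
noncomputable def seriesPhi (ω q t b c : ℂ) : ℂ := ∑' k, termPhi ω q t b c k

theorem norm_omega {ω : ℂ} (hω : ω ^ 2 + ω + 1 = 0) : ‖ω‖ = 1 := by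
  have h3 : ω ^ 3 = 1 := by linear_combination (ω - 1) * hω
  exact (isOfFinOrder_iff_pow_eq_one.2 ⟨3, by norm_num, h3⟩).norm_eq_one

/-- The transformation of `seriesA_eq_seriesPhi` with `β = s ^ 2`. -/
theorem seriesA_mul_eq {ω q s t : ℂ} (hω : ω ^ 2 + ω + 1 = 0) (hq : ‖q‖ < 1) (hs : ‖s‖ < 1)
    (ht : ‖t‖ < 1) :
    qPochInf (-s ^ 2) q * seriesA ω q (s ^ 2) t
      = qPochInf (s ^ 2 * t ^ 2) (q ^ 2) * seriesPhi ω q t (s ^ 2 * t ^ 2) (s ^ 2) := by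
  have h3 : ω ^ 3 = 1 := by linear_combination (ω - 1) * hω
  have hn := norm_omega hω
  have hβ : ‖-s ^ 2‖ < 1 := by
    rw [norm_neg]; exact norm_pow_lt_one hs two_ne_zero
  have hst : ‖s * t‖ < 1 := by
    rw [norm_mul]; exact mul_lt_one_of_nonneg_of_lt_one_left (norm_nonneg _) hs ht.le
  have hst' : ‖-(s * t)‖ < 1 := by rwa [norm_neg]
  -- The first use of Jackson's transformation expands in `t ω²`. The second and the third read the
  -- resulting series as one in `-s ω²`, with the two numerator parameters in either order.
  have j1 := jackson hq (z := t * ω ^ 2) (by simpa [hn] using ht) (s * ω) (-(s * ω)) (s * ω ^ 2)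
    (by rw [show -(s * ω) * (s * ω ^ 2) = -s ^ 2 by linear_combination (-s ^ 2) * h3]
        exact mul_pow_ne_one hq hβ)
  have j2 := jackson hq (z := -s * ω ^ 2) (by simpa [hn] using hs) (s * ω) (t * ω) (s * ω ^ 2)
    (by rw [show t * ω * (s * ω ^ 2) = s * t by linear_combination s * t * h3]
        exact mul_pow_ne_one hq hst)
  have j3 := jackson hq (z := -s * ω ^ 2) (by simpa [hn] using hs) (t * ω) (s * ω) (t * ω ^ 2)
    (by rw [show s * ω * (t * ω ^ 2) = s * t by linear_combination s * t * h3]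
        exact mul_pow_ne_one hq hst)
  rw [show -(s * ω) * (s * ω ^ 2) = -s ^ 2 by linear_combination (-s ^ 2) * h3,
    show s * ω * (t * ω ^ 2) = s * t by linear_combination s * t * h3,
    show -(s * ω) * (t * ω ^ 2) = -(s * t) by linear_combination (-s * t) * h3] at j1
  rw [show t * ω * (s * ω ^ 2) = s * t by linear_combination s * t * h3,
    show s * ω * (-s * ω ^ 2) = -s ^ 2 by linear_combination (-s ^ 2) * h3,
    show t * ω * (-s * ω ^ 2) = -(s * t) by linear_combination (-s * t) * h3] at j2
  rw [show s * ω * (t * ω ^ 2) = s * t by linear_combination s * t * h3,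
    show s * ω * (-s * ω ^ 2) = -s ^ 2 by linear_combination (-s ^ 2) * h3,
    show t * ω * (-s * ω ^ 2) = -(s * t) by linear_combination (-s * t) * h3] at j3
  have e1 : seriesA ω q (s ^ 2) t = qPochInf (t * ω ^ 2) q * ∑' n, qPoch (s * ω) q n
      * qPoch (-(s * ω)) q n / (qPoch q q n * qPoch (-s ^ 2) q n) * (t * ω ^ 2) ^ n := by
    simp only [seriesA, qPoch_mul_neg, mul_pow s ω 2]
  have e2 : qPochInf (-s ^ 2) q * seriesA ω q (s ^ 2) t = qPochInf (s * t) q *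
      (qPochInf (-s * ω ^ 2) q * ∑' n, qPoch (s * ω) q n
      * qPoch (t * ω) q n / (qPoch q q n * qPoch (s * t) q n) * (-s * ω ^ 2) ^ n) := by
    rw [e1, j1, j2, ← tsum_mul_left, ← tsum_mul_left]
    refine tsum_congr fun k => ?_
    rw [qPochInf_eq_mul (s * t) hq k, qPochInf_eq_mul (-s ^ 2) hq k]
    have h1 := qPoch_ne_zero_of_norm hq hβ k
    have h2 := qPoch_ne_zero_of_norm hq hst k
    have h4 := qPoch_self_ne_zero hq k
    field_simp
  have e3 : qPochInf (-s * ω ^ 2) q * ∑' n, qPoch (s * ω) q n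
      * qPoch (t * ω) q n / (qPoch q q n * qPoch (s * t) q n) * (-s * ω ^ 2) ^ n
      = qPochInf (-(s * t)) q * seriesPhi ω q t (s ^ 2 * t ^ 2) (s ^ 2) := by
    simp only [mul_comm (qPoch (s * ω) q _)]
    rw [j3, seriesPhi, ← tsum_mul_left]
    refine tsum_congr fun k => ?_
    rw [termPhi, qPochInf_eq_mul (-(s * t)) hq k, ← mul_pow s t 2, ← qPoch_mul_neg]
    have h1 := qPoch_ne_zero_of_norm hq hst' k
    have h2 := qPoch_ne_zero_of_norm hq hst k
    have h4 := qPoch_self_ne_zero hq k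
    rw [neg_pow (s ^ 2)]
    have h5 : (-1 : ℂ) ^ k * (-1) ^ k = 1 := by rw [← mul_pow]; simp
    calc _ = ((-1) ^ k * (-1) ^ k) * (qPoch (t * ω) q k * qPoch (t * ω ^ 2) q k
          / (qPoch q q k * qPoch (s * t) q k) * q ^ k.choose 2 * (s ^ 2) ^ k
          * qPochInf (-(s * t) * q ^ k) q) := by ring
      _ = _ := by
        rw [h5]
        generalize s * t = x at *
        field_simp
  rw [e2, e3, ← mul_pow s t 2, ← qPochInf_mul_neg _ hq]
  ring

/-- A transformation between the two series, obtained by applying Jackson's transformation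
three times. -/
theorem seriesA_eq_seriesPhi {ω q β b t : ℂ} (hω : ω ^ 2 + ω + 1 = 0) (hq : ‖q‖ < 1)
    (hβ : ‖β‖ < 1) (ht : ‖t‖ < 1) (hb : β * t ^ 2 = b) :
    qPochInf (-β) q * seriesA ω q β t = qPochInf b (q ^ 2) * seriesPhi ω q t b β := by
  obtain ⟨s, rfl⟩ := IsAlgClosed.exists_pow_nat_eq β two_pos
  have hs : ‖s‖ < 1 := by
    rw [norm_pow] at hβ
    exact lt_of_pow_lt_pow_left₀ 2 zero_le_one (by simpa using hβ)
  rw [← hb]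
  exact seriesA_mul_eq hω hq hs ht

/-- The coefficient of `r ^ m` in `(β r ω, β r ω²; q)_∞ / (r ω, r ω²; q)_∞`, as the finite sum which
results from the `q`-Gauss summation and the `q`-binomial theorem. -/
noncomputable def coeffC (ω q β : ℂ) (m : ℕ) : ℂ :=
  ∑ x ∈ antidiagonal m, qPoch β q x.1 * qPoch (β * ω ^ 2) q x.1 * ω ^ (2 * x.1 + x.2)
    * qPoch (β ^ 2 * q ^ x.1) q x.2 / (qPoch q q x.1 * qPoch q q x.2)

open PowerSeries in
/-- The quadratic transformation behind the passage from base `q` to base `q ^ 2`. The hypotheses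
on `e` and `s` say that they are `1` and `q` in some order. Both sides are the coefficients of a
power series solution of the same second-order equation in base `q ^ 2`. -/
theorem inv_qPoch_mul_qPoch_neg {q β e s l : ℂ} (hq0 : q ≠ 0) (hq : ‖q‖ < 1) (hβ : ‖β‖ < 1)
    (hes : e * s = q) (hes' : e + s = 1 + q) (hl : s * l = β * e) (N : ℕ) :
    1 / (qPoch q q N * qPoch (-β) q N) = ∑ x ∈ antidiagonal N,
      qPoch l (q ^ 2) x.1 * qPoch β (q ^ 2) x.1
        / (qPoch (q ^ 2) (q ^ 2) x.1 * qPoch (β ^ 2) (q ^ 2) x.1) * s ^ x.1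
        * (e ^ x.2 / qPoch (q ^ 2) (q ^ 2) x.2) := by
  have hβ' : ‖-β‖ < 1 := by rwa [norm_neg]
  have hβ2 := norm_pow_lt_one hβ two_ne_zero
  have hQ := norm_pow_lt_one hq two_ne_zero
  set f : PowerSeries ℂ := mk fun n => 1 / (qPoch q q n * qPoch (-β) q n) with hf
  set φ : PowerSeries ℂ := mk fun n => qPoch l (q ^ 2) n * qPoch β (q ^ 2) n
        / (qPoch (q ^ 2) (q ^ 2) n * qPoch (β ^ 2) (q ^ 2) n) * s ^ n with hφ
  set E : PowerSeries ℂ := mk fun n => e ^ n / qPoch (q ^ 2) (q ^ 2) n with hE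
  have hfrec : C q * f - C q * (X * f) = C (q - β) * rescale q f
      + C β * rescale q (rescale q f) := by
    ext n
    rcases n with _ | n
    · simp [hf, qPoch_zero, constantCoeff_rescale]
    · simp only [hf, map_sub, map_add, sub_mul, coeff_C_mul, coeff_succ_X_mul, coeff_rescale,
        coeff_mk, qPoch_self_succ, qPoch_succ (-β)]
      have h1 := qPoch_self_ne_zero hq n
      have h2 := one_sub_pow_succ_ne_zero hq n
      have h3 := qPoch_ne_zero_of_norm hq hβ' n
      have h4 : 1 - -β * q ^ n ≠ 0 := sub_ne_zero.2 (mul_pow_ne_one hq hβ' n).symm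
      simp only [pow_succ'] at h2 ⊢
      generalize qPoch (-β) q n = y at *
      generalize q ^ n = x at *
      rw [neg_mul, sub_neg_eq_add] at h4 ⊢
      obtain ⟨w, hw⟩ : ∃ w, w = 1 + β * x := ⟨_, rfl⟩
      rw [← hw] at h4 ⊢
      field_simp
      rw [hw]
      ring
  have hφrec : C (q ^ 2) * φ - C (q ^ 2 * s) * (X * φ)
      = C (q ^ 2 + β ^ 2) * rescale (q ^ 2) φ
        - C (q ^ 2 * s * (l + β)) * (X * rescale (q ^ 2) φ)
        - C (β ^ 2) * rescale (q ^ 2) (rescale (q ^ 2) φ)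
        + C (s * l * β * q ^ 2) * (X * rescale (q ^ 2) (rescale (q ^ 2) φ)) := by
    ext n
    rcases n with _ | n
    · simp [hφ, qPoch_zero, constantCoeff_rescale]
    · simp only [hφ, map_sub, map_add, add_mul, coeff_C_mul, coeff_succ_X_mul, coeff_rescale,
        coeff_mk, qPoch_self_succ, qPoch_succ (β ^ 2), qPoch_succ β, qPoch_succ l]
      have h1 := qPoch_self_ne_zero hQ n
      have h2 := one_sub_pow_succ_ne_zero hQ n
      have h3 := qPoch_ne_zero_of_norm hQ hβ2 n
      have h4 : 1 - (q ^ 2) ^ n * β ^ 2 ≠ 0 := by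
        rw [mul_comm]; exact sub_ne_zero.2 (mul_pow_ne_one hQ hβ2 n).symm
      generalize q ^ 2 = Q at *
      field_simp
      ring
  have hErec : rescale (q ^ 2) E = E - C e * (X * E) := by
    ext n
    rcases n with _ | n
    · simp [hE, qPoch_zero]
    · simp only [hE, map_sub, coeff_C_mul, coeff_succ_X_mul, coeff_rescale, coeff_mk,
        qPoch_self_succ]
      have h1 := qPoch_self_ne_zero hQ n
      have h2 := one_sub_pow_succ_ne_zero hQ n
      generalize q ^ 2 = Q at *
      field_simp
      ring
  have hErec2 : rescale (q ^ 2) (rescale (q ^ 2) E) = rescale (q ^ 2) E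
      - C (e * q ^ 2) * (X * rescale (q ^ 2) E) := by
    conv_lhs => rw [hErec]
    simp only [map_sub, map_mul, rescale_C, rescale_X]
    ring
  have hrr : ∀ G : PowerSeries ℂ, rescale q (rescale q G) = rescale (q ^ 2) G := fun G => by
    rw [rescale_rescale, pow_two]
  have hf1 := congrArg (rescale q) hfrec
  have hf2 := congrArg (rescale q) hf1
  simp only [map_sub, map_add, map_mul, rescale_C, rescale_X, hrr] at hf1 hf2 hfrec
  -- The equation of `f` in base `q`, applied three times, eliminates the odd iterates.
  have hff : C (q ^ 2) * ((1 - X) * (1 - C q * X)) * f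
      = (C (q ^ 2 + β ^ 2) - C (q ^ 2 * β * (1 + q)) * X) * rescale (q ^ 2) f
        + C (-β ^ 2) * rescale (q ^ 2) (rescale (q ^ 2) f) := by
    simp only [map_add, map_mul, map_pow, map_neg, map_one]
    linear_combination C q * (1 - C q * X) * hfrec + (C q - C β) * hf1 - C β * hf2
  -- The product of `φ` and `E` satisfies the same equation.
  have hψ : C (q ^ 2) * ((1 - X) * (1 - C q * X)) * (φ * E)
      = (C (q ^ 2 + β ^ 2) - C (q ^ 2 * β * (1 + q)) * X) * rescale (q ^ 2) (φ * E)
        + C (-β ^ 2) * rescale (q ^ 2) (rescale (q ^ 2) (φ * E)) := by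
    have c1 : (C e : PowerSeries ℂ) * C s = C q := by rw [← map_mul, hes]
    have c2 : (C e : PowerSeries ℂ) + C s = 1 + C q := by rw [← map_add, hes', map_add, map_one]
    have c3 : (C s : PowerSeries ℂ) * C l = C β * C e := by rw [← map_mul, hl, map_mul]
    simp only [map_add, map_mul, map_pow, map_neg, map_one] at hφrec hErec hErec2 ⊢
    rw [hErec2]
    linear_combination (1 - C e * X) * E * hφrec
      - ((C q ^ 2 + C β ^ 2) * rescale (q ^ 2) φ
        - C q ^ 2 * C s * (C l + C β) * (X * rescale (q ^ 2) φ)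
        - C β ^ 2 * rescale (q ^ 2) (rescale (q ^ 2) φ)
        + C s * C l * C β * C q ^ 2 * (X * rescale (q ^ 2) (rescale (q ^ 2) φ))) * hErec
      + C q ^ 2 * (φ * E) * (X * c2 - X ^ 2 * c1)
      - C q ^ 2 * X * (rescale (q ^ 2) E * rescale (q ^ 2) φ) * (c3 + C β * c2)
      + C q ^ 2 * C β * X * (rescale (q ^ 2) E * rescale (q ^ 2) (rescale (q ^ 2) φ)) * c3
  have hzero : f - φ * E = 0 := by
    refine eq_zero_of_rescale (q := q ^ 2) (P₀ := C (q ^ 2) * ((1 - X) * (1 - C q * X)))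
      (P₁ := C (q ^ 2 + β ^ 2) - C (q ^ 2 * β * (1 + q)) * X) (P₂ := C (-β ^ 2)) ?_ ?_ ?_
    · rw [map_sub, map_sub]
      linear_combination hff - hψ
    · simp [hf, hφ, hE, qPoch_zero]
    · intro n
      have h2 := one_sub_pow_succ_ne_zero hQ n
      have h4 : 1 - β ^ 2 * (q ^ 2) ^ n ≠ 0 := sub_ne_zero.2 (mul_pow_ne_one hQ hβ2 n).symm
      have := mul_ne_zero (mul_ne_zero (pow_ne_zero 2 hq0) h2) h4
      simp only [map_sub, map_mul, constantCoeff_C, constantCoeff_X, map_one]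
      intro h
      apply this
      rw [← h]
      ring
  have := congrArg (coeff N) (sub_eq_zero.1 hzero)
  rw [coeff_mul] at this
  simpa only [hf, hφ, hE, coeff_mk] using this

/-! ### The coefficients `coeffC` and the change of base -/

/-- A bound on `(a; q)_n` uniform in `n` and in `a` from a disc; `(-R; |q|)_∞` dominates. -/
theorem exists_norm_qPoch_le_of_norm_le (R : ℝ) {q : ℂ} (hq : ‖q‖ < 1) :
    ∃ C : ℝ, 0 < C ∧ ∀ a : ℂ, ‖a‖ ≤ R → (∀ n, ‖qPoch a q n‖ ≤ C) ∧ ‖qPochInf a q‖ ≤ C := by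
  have hq' : ‖((‖q‖ : ℝ) : ℂ)‖ < 1 := by simpa using hq
  obtain ⟨C, hC0, hC⟩ := exists_norm_qPoch_le (-(R : ℂ)) hq'
  refine ⟨C, hC0, fun a ha => ?_⟩
  have hR : 0 ≤ R := (norm_nonneg a).trans ha
  have h : ∀ n, ‖qPoch a q n‖ ≤ C := by
    intro n
    refine le_trans ?_ (hC n)
    rw [qPoch, qPoch, norm_prod, norm_prod]
    refine Finset.prod_le_prod (fun _ _ => norm_nonneg _) fun j _ => ?_
    have e : (1 - -(R : ℂ) * (‖q‖ : ℂ) ^ j) = ((1 + R * ‖q‖ ^ j : ℝ) : ℂ) := by push_cast; ring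
    rw [e, Complex.norm_real, Real.norm_of_nonneg (by positivity)]
    refine (norm_sub_le _ _).trans ?_
    rw [norm_one, norm_mul, norm_pow]
    gcongr
  exact ⟨h, le_of_tendsto (tendsto_qPoch a hq).norm (Eventually.of_forall h)⟩

theorem summable_norm_antidiagonal {f : ℕ × ℕ → ℂ} (hf : Summable f) :
    Summable fun n => ‖∑ x ∈ antidiagonal n, f x‖ := by
  have hs : Summable fun x : Σ n, antidiagonal n =>
      ‖f (Finset.HasAntidiagonal.sigmaAntidiagonalEquivProd x)‖ :=
    (Finset.HasAntidiagonal.sigmaAntidiagonalEquivProd.summable_iff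
      (f := fun x => ‖f x‖)).2 hf.norm
  refine Summable.of_nonneg_of_le (fun _ => norm_nonneg _) (fun n => ?_) hs.sigma
  rw [tsum_fintype]
  exact (norm_sum_le _ _).trans (Finset.sum_coe_sort (antidiagonal n) fun x => ‖f x‖).ge

theorem differentiable_qPochInf {q : ℂ} (hq : ‖q‖ < 1) :
    Differentiable ℂ fun z => qPochInf z q := by
  intro z
  obtain ⟨C, hC0, hC⟩ := exists_norm_euler_le hq (‖z‖ + 1)
  have h : DifferentiableOn ℂ
      (fun z => ∑' n : ℕ, (-1) ^ n * q ^ n.choose 2 / qPoch q q n * z ^ n)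
      (Metric.ball 0 (‖z‖ + 1)) := by
    refine Complex.differentiableOn_tsum_of_summable_norm
      (u := fun n => C * (1 / 2) ^ n)
      ((summable_geometric_of_lt_one (by norm_num) (by norm_num)).mul_left C)
      (fun n => by fun_prop) Metric.isOpen_ball fun n w hw => hC n w ?_
    exact (mem_ball_zero_iff.1 hw).le
  simp only [euler hq] at h
  exact h.differentiableAt (Metric.isOpen_ball.mem_nhds (by simp))

theorem summable_coeffC_aux {ω q β r : ℂ} (hω : ω ^ 2 + ω + 1 = 0) (hq : ‖q‖ < 1)
    (hr : ‖r‖ < 1) :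
    Summable fun x : ℕ × ℕ => qPoch β q x.1 * qPoch (β * ω ^ 2) q x.1 / qPoch q q x.1
      * (r * ω ^ 2) ^ x.1 * (qPoch (β ^ 2 * q ^ x.1) q x.2 / qPoch q q x.2 * (r * ω) ^ x.2) := by
  have hn := norm_omega hω
  obtain ⟨A, hA0, hA⟩ := exists_norm_qPoch_le β hq
  obtain ⟨B, hB0, hB⟩ := exists_norm_qPoch_le (β * ω ^ 2) hq
  obtain ⟨D, hD0, hD⟩ := exists_norm_qPoch_le_of_norm_le ‖β ^ 2‖ hq
  obtain ⟨K, hK0, hK⟩ := exists_norm_inv_qPoch_le hq (mul_pow_ne_one hq hq)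
  refine summable_of_norm_le_geom₂ (C := A * B * K * (D * K)) (norm_nonneg r) hr
    (norm_nonneg r) hr fun k l => ?_
  have h1 : ‖β ^ 2 * q ^ k‖ ≤ ‖β ^ 2‖ := by
    rw [norm_mul, norm_pow q]
    exact mul_le_of_le_one_right (norm_nonneg _) (pow_le_one₀ (norm_nonneg q) hq.le)
  calc _ = ‖qPoch β q k‖ * ‖qPoch (β * ω ^ 2) q k‖ * ‖(qPoch q q k)⁻¹‖ * ‖r‖ ^ k
        * (‖qPoch (β ^ 2 * q ^ k) q l‖ * ‖(qPoch q q l)⁻¹‖ * ‖r‖ ^ l) := by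
        simp only [norm_mul, norm_pow, norm_inv, hn, one_pow, mul_one, div_eq_mul_inv]
    _ ≤ A * B * K * ‖r‖ ^ k * (D * K * ‖r‖ ^ l) := by
        gcongr
        exacts [hA k, hB k, hK k, (hD _ h1).1 l, hK l]
    _ = _ := by ring

theorem coeffC_mul_pow (ω q β r : ℂ) (m : ℕ) : coeffC ω q β m * r ^ m
    = ∑ x ∈ antidiagonal m, qPoch β q x.1 * qPoch (β * ω ^ 2) q x.1 / qPoch q q x.1
      * (r * ω ^ 2) ^ x.1 * (qPoch (β ^ 2 * q ^ x.1) q x.2 / qPoch q q x.2 * (r * ω) ^ x.2) := by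
  rw [coeffC, Finset.sum_mul]
  refine Finset.sum_congr rfl fun x hx => ?_
  rw [← Finset.HasAntidiagonal.mem_antidiagonal.1 hx]
  ring

theorem summable_coeffC {ω q β r : ℂ} (hω : ω ^ 2 + ω + 1 = 0) (hq : ‖q‖ < 1)
    (hr : ‖r‖ < 1) : Summable fun m => ‖coeffC ω q β m * r ^ m‖ := by
  simp only [coeffC_mul_pow]
  exact summable_norm_antidiagonal (summable_coeffC_aux hω hq hr)

/-- The generating function of `coeffC`. The inner sums are instances of the `q`-binomial theorem
and the outer one of the `q`-Gauss summation. -/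
theorem tsum_coeffC {ω q β r : ℂ} (hω : ω ^ 2 + ω + 1 = 0) (hq : ‖q‖ < 1)
    (hr : ‖r‖ < 1) : ∑' m, coeffC ω q β m * r ^ m
      = qPochInf (β * r * ω) q * qPochInf (β * r * ω ^ 2) q
        / (qPochInf (r * ω) q * qPochInf (r * ω ^ 2) q) := by
  have h3 : ω ^ 3 = 1 := by linear_combination (ω - 1) * hω
  have hn := norm_omega hω
  have hr1 : ‖r * ω‖ < 1 := by simpa [hn] using hr
  have hr2 : ‖r * ω ^ 2‖ < 1 := by simpa [hn] using hr
  simp only [coeffC_mul_pow]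
  rw [tsum_antidiagonal_eq_tsum_tsum (summable_coeffC_aux hω hq hr)]
  have h := qGauss hq hr2 β (β * ω ^ 2)
  rw [show β * (r * ω ^ 2) = β * r * ω ^ 2 by ring,
    show β * ω ^ 2 * (r * ω ^ 2) = β * r * ω by linear_combination β * r * ω * h3] at h
  simp only [tsum_mul_left]
  have e : ∀ k, qPoch β q k * qPoch (β * ω ^ 2) q k / qPoch q q k * (r * ω ^ 2) ^ k
      * ∑' l, qPoch (β ^ 2 * q ^ k) q l / qPoch q q l * (r * ω) ^ l
      = (qPochInf (r * ω) q)⁻¹ * (qPoch β q k * qPoch (β * ω ^ 2) q k / qPoch q q k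
        * (r * ω ^ 2) ^ k * qPochInf (β * (β * ω ^ 2) * (r * ω ^ 2) * q ^ k) q) := by
    intro k
    rw [qbinomial _ hq hr1, show β ^ 2 * q ^ k * (r * ω)
      = β * (β * ω ^ 2) * (r * ω ^ 2) * q ^ k by linear_combination (-β ^ 2 * q ^ k * r * ω) * h3]
    ring
  simp only [e]
  rw [tsum_mul_left, h]
  field_simp

/-- A power series that vanishes on the punctured unit disc has zero coefficients. -/
theorem coeff_eq_zero_of_tsum {c : ℕ → ℂ} (hs : ∀ z : ℂ, ‖z‖ < 1 → Summable fun n => ‖c n * z ^ n‖)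
    (h0 : ∀ z : ℂ, z ≠ 0 → ‖z‖ < 1 → ∑' n, c n * z ^ n = 0) (n : ℕ) : c n = 0 := by
  have key : ∀ {c : ℕ → ℂ}, (∀ z : ℂ, ‖z‖ < 1 → Summable fun n => ‖c n * z ^ n‖) →
      (∀ z : ℂ, z ≠ 0 → ‖z‖ < 1 → ∑' n, c n * z ^ n = 0) → c 0 = 0 := by
    intro c hs h0
    have h2 : ‖(1 / 2 : ℂ)‖ < 1 := by norm_num
    have h := tendsto_tsum_mul_pow h2 (hs (1 / 2) h2)
    refine tendsto_nhds_unique h (tendsto_const_nhds.congr fun N => (h0 _ (by simp) ?_).symm)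
    rw [← pow_succ']
    exact norm_pow_lt_one h2 (Nat.succ_ne_zero N)
  induction n generalizing c with
  | zero => exact key hs h0
  | succ n ih =>
    have hc := key hs h0
    have hs' : ∀ z : ℂ, z ≠ 0 → ‖z‖ < 1 → Summable fun n => ‖c (n + 1) * z ^ n‖ := by
      intro z hz hz1
      have h := ((summable_nat_add_iff 1).2 (hs z hz1)).mul_left ‖z‖⁻¹
      refine h.congr fun n => ?_
      rw [norm_mul, norm_mul, norm_pow, norm_pow, pow_succ]
      have : ‖z‖ ≠ 0 := norm_ne_zero_iff.2 hz
      field_simp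
    refine ih (c := fun n => c (n + 1)) (fun z hz1 => ?_) (fun z hz hz1 => ?_)
    · rcases eq_or_ne z 0 with rfl | hz
      · refine summable_of_ne_finset_zero (s := {0}) fun n hn => ?_
        have : n ≠ 0 := by simpa using hn
        simp [this]
      · exact hs' z hz hz1
    · have h := h0 z hz hz1
      rw [(hs z hz1).of_norm.tsum_eq_zero_add, hc, zero_mul, zero_add] at h
      have e : ∑' n, c (n + 1) * z ^ (n + 1) = z * ∑' n, c (n + 1) * z ^ n := by
        rw [← tsum_mul_left]; exact tsum_congr fun n => by ring
      rw [e] at h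
      exact (mul_eq_zero.1 h).resolve_left hz

theorem hasSum_congr_fun {f g : ℕ → ℂ} {a : ℂ} (h : ∀ n, f n = g n) :
    HasSum f a ↔ HasSum g a := by
  rw [funext h]

theorem coeffC_zero (ω q β : ℂ) : coeffC ω q β 0 = 1 := by simp [coeffC, qPoch_zero]

/-- The three-term recurrence equivalent to the product form of the generating function. -/
theorem coeffC_rec {ω q β : ℂ} (hω : ω ^ 2 + ω + 1 = 0) (hq : ‖q‖ < 1) :
    coeffC ω q β 1 * (1 - q) + (1 - β) = 0 ∧ ∀ m, coeffC ω q β (m + 2) * (1 - q ^ (m + 2))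
      + coeffC ω q β (m + 1) * (1 - β * q ^ (m + 1)) + coeffC ω q β m * (1 - β ^ 2 * q ^ m)
        = 0 := by
  have hn := norm_omega hω
  set C := coeffC ω q β with hC
  have hC0 : C 0 = 1 := coeffC_zero ω q β
  -- With `G` the generating function, `c n` is the coefficient of `z ^ n` in
  -- `(1 + z + z²) G(z) - (1 + β z + β² z²) G(q z)`, which vanishes.
  set c : ℕ → ℂ := fun n => C n * (1 - q ^ n)
    + (if n = 0 then 0 else C (n - 1) * (1 - β * q ^ (n - 1)))
    + (if n ≤ 1 then 0 else C (n - 2) * (1 - β ^ 2 * q ^ (n - 2))) with hc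
  have hs0 : ∀ z : ℂ, ‖z‖ < 1 → Summable fun n => C n * z ^ n := fun z hz =>
    (summable_coeffC hω hq hz).of_norm
  have hqz : ∀ z : ℂ, ‖z‖ < 1 → ‖q * z‖ < 1 := fun z hz => by
    rw [norm_mul]; exact mul_lt_one_of_nonneg_of_lt_one_left (norm_nonneg _) hq hz.le
  have hsg : ∀ (b z : ℂ), ‖z‖ < 1 → HasSum (fun n => C n * (1 - b * q ^ n) * z ^ n)
      (∑' n, C n * z ^ n - b * ∑' n, C n * (q * z) ^ n) := by
    intro b z hz
    refine (hasSum_congr_fun fun n => ?_).2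
      ((hs0 z hz).hasSum.sub (((hs0 _ (hqz z hz)).hasSum).mul_left b))
    rw [mul_pow]
    ring
  have hsum : ∀ z : ℂ, ‖z‖ < 1 → HasSum (fun n => c n * z ^ n)
      ((1 + z + z ^ 2) * ∑' n, C n * z ^ n
        - (1 + β * z + β ^ 2 * z ^ 2) * ∑' n, C n * (q * z) ^ n) := by
    intro z hz
    have hU := hsg 1 z hz
    have hV : HasSum (fun n => if n = 0 then 0 else C (n - 1) * (1 - β * q ^ (n - 1)) * z ^ n)
        (z * (∑' n, C n * z ^ n - β * ∑' n, C n * (q * z) ^ n)) := by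
      have := (hasSum_nat_add_iff (f := fun n => if n = 0 then 0 else
        C (n - 1) * (1 - β * q ^ (n - 1)) * z ^ n) 1).1
          ((hasSum_congr_fun ?_).2 ((hsg β z hz).mul_left z))
      · simpa using this
      · intro n
        simp only [Nat.succ_ne_zero, if_false, Nat.add_sub_cancel]
        ring
    have hW : HasSum (fun n => if n ≤ 1 then 0 else C (n - 2) * (1 - β ^ 2 * q ^ (n - 2)) * z ^ n)
        (z ^ 2 * (∑' n, C n * z ^ n - β ^ 2 * ∑' n, C n * (q * z) ^ n)) := by
      have := (hasSum_nat_add_iff (f := fun n => if n ≤ 1 then 0 else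
        C (n - 2) * (1 - β ^ 2 * q ^ (n - 2)) * z ^ n) 2).1
          ((hasSum_congr_fun ?_).2 ((hsg (β ^ 2) z hz).mul_left (z ^ 2)))
      · simpa [Finset.sum_range_succ] using this
      · intro n
        rw [if_neg (by omega), Nat.add_sub_cancel]
        ring
    have h := (hU.add hV).add hW
    convert h using 1
    · ext n
      simp only [hc]
      split_ifs <;> ring
    · ring
  have hc0 := coeff_eq_zero_of_tsum (c := c) (fun z hz => (hsum z hz).summable.norm)
    (fun z _ hz => ?_)
  · refine ⟨?_, fun m => ?_⟩
    · simpa [hc, hC0] using hc0 1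
    · have := hc0 (m + 2)
      simpa [hc] using this
  · rw [(hsum z hz).tsum_eq, tsum_coeffC hω hq hz, tsum_coeffC hω hq (hqz z hz)]
    have h1 : ‖z * ω‖ < 1 := by simpa [hn] using hz
    have h2 : ‖z * ω ^ 2‖ < 1 := by simpa [hn] using hz
    have n1 := qPochInf_ne_zero_of_norm hq h1
    have n2 := qPochInf_ne_zero_of_norm hq h2
    have e1 := qPochInf_succ (z * ω) hq
    have e2 := qPochInf_succ (z * ω ^ 2) hq
    have e3 := qPochInf_succ (β * z * ω) hq
    have e4 := qPochInf_succ (β * z * ω ^ 2) hq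
    rw [show z * ω * q = q * z * ω by ring] at e1
    rw [show z * ω ^ 2 * q = q * z * ω ^ 2 by ring] at e2
    rw [show β * z * ω * q = β * (q * z) * ω by ring] at e3
    rw [show β * z * ω ^ 2 * q = β * (q * z) * ω ^ 2 by ring] at e4
    rw [e1] at n1 ⊢
    rw [e2] at n2 ⊢
    rw [e3, e4]
    have m1 := left_ne_zero_of_mul n1
    have m2 := right_ne_zero_of_mul n1
    have m3 := left_ne_zero_of_mul n2
    have m4 := right_ne_zero_of_mul n2
    rw [sub_eq_zero, mul_div_assoc', mul_div_assoc', div_eq_div_iff (mul_ne_zero n1 n2)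
      (mul_ne_zero m2 m4)]
    have f1 : (1 - z * ω) * (1 - z * ω ^ 2) = 1 + z + z ^ 2 := by
      linear_combination (z ^ 2 * (ω - 1) - z) * hω
    have f2 : (1 - β * z * ω) * (1 - β * z * ω ^ 2) = 1 + β * z + β ^ 2 * z ^ 2 := by
      linear_combination (β ^ 2 * z ^ 2 * (ω - 1) - β * z) * hω
    rw [← f1, ← f2]
    ring

theorem summable_qPoch_add {q a b c d y z : ℂ} (hq : ‖q‖ < 1) (hd : ∀ n : ℕ, d * q ^ n ≠ 1)
    (hy : ‖y‖ < 1) (hz : ‖z‖ < 1) :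
    Summable fun x : ℕ × ℕ => qPoch a q (x.1 + x.2)
      * (qPoch b q x.1 * qPoch c q x.1 / (qPoch q q x.1 * qPoch d q x.1)
        * y ^ x.1 * (z ^ x.2 / qPoch q q x.2)) := by
  obtain ⟨A, hA0, hA⟩ := exists_norm_qPoch_le a hq
  obtain ⟨B, hB0, hB⟩ := exists_norm_qPoch_le b hq
  obtain ⟨C, hC0, hC⟩ := exists_norm_qPoch_le c hq
  obtain ⟨D, hD0, hD⟩ := exists_norm_inv_qPoch_le hq hd
  obtain ⟨K, hK0, hK⟩ := exists_norm_inv_qPoch_le hq (mul_pow_ne_one hq hq)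
  refine summable_of_norm_le_geom₂ (C := A * (B * C * (K * D) * K)) (norm_nonneg y) hy
    (norm_nonneg z) hz fun k l => ?_
  simp only [div_eq_mul_inv, mul_inv]
  calc _ = ‖qPoch a q (k + l)‖ * (‖qPoch b q k‖ * ‖qPoch c q k‖
        * (‖(qPoch q q k)⁻¹‖ * ‖(qPoch d q k)⁻¹‖) * ‖y‖ ^ k
        * (‖z‖ ^ l * ‖(qPoch q q l)⁻¹‖)) := by
        simp only [norm_mul, norm_pow]
    _ ≤ A * (B * C * (K * D) * ‖y‖ ^ k * (‖z‖ ^ l * K)) := by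
        gcongr
        exacts [hA _, hB k, hC k, hK k, hD k, hK l]
    _ = _ := by ring

theorem summable_coeffC_mul {ω q β r l : ℂ} (hω : ω ^ 2 + ω + 1 = 0) (hq : ‖q‖ < 1)
    (hr : ‖r‖ < 1) {b : ℂ} (hb : ∀ n : ℕ, b * q ^ n ≠ 1) :
    Summable fun m => coeffC ω q β m * r ^ m * (qPoch l q m / qPoch b q m) := by
  obtain ⟨L, hL0, hL⟩ := exists_norm_qPoch_le l hq
  obtain ⟨D, hD0, hD⟩ := exists_norm_inv_qPoch_le hq hb
  refine Summable.of_norm_bounded ((summable_coeffC (β := β) hω hq hr).mul_right (L * D))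
    fun m => ?_
  rw [norm_mul, div_eq_mul_inv, norm_mul (qPoch l q m)]
  gcongr
  exacts [hL m, hD m]

/-- Passage from base `q` to base `q ^ 2`. As in `inv_qPoch_mul_qPoch_neg`, the hypotheses on `e`
and `s` say that they are `1` and `q` in some order. -/
theorem seriesA_eq_tsum_coeffC {ω q β e s l t : ℂ} (hω : ω ^ 2 + ω + 1 = 0) (hq0 : q ≠ 0)
    (hq : ‖q‖ < 1)
    (hβ : ‖β‖ < 1) (hes : e * s = q) (hes' : e + s = 1 + q) (hl : s * l = β * e)
    (ht : ‖t‖ < 1) :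
    seriesA ω q β t = qPochInf (s * t * ω) (q ^ 2) * qPochInf (s * t * ω ^ 2) (q ^ 2)
      * ∑' m, coeffC ω (q ^ 2) β m * (s * t) ^ m
        * (qPoch l (q ^ 2) m / qPoch (β ^ 2) (q ^ 2) m) := by
  have h3 : ω ^ 3 = 1 := by linear_combination (ω - 1) * hω
  have hn := norm_omega hω
  have hQ := norm_pow_lt_one hq two_ne_zero
  have hβ2 := norm_pow_lt_one hβ two_ne_zero
  have hcase : (e = 1 ∧ s = q) ∨ (e = q ∧ s = 1) := by
    have : (e - 1) * (e - q) = 0 := by linear_combination e * hes' - hes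
    rcases mul_eq_zero.1 this with h | h
    · have he := sub_eq_zero.1 h
      exact Or.inl ⟨he, by simpa [he] using hes⟩
    · have he := sub_eq_zero.1 h
      exact Or.inr ⟨he, by linear_combination hes' - he⟩
  have hqt : ‖q * t‖ < 1 := by
    rw [norm_mul]; exact mul_lt_one_of_nonneg_of_lt_one_left (norm_nonneg _) hq ht.le
  have hst : ‖s * t‖ < 1 := by rcases hcase with ⟨_, h⟩ | ⟨_, h⟩ <;> rw [h] <;> simpa only [one_mul]
  have het : ‖e * t‖ < 1 := by rcases hcase with ⟨h, _⟩ | ⟨h, _⟩ <;> rw [h] <;> simpa only [one_mul]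
  have hsplit : qPochInf (t * ω ^ 2) q
      = qPochInf (s * t * ω ^ 2) (q ^ 2) * qPochInf (e * (t * ω ^ 2)) (q ^ 2) := by
    rw [qPochInf_two _ hq]
    rcases hcase with ⟨rfl, rfl⟩ | ⟨rfl, rfl⟩ <;> ring_nf
  have hex : ‖e * (t * ω ^ 2)‖ < 1 := by rw [← mul_assoc]; simpa [hn] using het
  have hsx : ‖s * t * ω‖ < 1 := by rw [norm_mul, hn, mul_one]; exact hst
  have hsx' : ‖s * t * ω ^ 2‖ < 1 := by
    rw [norm_mul, norm_pow, hn, one_pow, mul_one]; exact hst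
  -- Both sides are multiples of the same series `T`: if `1 / ((q; q)_N (-β; q)_N)` is expanded on
  -- the left and `coeffC` on the right, the inner sums are instances of the `q`-binomial theorem.
  obtain ⟨T, hT⟩ : ∃ T, T = ∑' k, qPoch (β * ω ^ 2) (q ^ 2) k
        * qPoch l (q ^ 2) k * qPoch β (q ^ 2) k
          / (qPoch (q ^ 2) (q ^ 2) k * qPoch (β ^ 2) (q ^ 2) k)
        * (s * t * ω ^ 2) ^ k * qPochInf (l * (s * t * ω) * (q ^ 2) ^ k) (q ^ 2) := ⟨_, rfl⟩
  have e1 : ∑' N, qPoch (β * ω ^ 2) (q ^ 2) N / (qPoch q q N * qPoch (-β) q N) * (t * ω ^ 2) ^ N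
      = (qPochInf (e * (t * ω ^ 2)) (q ^ 2))⁻¹ * T := by
    have hsm := summable_qPoch_add (a := β * ω ^ 2) (b := l) (c := β) hQ
      (mul_pow_ne_one hQ hβ2) hsx' hex
    rw [hT, ← tsum_mul_left]
    calc _ = _ := tsum_congr fun N => ?_
      _ = _ := tsum_antidiagonal_eq_tsum_tsum hsm
      _ = _ := tsum_congr fun k => ?_
    · rw [div_eq_mul_one_div, inv_qPoch_mul_qPoch_neg hq0 hq hβ hes hes' hl, Finset.mul_sum,
        Finset.sum_mul]
      refine Finset.sum_congr rfl fun x hx => ?_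
      rw [← Finset.HasAntidiagonal.mem_antidiagonal.1 hx]
      ring
    · have hb := qbinomial (β * ω ^ 2 * (q ^ 2) ^ k) hQ hex
      rw [show β * ω ^ 2 * (q ^ 2) ^ k * (e * (t * ω ^ 2)) = l * (s * t * ω) * (q ^ 2) ^ k by
        linear_combination β * e * t * (q ^ 2) ^ k * ω * h3 - ω * t * (q ^ 2) ^ k * hl] at hb
      rw [div_eq_inv_mul] at hb
      have e2 : ∀ c : ℂ, (qPochInf (e * (t * ω ^ 2)) (q ^ 2))⁻¹ * (c
        * qPochInf (l * (s * t * ω) * (q ^ 2) ^ k) (q ^ 2)) = c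
          * ((qPochInf (e * (t * ω ^ 2)) (q ^ 2))⁻¹
            * qPochInf (l * (s * t * ω) * (q ^ 2) ^ k) (q ^ 2)) := fun c => by ring
      rw [e2, ← hb, ← tsum_mul_left]
      refine tsum_congr fun j => ?_
      rw [qPoch_add]
      ring
  have e3 : ∑' m, coeffC ω (q ^ 2) β m * (s * t) ^ m
        * (qPoch l (q ^ 2) m / qPoch (β ^ 2) (q ^ 2) m)
      = (qPochInf (s * t * ω) (q ^ 2))⁻¹ * T := by
    have hsm := summable_qPoch_add (a := l) (b := β * ω ^ 2) (c := β) hQ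
      (mul_pow_ne_one hQ hβ2) hsx' hsx
    rw [hT, ← tsum_mul_left]
    calc _ = _ := tsum_congr fun N => ?_
      _ = _ := tsum_antidiagonal_eq_tsum_tsum hsm
      _ = _ := tsum_congr fun k => ?_
    · rw [coeffC, Finset.sum_mul, Finset.sum_mul]
      refine Finset.sum_congr rfl fun x hx => ?_
      rw [← Finset.HasAntidiagonal.mem_antidiagonal.1 hx]
      have n1 := qPoch_ne_zero_of_norm hQ hβ2 (x.1 + x.2)
      rw [qPoch_add (β ^ 2)] at n1 ⊢
      have n2 := left_ne_zero_of_mul n1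
      have n3 := right_ne_zero_of_mul n1
      generalize qPoch (β ^ 2 * (q ^ 2) ^ x.1) (q ^ 2) x.2 = y at *
      field_simp
      ring
    · have hb := qbinomial (l * (q ^ 2) ^ k) hQ hsx
      rw [show l * (q ^ 2) ^ k * (s * t * ω) = l * (s * t * ω) * (q ^ 2) ^ k by ring,
        div_eq_inv_mul] at hb
      have e2 : ∀ c : ℂ, (qPochInf (s * t * ω) (q ^ 2))⁻¹ * (c
        * qPochInf (l * (s * t * ω) * (q ^ 2) ^ k) (q ^ 2)) = c
          * ((qPochInf (s * t * ω) (q ^ 2))⁻¹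
            * qPochInf (l * (s * t * ω) * (q ^ 2) ^ k) (q ^ 2)) := fun c => by ring
      rw [e2, ← hb, ← tsum_mul_left]
      refine tsum_congr fun j => ?_
      rw [qPoch_add]
      ring
  rw [seriesA, e1, e3, hsplit]
  have n1 := qPochInf_ne_zero_of_norm hQ hex
  have n2 := qPochInf_ne_zero_of_norm hQ hsx
  generalize qPochInf (e * (t * ω ^ 2)) (q ^ 2) = x at *
  generalize qPochInf (s * t * ω) (q ^ 2) = y at *
  field_simp

/-! ### A cubic summation -/

/-- The cubic summation for `|l| < 1`. Expanding `(a l q ^ m; q)_∞ / (l q ^ m; q)_∞` in powers of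
`l`, the sum over `m` becomes the generating function of `coeffC` at `a q ^ n`. Since `β a = q`, the
resulting quotient of factorials has base `q ^ 3`, and the sum over `n` is again an instance of the
`q`-binomial theorem. -/
theorem tsum_coeffC_mul_qPoch_of_norm_lt {ω q β a l : ℂ} (hω : ω ^ 2 + ω + 1 = 0) (hq : ‖q‖ < 1)
    (ha : ‖a‖ < 1) (hβa : β * a = q) (hl : ‖l‖ < 1) :
    ∑' m, coeffC ω q β m * a ^ m * (qPoch l q m * qPochInf (a * l * q ^ m) q)
      = qPochInf (q * ω) q * qPochInf (q * ω ^ 2) q / (qPochInf (a * ω) q * qPochInf (a * ω ^ 2) q)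
        * (qPochInf (l * q) (q ^ 3) * qPochInf (l * q ^ 2) (q ^ 3)
          * qPochInf (a ^ 3 * l) (q ^ 3)) := by
  have hn := norm_omega hω
  have hq3 := norm_pow_lt_one hq three_ne_zero
  have haq : ∀ n : ℕ, ‖a * q ^ n‖ < 1 := fun n => by
    rw [norm_mul, norm_pow]
    exact mul_lt_one_of_nonneg_of_lt_one_left (norm_nonneg _) ha (pow_le_one₀ (norm_nonneg q) hq.le)
  have hlq : ∀ n : ℕ, ‖l * q ^ n‖ < 1 := fun n => by
    rw [norm_mul, norm_pow]
    exact mul_lt_one_of_nonneg_of_lt_one_left (norm_nonneg _) hl (pow_le_one₀ (norm_nonneg q) hq.le)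
  have hs : Summable fun x : ℕ × ℕ => coeffC ω q β x.1 * a ^ x.1
      * (qPoch a q x.2 / qPoch q q x.2 * (l * q ^ x.1) ^ x.2) := by
    refine Summable.of_norm_bounded (g := fun x : ℕ × ℕ => ‖coeffC ω q β x.1 * a ^ x.1‖
      * ‖qPoch a q x.2 / qPoch q q x.2 * l ^ x.2‖) ((summable_coeffC hω hq ha).mul_of_nonneg
        (summable_qbinomial a hq hl) (fun _ => norm_nonneg _) (fun _ => norm_nonneg _)) fun x => ?_
    rw [norm_mul]
    gcongr 1
    rw [mul_pow, ← mul_assoc, norm_mul]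
    refine mul_le_of_le_one_right (norm_nonneg _) ?_
    rw [norm_pow, norm_pow]
    exact pow_le_one₀ (by positivity) (pow_le_one₀ (norm_nonneg q) hq.le)
  calc _ = qPochInf l q * ∑' m, ∑' n, coeffC ω q β m * a ^ m
        * (qPoch a q n / qPoch q q n * (l * q ^ m) ^ n) := by
        rw [← tsum_mul_left]
        refine tsum_congr fun m => ?_
        rw [tsum_mul_left, qbinomial a hq (hlq m), qPochInf_eq_mul l hq m,
          show a * (l * q ^ m) = a * l * q ^ m by ring]
        have := qPochInf_ne_zero_of_norm hq (hlq m)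
        field_simp
    _ = qPochInf l q * ∑' n, ∑' m, coeffC ω q β m * a ^ m
        * (qPoch a q n / qPoch q q n * (l * q ^ m) ^ n) := by
        rw [Summable.tsum_comm (f := fun m n => coeffC ω q β m * a ^ m
          * (qPoch a q n / qPoch q q n * (l * q ^ m) ^ n)) hs]
    _ = qPochInf l q * ∑' n, qPochInf (q * ω) q * qPochInf (q * ω ^ 2) q
          / (qPochInf (a * ω) q * qPochInf (a * ω ^ 2) q)
          * (qPoch (a ^ 3) (q ^ 3) n / qPoch (q ^ 3) (q ^ 3) n * l ^ n) := by
        congr 1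
        refine tsum_congr fun n => ?_
        have e1 : ∀ m, coeffC ω q β m * a ^ m * (qPoch a q n / qPoch q q n * (l * q ^ m) ^ n)
            = qPoch a q n / qPoch q q n * l ^ n * (coeffC ω q β m * (a * q ^ n) ^ m) := fun m => by
          rw [mul_pow, mul_pow, ← pow_mul, ← pow_mul, mul_comm m n]
          ring
        simp only [e1]
        rw [tsum_mul_left, tsum_coeffC hω hq (haq n), ← qPoch_cube hω a q n, ← qPoch_cube hω q q n,
          show β * (a * q ^ n) * ω = q * ω * q ^ n by linear_combination q ^ n * ω * hβa,
          show β * (a * q ^ n) * ω ^ 2 = q * ω ^ 2 * q ^ n by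
            linear_combination q ^ n * ω ^ 2 * hβa,
          show a * q ^ n * ω = a * ω * q ^ n by ring,
          show a * q ^ n * ω ^ 2 = a * ω ^ 2 * q ^ n by ring,
          qPochInf_eq_mul (q * ω) hq n, qPochInf_eq_mul (q * ω ^ 2) hq n,
          qPochInf_eq_mul (a * ω) hq n, qPochInf_eq_mul (a * ω ^ 2) hq n]
        have b1 : ‖q * ω‖ < 1 := by simpa [hn] using hq
        have b2 : ‖q * ω ^ 2‖ < 1 := by simpa [hn] using hq
        have b3 : ‖a * ω‖ < 1 := by simpa [hn] using ha
        have b4 : ‖a * ω ^ 2‖ < 1 := by simpa [hn] using ha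
        have n1 := qPoch_ne_zero_of_norm hq b1 n
        have n2 := qPoch_ne_zero_of_norm hq b2 n
        have n3 := qPochInf_ne_zero_of_norm hq b3
        have n4 := qPochInf_ne_zero_of_norm hq b4
        rw [qPochInf_eq_mul _ hq n] at n3 n4
        have m1 := left_ne_zero_of_mul n3
        have m2 := right_ne_zero_of_mul n3
        have m3 := left_ne_zero_of_mul n4
        have m4 := right_ne_zero_of_mul n4
        have m5 := qPoch_self_ne_zero hq n
        generalize qPochInf (a * ω * q ^ n) q = x1 at *
        generalize qPochInf (a * ω ^ 2 * q ^ n) q = x2 at *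
        generalize qPoch (a * ω) q n = x3 at *
        generalize qPoch (a * ω ^ 2) q n = x4 at *
        generalize qPoch (q * ω) q n = x5 at *
        generalize qPoch (q * ω ^ 2) q n = x6 at *
        generalize qPochInf (q * ω * q ^ n) q = x7 at *
        generalize qPochInf (q * ω ^ 2 * q ^ n) q = x8 at *
        field_simp
    _ = _ := by
        rw [tsum_mul_left, qbinomial (a ^ 3) hq3 hl, qPochInf_three l hq]
        have := qPochInf_ne_zero_of_norm hq3 hl
        generalize qPochInf l (q ^ 3) = x at *
        field_simp

/-- The cubic summation. Both sides are entire functions of `l`, so that the case `|l| < 1`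
suffices. -/
theorem tsum_coeffC_mul_qPoch {ω q β a : ℂ} (hω : ω ^ 2 + ω + 1 = 0) (hq : ‖q‖ < 1)
    (ha : ‖a‖ < 1) (hβa : β * a = q) (l : ℂ) :
    ∑' m, coeffC ω q β m * a ^ m * (qPoch l q m * qPochInf (a * l * q ^ m) q)
      = qPochInf (q * ω) q * qPochInf (q * ω ^ 2) q / (qPochInf (a * ω) q * qPochInf (a * ω ^ 2) q)
        * (qPochInf (l * q) (q ^ 3) * qPochInf (l * q ^ 2) (q ^ 3)
          * qPochInf (a ^ 3 * l) (q ^ 3)) := by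
  have hq3 := norm_pow_lt_one hq three_ne_zero
  set f : ℂ → ℂ := fun l => ∑' m, coeffC ω q β m * a ^ m
      * (qPoch l q m * qPochInf (a * l * q ^ m) q)
    with hf
  set g : ℂ → ℂ := fun l => qPochInf (q * ω) q * qPochInf (q * ω ^ 2) q
      / (qPochInf (a * ω) q * qPochInf (a * ω ^ 2) q)
        * (qPochInf (l * q) (q ^ 3) * qPochInf (l * q ^ 2) (q ^ 3) * qPochInf (a ^ 3 * l) (q ^ 3))
    with hg
  have hD : Differentiable ℂ fun z => qPochInf z q := differentiable_qPochInf hq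
  have hD3 : Differentiable ℂ fun z => qPochInf z (q ^ 3) := differentiable_qPochInf hq3
  have hgd : Differentiable ℂ g := by
    have h1 : Differentiable ℂ fun l : ℂ => qPochInf (l * q) (q ^ 3) :=
      hD3.comp (g := fun z => qPochInf z (q ^ 3)) (f := fun l : ℂ => l * q) (by fun_prop)
    have h2 : Differentiable ℂ fun l : ℂ => qPochInf (l * q ^ 2) (q ^ 3) :=
      hD3.comp (g := fun z => qPochInf z (q ^ 3)) (f := fun l : ℂ => l * q ^ 2) (by fun_prop)
    have h3 : Differentiable ℂ fun l : ℂ => qPochInf (a ^ 3 * l) (q ^ 3) :=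
      hD3.comp (g := fun z => qPochInf z (q ^ 3)) (f := fun l : ℂ => a ^ 3 * l) (by fun_prop)
    exact ((h1.mul h2).mul h3).const_mul _
  have hfd : Differentiable ℂ f := by
    intro z
    obtain ⟨C, hC0, hC⟩ := exists_norm_qPoch_le_of_norm_le (‖z‖ + 1) hq
    have h : DifferentiableOn ℂ f (Metric.ball 0 (‖z‖ + 1)) := by
      refine Complex.differentiableOn_tsum_of_summable_norm
        (u := fun m => ‖coeffC ω q β m * a ^ m‖ * (C * C))
        ((summable_coeffC hω hq ha).mul_right _)
        (fun m => ?_) Metric.isOpen_ball fun m w hw => ?_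
      · refine Differentiable.differentiableOn
          (Differentiable.const_mul (Differentiable.mul ?_ ?_) _)
        · unfold qPoch
          fun_prop
        · exact hD.comp (g := fun z => qPochInf z q) (f := fun l : ℂ => a * l * q ^ m) (by fun_prop)
      · have hw' : ‖w‖ ≤ ‖z‖ + 1 := (mem_ball_zero_iff.1 hw).le
        have hw2 : ‖a * w * q ^ m‖ ≤ ‖z‖ + 1 := by
          refine le_trans ?_ hw'
          rw [norm_mul, norm_mul, norm_pow]
          have h1 : ‖a‖ * ‖w‖ ≤ ‖w‖ := mul_le_of_le_one_left (norm_nonneg _) ha.le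
          exact (mul_le_of_le_one_right (by positivity)
            (pow_le_one₀ (norm_nonneg q) hq.le)).trans h1
        rw [norm_mul, norm_mul (qPoch w q m)]
        gcongr
        exacts [(hC w hw').1 m, (hC _ hw2).2]
    exact h.differentiableAt (Metric.isOpen_ball.mem_nhds (by simp))
  have hev : f =ᶠ[𝓝 0] g := by
    filter_upwards [Metric.isOpen_ball.mem_nhds (Metric.mem_ball_self (x := (0 : ℂ)) one_pos)]
      with l hl
    exact tsum_coeffC_mul_qPoch_of_norm_lt hω hq ha hβa (by simpa using hl)
  have := AnalyticOnNhd.eq_of_eventuallyEq (fun z _ => hfd.analyticAt z)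
    (fun z _ => hgd.analyticAt z) hev
  exact congrFun this l

/-- The cubic summation as the evaluation of a series with a denominator parameter. -/
theorem tsum_coeffC_mul_div {ω q β a l b : ℂ} (hω : ω ^ 2 + ω + 1 = 0) (hq : ‖q‖ < 1)
    (ha : ‖a‖ < 1) (hβa : β * a = q) (hb : a * l = b) (hb' : ∀ n : ℕ, b * q ^ n ≠ 1) :
    qPochInf b q * (qPochInf (a * ω) q * qPochInf (a * ω ^ 2) q
        * ∑' m, coeffC ω q β m * a ^ m * (qPoch l q m / qPoch b q m))
      = qPochInf (q * ω) q * qPochInf (q * ω ^ 2) q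
        * (qPochInf (l * q) (q ^ 3) * qPochInf (l * q ^ 2) (q ^ 3)
          * qPochInf (a ^ 3 * l) (q ^ 3)) := by
  have hn := norm_omega hω
  have n1 := qPochInf_ne_zero_of_norm hq (a := a * ω) (by simpa [hn] using ha)
  have n2 := qPochInf_ne_zero_of_norm hq (a := a * ω ^ 2) (by simpa [hn] using ha)
  have h := tsum_coeffC_mul_qPoch hω hq ha hβa l
  have e : ∑' m, coeffC ω q β m * a ^ m * (qPoch l q m * qPochInf (a * l * q ^ m) q)
      = qPochInf b q * ∑' m, coeffC ω q β m * a ^ m * (qPoch l q m / qPoch b q m) := by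
    rw [← tsum_mul_left]
    refine tsum_congr fun m => ?_
    rw [hb, qPochInf_eq_mul b hq m]
    have := qPoch_ne_zero hb' m
    field_simp
  rw [e, div_mul_eq_mul_div, eq_div_iff (mul_ne_zero n1 n2)] at h
  linear_combination h

/-! ### Contiguous relations -/

theorem summable_termPhi {q b : ℂ} (hq : ‖q‖ < 1) (hb : ∀ n : ℕ, b * (q ^ 2) ^ n ≠ 1) (ω t c : ℂ) :
    Summable (termPhi ω q t b c) := by
  obtain ⟨A, hA0, hA⟩ := exists_norm_qPoch_le (t * ω) hq
  obtain ⟨B, hB0, hB⟩ := exists_norm_qPoch_le (t * ω ^ 2) hq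
  obtain ⟨D, hD0, hD⟩ := exists_norm_inv_qPoch_le (norm_pow_lt_one hq two_ne_zero) hb
  obtain ⟨K, hK0, hK⟩ := exists_norm_inv_qPoch_le hq (mul_pow_ne_one hq hq)
  obtain ⟨E, hE0, hE⟩ := exists_pow_choose_two_le (norm_nonneg q) hq (norm_nonneg c)
  refine summable_of_norm_le_geom (C := A * B * (K * D) * E) (ρ := 1 / 2) (by norm_num)
    (by norm_num) fun k => ?_
  have h := hE k
  simp only [termPhi, div_eq_mul_inv, mul_inv]
  calc _ = ‖qPoch (t * ω) q k‖ * ‖qPoch (t * ω ^ 2) q k‖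
        * (‖(qPoch q q k)⁻¹‖ * ‖(qPoch b (q ^ 2) k)⁻¹‖) * (‖q‖ ^ k.choose 2 * ‖c‖ ^ k) := by
        simp only [norm_mul, norm_pow]
        ring
    _ ≤ A * B * (K * D) * (E * (1 / 2) ^ k) := by
        gcongr
        exacts [hA _, hB k, hK k, hD k]
    _ = _ := by ring

/-- Summation by parts against the three-term recurrence for `coeffC`. -/
theorem tsum_coeffC_by_parts {ω q β t : ℂ} (hω : ω ^ 2 + ω + 1 = 0) (hq : ‖q‖ < 1) (ht : ‖t‖ < 1)
    {w : ℕ → ℂ} {B : ℝ} (hw : ∀ m, ‖w m‖ ≤ B) :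
    ∑' m, coeffC ω q β m * t ^ m * ((1 - q ^ m) * w m + t * (1 - β * q ^ m) * w (m + 1)
      + t ^ 2 * (1 - β ^ 2 * q ^ m) * w (m + 2)) = 0 := by
  obtain ⟨h1, h2⟩ := coeffC_rec (β := β) hω hq
  have hB0 : 0 ≤ B := (norm_nonneg _).trans (hw 0)
  have hs : ∀ (b : ℂ) (j : ℕ), Summable fun m =>
      coeffC ω q β m * t ^ m * ((1 - b * q ^ m) * w (m + j)) := by
    intro b j
    refine Summable.of_norm_bounded ((summable_coeffC (β := β) hω hq ht).mul_right
      ((1 + ‖b‖) * B)) fun m => ?_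
    rw [norm_mul, norm_mul (1 - b * q ^ m)]
    gcongr
    · refine (norm_sub_le _ _).trans ?_
      rw [norm_one, norm_mul, norm_pow]
      gcongr
      exact mul_le_of_le_one_right (norm_nonneg b) (pow_le_one₀ (norm_nonneg q) hq.le)
    · exact hw _
  have s0 := hs 1 0
  have s1 := (hs β 1).mul_left t
  have s2 := (hs (β ^ 2) 2).mul_left (t ^ 2)
  have e : ∀ m, coeffC ω q β m * t ^ m * ((1 - q ^ m) * w m + t * (1 - β * q ^ m) * w (m + 1)
      + t ^ 2 * (1 - β ^ 2 * q ^ m) * w (m + 2))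
      = coeffC ω q β m * t ^ m * ((1 - 1 * q ^ m) * w (m + 0))
        + t * (coeffC ω q β m * t ^ m * ((1 - β * q ^ m) * w (m + 1)))
        + t ^ 2 * (coeffC ω q β m * t ^ m * ((1 - β ^ 2 * q ^ m) * w (m + 2))) := fun m => by
    rw [add_zero]; ring
  simp only [e]
  rw [(s0.add s1).tsum_add s2, s0.tsum_add s1, ← s0.sum_add_tsum_nat_add 2,
    ← s1.sum_add_tsum_nat_add 1]
  have s0' := (summable_nat_add_iff 2).2 s0
  have s1' := (summable_nat_add_iff 1).2 s1
  have e2 : (∑' m, coeffC ω q β (m + 2) * t ^ (m + 2) * ((1 - 1 * q ^ (m + 2)) * w (m + 2 + 0)))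
      + (∑' m, t * (coeffC ω q β (m + 1) * t ^ (m + 1) * ((1 - β * q ^ (m + 1)) * w (m + 1 + 1))))
      + (∑' m, t ^ 2 * (coeffC ω q β m * t ^ m * ((1 - β ^ 2 * q ^ m) * w (m + 2)))) = 0 := by
    rw [← s0'.tsum_add s1', ← (s0'.add s1').tsum_add s2]
    refine (tsum_congr fun m => ?_).trans tsum_zero
    rw [add_zero, add_assoc m 1 1]
    linear_combination t ^ (m + 2) * w (m + 2) * h2 m
  simp only [Finset.sum_range_succ, Finset.sum_range_zero, zero_add, pow_zero, pow_one, mul_one,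
    sub_self, zero_mul, mul_zero, coeffC_zero, one_mul, add_zero] at e2 ⊢
  linear_combination e2 + t * w 1 * h1

theorem one_add_add_sq_ne_zero {p : ℂ} (hp : ‖p‖ < 1) : 1 + p + p ^ 2 ≠ 0 := by
  intro h
  have := norm_omega (ω := p) (by linear_combination h)
  linarith

/-- `(t ω; q)_{k+1} (t ω²; q)_{k+1}` with the first factors split off. -/
theorem qPoch_omega_succ' {ω : ℂ} (hω : ω ^ 2 + ω + 1 = 0) (t q : ℂ) (k : ℕ) :
    qPoch (t * ω) q (k + 1) * qPoch (t * ω ^ 2) q (k + 1)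
      = (1 + t + t ^ 2) * (qPoch (t * q * ω) q k * qPoch (t * q * ω ^ 2) q k) := by
  rw [qPoch_succ', qPoch_succ', show t * ω * q = t * q * ω by ring,
    show t * ω ^ 2 * q = t * q * ω ^ 2 by ring]
  linear_combination (qPoch (t * q * ω) q k * qPoch (t * q * ω ^ 2) q k)
    * (t ^ 2 * (ω - 1) - t) * hω

theorem qPoch_omega_succ {ω : ℂ} (hω : ω ^ 2 + ω + 1 = 0) (t q : ℂ) (k : ℕ) :
    qPoch (t * ω) q (k + 1) * qPoch (t * ω ^ 2) q (k + 1)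
      = (1 + t * q ^ k + (t * q ^ k) ^ 2) * (qPoch (t * ω) q k * qPoch (t * ω ^ 2) q k) := by
  rw [qPoch_succ, qPoch_succ]
  linear_combination (qPoch (t * ω) q k * qPoch (t * ω ^ 2) q k)
    * ((t * q ^ k) ^ 2 * (ω - 1) - t * q ^ k) * hω

/-- A contiguous relation; it holds term by term after a shift of the index in the last series. -/
theorem seriesPhi_contiguous {ω p : ℂ} (hω : ω ^ 2 + ω + 1 = 0) (hp : ‖p‖ < 1) :
    (1 - p ^ 5) * seriesPhi ω (p ^ 2) p (p ^ 5) p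
      = (1 - p ^ 5) * seriesPhi ω (p ^ 2) p (p ^ 5) (p ^ 3)
        + p * (1 + p + p ^ 2) * seriesPhi ω (p ^ 2) (p ^ 3) (p ^ 9) (p ^ 3) := by
  have hq := norm_pow_lt_one hp two_ne_zero
  have hQ := norm_pow_lt_one hq two_ne_zero
  have hp5 := norm_pow_lt_one hp (n := 5) (by norm_num)
  have hp9 := norm_pow_lt_one hp (n := 9) (by norm_num)
  have b5 := mul_pow_ne_one hQ hp5
  have b9 := mul_pow_ne_one hQ hp9
  have s1 := summable_termPhi hq b5 ω p p
  have s2 := summable_termPhi hq b5 ω p (p ^ 3)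
  have hd : seriesPhi ω (p ^ 2) p (p ^ 5) p - seriesPhi ω (p ^ 2) p (p ^ 5) (p ^ 3)
      = p * (1 + p + p ^ 2) / (1 - p ^ 5) * seriesPhi ω (p ^ 2) (p ^ 3) (p ^ 9) (p ^ 3) := by
    simp only [seriesPhi]
    rw [← s1.tsum_sub s2, (s1.sub s2).tsum_eq_zero_add, ← tsum_mul_left]
    have e0 : termPhi ω (p ^ 2) p (p ^ 5) p 0 - termPhi ω (p ^ 2) p (p ^ 5) (p ^ 3) 0 = 0 := by
      simp [termPhi]
    rw [e0, zero_add]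
    refine tsum_congr fun k => ?_
    have n0 := one_sub_pow_succ_ne_zero hq k
    have n1 := qPoch_self_ne_zero hq k
    have n2 := qPoch_ne_zero b9 k
    have n3 : 1 - p ^ 5 ≠ 0 := one_sub_pow_succ_ne_zero hp 4
    have e1 := qPoch_omega_succ' hω p (p ^ 2) k
    rw [show p * p ^ 2 = p ^ 3 by ring] at e1
    have hch : (k + 1).choose 2 = k + k.choose 2 := by
      rw [Nat.choose_succ_succ' k 1, Nat.choose_one_right]
    have e2 : qPoch (p ^ 5) ((p ^ 2) ^ 2) (k + 1)
        = (1 - p ^ 5) * qPoch (p ^ 9) ((p ^ 2) ^ 2) k := by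
      rw [qPoch_succ', show p ^ 5 * (p ^ 2) ^ 2 = p ^ 9 by ring]
    simp only [termPhi]
    rw [e1, e2, qPoch_self_succ, hch]
    generalize qPoch (p ^ 3 * ω) (p ^ 2) k = x1 at *
    generalize qPoch (p ^ 3 * ω ^ 2) (p ^ 2) k = x2 at *
    generalize qPoch (p ^ 2) (p ^ 2) k = x3 at *
    generalize qPoch (p ^ 9) ((p ^ 2) ^ 2) k = x4 at *
    have h3 : (p ^ 3) ^ (k + 1) = p * p ^ k * (p ^ 2) ^ (k + 1) := by ring
    have h4 : (p ^ 3) ^ k = p ^ k * (p ^ 2) ^ k := by ring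
    rw [h3, h4, pow_add _ k (k.choose 2), pow_succ p k]
    generalize (p ^ 2) ^ (k + 1) = x5 at *
    generalize (p ^ 2) ^ k = x6 at *
    generalize 1 - p ^ 5 = x7 at *
    generalize (p ^ 2) ^ k.choose 2 = x8 at *
    field_simp
  have n3 : 1 - p ^ 5 ≠ 0 := one_sub_pow_succ_ne_zero hp 4
  field_simp at hd
  linear_combination hd

/-- A contiguous relation with a parameter `p⁻¹`; the difference of the terms telescopes. -/
theorem seriesPhi_contiguous_inv {ω p : ℂ} (hω : ω ^ 2 + ω + 1 = 0) (hp0 : p ≠ 0) (hp : ‖p‖ < 1) :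
    p * seriesPhi ω (p ^ 2) p⁻¹ (p ^ 3) (p ^ 3) + seriesPhi ω (p ^ 2) p (p ^ 3) p
      = seriesPhi ω (p ^ 2) (p ^ 3) (p ^ 7) p / (1 - p) := by
  have hq := norm_pow_lt_one hp two_ne_zero
  have hQ := norm_pow_lt_one hq two_ne_zero
  have b3 := mul_pow_ne_one hQ (norm_pow_lt_one hp (n := 3) (by norm_num))
  have b7 := mul_pow_ne_one hQ (norm_pow_lt_one hp (n := 7) (by norm_num))
  have s1 := summable_termPhi hq b3 ω p⁻¹ (p ^ 3)
  have s2 := summable_termPhi hq b3 ω p p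
  have s3 := summable_termPhi hq b7 ω (p ^ 3) p
  have s4 := summable_termPhi hq b3 ω p⁻¹ p
  have hc := one_add_add_sq_ne_zero hp
  have n1p : 1 - p ≠ 0 := by
    intro h; rw [← sub_eq_zero.1 h] at hp; simp at hp
  -- The antidifference of the terms.
  set h : ℕ → ℂ := fun k => -(p * (p ^ 2) ^ k / (1 + p + p ^ 2)
    * (termPhi ω (p ^ 2) p⁻¹ (p ^ 3) p k * ((1 - (p ^ 2) ^ k) * (1 + p + (p ^ 2) ^ k)))) with hh
  have hlim : Tendsto h atTop (𝓝 0) := by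
    have t1 := tendsto_geom hq
    have t2 := s4.tendsto_atTop_zero
    have := ((t1.const_mul p).div_const (1 + p + p ^ 2)).mul
      (t2.mul ((t1.const_sub 1).mul (t1.const_add (1 + p)))) |>.neg
    simpa using this
  have hstep : ∀ k, p * termPhi ω (p ^ 2) p⁻¹ (p ^ 3) (p ^ 3) k + termPhi ω (p ^ 2) p (p ^ 3) p k
      - termPhi ω (p ^ 2) (p ^ 3) (p ^ 7) p k / (1 - p) = h (k + 1) - h k := by
    intro k
    have n0 := one_sub_pow_succ_ne_zero hq k
    have n1 := qPoch_self_ne_zero hq k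
    have n2 := qPoch_ne_zero b7 k
    have n3 : 1 - p ^ 3 ≠ 0 := one_sub_pow_succ_ne_zero hp 2
    have n4 := qPoch_ne_zero b3 k
    have n5 : 1 - p ^ 3 * ((p ^ 2) ^ 2) ^ k ≠ 0 := sub_ne_zero.2 (b3 k).symm
    have e1 := qPoch_omega_succ' hω p (p ^ 2) k
    rw [qPoch_omega_succ hω, show p * p ^ 2 = p ^ 3 by ring] at e1
    have e2 := qPoch_omega_succ' hω p⁻¹ (p ^ 2) k
    have e3 := qPoch_omega_succ hω p⁻¹ (p ^ 2) k
    rw [e3, show p⁻¹ * p ^ 2 = p by field_simp] at e2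
    have e4 : (1 - p ^ 3) * qPoch (p ^ 7) ((p ^ 2) ^ 2) k
        = qPoch (p ^ 3) ((p ^ 2) ^ 2) k * (1 - p ^ 3 * ((p ^ 2) ^ 2) ^ k) := by
      rw [← qPoch_succ, qPoch_succ', show p ^ 3 * (p ^ 2) ^ 2 = p ^ 7 by ring]
    have hch : (k + 1).choose 2 = k + k.choose 2 := by
      rw [Nat.choose_succ_succ' k 1, Nat.choose_one_right]
    have h4 : (p ^ 3) ^ k = p ^ k * (p ^ 2) ^ k := by ring
    have hQk : ((p ^ 2) ^ 2) ^ k = ((p ^ 2) ^ k) ^ 2 := by ring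
    simp only [hh, termPhi]
    rw [e3, qPoch_self_succ, qPoch_succ (p ^ 3) ((p ^ 2) ^ 2), hch, pow_add _ k (k.choose 2), h4,
      pow_succ (p ^ 2) k, pow_succ p k]
    rw [pow_succ] at n0
    rw [hQk] at n5 e4 ⊢
    -- Everything is expressed through the products attached to `p⁻¹`.
    have f1 : qPoch (p * ω) (p ^ 2) k * qPoch (p * ω ^ 2) (p ^ 2) k
        = (p ^ 2 + p * (p ^ 2) ^ k + ((p ^ 2) ^ k) ^ 2) / (1 + p + p ^ 2)
          * (qPoch (p⁻¹ * ω) (p ^ 2) k * qPoch (p⁻¹ * ω ^ 2) (p ^ 2) k) := by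
      generalize qPoch (p * ω) (p ^ 2) k * qPoch (p * ω ^ 2) (p ^ 2) k = x1 at *
      generalize qPoch (p⁻¹ * ω) (p ^ 2) k * qPoch (p⁻¹ * ω ^ 2) (p ^ 2) k = x2 at *
      generalize (p ^ 2) ^ k = x at *
      field_simp at e2 ⊢
      linear_combination -e2
    have f2 : qPoch (p ^ 3 * ω) (p ^ 2) k * qPoch (p ^ 3 * ω ^ 2) (p ^ 2) k
        = (1 + p * (p ^ 2) ^ k + (p * (p ^ 2) ^ k) ^ 2) / (1 + p + p ^ 2)
          * (qPoch (p * ω) (p ^ 2) k * qPoch (p * ω ^ 2) (p ^ 2) k) := by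
      rw [div_mul_eq_mul_div, eq_div_iff hc]
      linear_combination -e1
    have f3 : qPoch (p ^ 7) ((p ^ 2) ^ 2) k
        = qPoch (p ^ 3) ((p ^ 2) ^ 2) k * (1 - p ^ 3 * ((p ^ 2) ^ k) ^ 2) / (1 - p ^ 3) := by
      rw [eq_div_iff n3]
      linear_combination e4
    rw [f2, f3, f1]
    have n6 : 1 - p ^ 3 = (1 - p) * (1 + p + p ^ 2) := by ring
    rw [n6]
    generalize qPoch (p⁻¹ * ω) (p ^ 2) k * qPoch (p⁻¹ * ω ^ 2) (p ^ 2) k = x2 at *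
    generalize qPoch (p ^ 3) ((p ^ 2) ^ 2) k = x3 at *
    generalize qPoch (p ^ 2) (p ^ 2) k = x4 at *
    generalize (p ^ 2) ^ k.choose 2 = x5 at *
    generalize (p ^ 2) ^ k = x at *
    generalize p ^ k = y at *
    obtain ⟨u, hu⟩ : ∃ u, u = 1 + p + p ^ 2 := ⟨_, rfl⟩
    obtain ⟨v, hv⟩ : ∃ v, v = 1 - p ^ 3 * x ^ 2 := ⟨_, rfl⟩
    obtain ⟨z, hz⟩ : ∃ z, z = 1 - x * p ^ 2 := ⟨_, rfl⟩
    rw [← hu] at hc ⊢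
    rw [← hv] at n5 ⊢
    rw [← hz] at n0 ⊢
    field_simp
    rw [hu, hv]
    ring
  have hsum := ((s1.mul_left p).add s2).sub (s3.div_const (1 - p))
  have hz : ∑' k, (p * termPhi ω (p ^ 2) p⁻¹ (p ^ 3) (p ^ 3) k + termPhi ω (p ^ 2) p (p ^ 3) p k
      - termPhi ω (p ^ 2) (p ^ 3) (p ^ 7) p k / (1 - p)) = 0 := by
    refine tendsto_nhds_unique hsum.hasSum.tendsto_sum_nat ?_
    simp only [hstep, Finset.sum_range_sub]
    have h0 : h 0 = 0 := by simp [hh]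
    simpa [h0] using hlim
  rw [((s1.mul_left p).add s2).tsum_sub (s3.div_const (1 - p)), (s1.mul_left p).tsum_add s2,
    tsum_mul_left, tsum_div_const] at hz
  simp only [seriesPhi]
  linear_combination hz

/-! ### Evaluation of four instances of `seriesPhi`

The numerals in the names are the exponents of `p` in the parameters of the series. -/

theorem qPochInf_omega_succ {ω q : ℂ} (hω : ω ^ 2 + ω + 1 = 0) (hq : ‖q‖ < 1) (t : ℂ) :
    qPochInf (t * ω) q * qPochInf (t * ω ^ 2) q
      = (1 + t + t ^ 2) * (qPochInf (t * q * ω) q * qPochInf (t * q * ω ^ 2) q) := by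
  rw [qPochInf_succ _ hq, qPochInf_succ (t * ω ^ 2) hq, show t * ω * q = t * q * ω by ring,
    show t * ω ^ 2 * q = t * q * ω ^ 2 by ring]
  linear_combination (qPochInf (t * q * ω) q * qPochInf (t * q * ω ^ 2) q)
    * (t ^ 2 * (ω - 1) - t) * hω

theorem qPochInf_pow_two {p : ℂ} (hp : ‖p‖ < 1) (k : ℕ) :
    qPochInf (p ^ k) (p ^ 2) = qPochInf (p ^ k) (p ^ 4) * qPochInf (p ^ (k + 2)) (p ^ 4) := by
  rw [qPochInf_two _ (norm_pow_lt_one hp two_ne_zero), ← pow_mul, ← pow_add]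

theorem qPochInf_pow_three {p : ℂ} (hp : ‖p‖ < 1) (k : ℕ) :
    qPochInf (p ^ k) (p ^ 4) = qPochInf (p ^ k) (p ^ 12) * qPochInf (p ^ (k + 4)) (p ^ 12)
      * qPochInf (p ^ (k + 8)) (p ^ 12) := by
  rw [qPochInf_three _ (norm_pow_lt_one hp four_ne_zero), ← pow_mul, ← pow_mul,
    ← pow_add, ← pow_add]

theorem qPochInf_pow_mul_neg {p : ℂ} (hp : ‖p‖ < 1) (k : ℕ) :
    qPochInf (p ^ k) (p ^ 2) * qPochInf (-p ^ k) (p ^ 2) = qPochInf (p ^ (k * 2)) (p ^ 4) := by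
  rw [qPochInf_mul_neg _ (norm_pow_lt_one hp two_ne_zero), ← pow_mul, ← pow_mul]

/-- The merging `qPochInf_cube` at `a = p ^ 4` in base `p ^ 4`, with `(p ^ 12; p ^ 12)_∞` cancelled.
-/
theorem qPochInf_omega_mul {ω p : ℂ} (hω : ω ^ 2 + ω + 1 = 0) (hp : ‖p‖ < 1) :
    qPochInf (p ^ 4 * ω) (p ^ 4) * qPochInf (p ^ 4 * ω ^ 2) (p ^ 4)
      * (qPochInf (p ^ 4) (p ^ 12) * qPochInf (p ^ 8) (p ^ 12)) = 1 := by
  have hp4 := norm_pow_lt_one hp four_ne_zero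
  have hp12 := norm_pow_lt_one hp (n := 12) (by norm_num)
  have h1 := qPochInf_cube hω (p ^ 4) hp4
  rw [← pow_mul, show 4 * 3 = 12 by norm_num] at h1
  have h2 : qPochInf (p ^ 4) (p ^ 4) = qPochInf (p ^ 4) (p ^ 12) * qPochInf (p ^ 8) (p ^ 12)
      * qPochInf (p ^ 12) (p ^ 12) := qPochInf_pow_three hp 4
  have h3 := qPochInf_ne_zero_of_norm hp12 hp12
  rw [h2] at h1
  exact mul_right_cancel₀ h3 (by linear_combination h1)

/-- The change of base leads directly to an instance of the cubic summation. -/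
theorem qPochInf_mul_seriesPhi_one_five_three {ω p : ℂ} (hω : ω ^ 2 + ω + 1 = 0) (hp0 : p ≠ 0)
    (hp : ‖p‖ < 1) :
    qPochInf (p ^ 5) (p ^ 4) * seriesPhi ω (p ^ 2) p (p ^ 5) (p ^ 3)
      = 1 / (qPochInf (p ^ 3) (p ^ 4)
        * (qPochInf (p ^ 4) (p ^ 12) * qPochInf (p ^ 5) (p ^ 12))) := by
  have hq := norm_pow_lt_one hp two_ne_zero
  have hQ := norm_pow_lt_one hp four_ne_zero
  have hN : ∀ n : ℕ, n ≠ 0 → ‖p ^ n‖ < 1 := fun n hn => norm_pow_lt_one hp hn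
  have hA := seriesA_eq_seriesPhi hω hq (hN 3 (by norm_num)) hp (b := p ^ 5) (by ring)
  have hE := seriesA_eq_tsum_coeffC hω (pow_ne_zero 2 hp0) hq (hN 3 (by norm_num)) (e := p ^ 2)
    (s := 1) (l := p ^ 5) (t := p)
    (by ring) (by ring) (by ring) hp
  have hS := tsum_coeffC_mul_div hω hQ hp (β := p ^ 3) (l := p ^ 5) (b := p ^ 6) (by ring) (by ring)
    (mul_pow_ne_one hQ (hN 6 (by norm_num)))
  rw [one_mul, show (p ^ 2) ^ 2 = p ^ 4 by ring, show (p ^ 3) ^ 2 = p ^ 6 by ring] at hE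
  rw [← hE, show (p ^ 4) ^ 3 = p ^ 12 by ring, show p ^ 5 * p ^ 4 = p ^ 9 by ring,
    show p ^ 5 * (p ^ 4) ^ 2 = p ^ 13 by ring, show p ^ 3 * p ^ 5 = p ^ 8 by ring] at hS
  rw [show (p ^ 2) ^ 2 = p ^ 4 by ring] at hA
  have k0 := qPochInf_omega_mul hω hp
  have k1 : _ = qPochInf (p ^ 6) (p ^ 4) := qPochInf_pow_mul_neg hp 3
  have k2 : _ = _ * qPochInf (p ^ 5) (p ^ 4) := qPochInf_pow_two hp 3
  have k3 : _ = _ * qPochInf (p ^ 9) (p ^ 12) * qPochInf (p ^ 13) (p ^ 12) :=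
    qPochInf_pow_three hp 5
  have n6 := qPochInf_ne_zero_of_norm hQ (hN 6 (by norm_num))
  have n3 := qPochInf_ne_zero_of_norm hQ (hN 3 (by norm_num))
  have n4 := qPochInf_ne_zero_of_norm (hN 12 (by norm_num)) (hN 4 (by norm_num))
  have n5 := qPochInf_ne_zero_of_norm (hN 12 (by norm_num)) (hN 5 (by norm_num))
  rw [eq_div_iff (mul_ne_zero n3 (mul_ne_zero n4 n5)), ← hA]
  refine mul_left_cancel₀ n6 ?_
  rw [k2] at k1
  rw [k3] at k1 k2
  generalize seriesA ω (p ^ 2) (p ^ 3) p = A at *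
  linear_combination (qPochInf (-p ^ 3) (p ^ 2) * (qPochInf (p ^ 3) (p ^ 4)
    * (qPochInf (p ^ 4) (p ^ 12) * qPochInf (p ^ 5) (p ^ 12)))) * hS
    + (qPochInf (-p ^ 3) (p ^ 2) * qPochInf (p ^ 3) (p ^ 4) * qPochInf (p ^ 5) (p ^ 12)
      * qPochInf (p ^ 9) (p ^ 12) * qPochInf (p ^ 13) (p ^ 12)) * k0 + k1

/-- The change of base leads directly to an instance of the cubic summation. -/
theorem qPochInf_mul_seriesPhi_one_three_one {ω p : ℂ} (hω : ω ^ 2 + ω + 1 = 0) (hp0 : p ≠ 0)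
    (hp : ‖p‖ < 1) :
    qPochInf (p ^ 3) (p ^ 4) * seriesPhi ω (p ^ 2) p (p ^ 3) p
      = 1 / (qPochInf p (p ^ 4) * (qPochInf (p ^ 4) (p ^ 12) * qPochInf (p ^ 11) (p ^ 12))) := by
  have hq := norm_pow_lt_one hp two_ne_zero
  have hQ := norm_pow_lt_one hp four_ne_zero
  have hN : ∀ n : ℕ, n ≠ 0 → ‖p ^ n‖ < 1 := fun n hn => norm_pow_lt_one hp hn
  have hA := seriesA_eq_seriesPhi hω hq hp hp (b := p ^ 3) (by ring)
  have hE := seriesA_eq_tsum_coeffC hω (pow_ne_zero 2 hp0) hq hp (e := 1) (s := p ^ 2) (l := p⁻¹)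
    (t := p)
    (by ring) (by ring) (by field_simp) hp
  have hS := tsum_coeffC_mul_div hω hQ (hN 3 (by norm_num)) (β := p) (l := p⁻¹) (b := p ^ 2)
    (by ring)
    (by field_simp) (mul_pow_ne_one hQ (hN 2 (by norm_num)))
  rw [show p ^ 2 * p = p ^ 3 by ring, show (p ^ 2) ^ 2 = p ^ 4 by ring] at hE
  rw [← hE, show (p ^ 4) ^ 3 = p ^ 12 by ring, show p⁻¹ * p ^ 4 = p ^ 3 by field_simp,
    show p⁻¹ * (p ^ 4) ^ 2 = p ^ 7 by field_simp,
    show (p ^ 3) ^ 3 * p⁻¹ = p ^ 8 by field_simp] at hS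
  rw [show (p ^ 2) ^ 2 = p ^ 4 by ring] at hA
  have k0 := qPochInf_omega_mul hω hp
  have k1 : _ = qPochInf (p ^ 2) (p ^ 4) := qPochInf_pow_mul_neg hp 1
  have k2 : _ = _ * qPochInf (p ^ 3) (p ^ 4) := qPochInf_pow_two hp 1
  have k3 : _ = _ * qPochInf (p ^ 7) (p ^ 12) * qPochInf (p ^ 11) (p ^ 12) :=
    qPochInf_pow_three hp 3
  rw [pow_one] at k1 k2
  have n6 := qPochInf_ne_zero_of_norm hQ (hN 2 (by norm_num))
  have n3 := qPochInf_ne_zero_of_norm hQ hp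
  have n4 := qPochInf_ne_zero_of_norm (hN 12 (by norm_num)) (hN 4 (by norm_num))
  have n5 := qPochInf_ne_zero_of_norm (hN 12 (by norm_num)) (hN 11 (by norm_num))
  rw [eq_div_iff (mul_ne_zero n3 (mul_ne_zero n4 n5)), ← hA]
  refine mul_left_cancel₀ n6 ?_
  rw [k2, k3] at k1
  generalize seriesA ω (p ^ 2) p p = A at *
  linear_combination (qPochInf (-p) (p ^ 2) * (qPochInf p (p ^ 4)
    * (qPochInf (p ^ 4) (p ^ 12) * qPochInf (p ^ 11) (p ^ 12)))) * hS
    + (qPochInf (-p) (p ^ 2) * qPochInf p (p ^ 4) * qPochInf (p ^ 3) (p ^ 12)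
      * qPochInf (p ^ 7) (p ^ 12) * qPochInf (p ^ 11) (p ^ 12)) * k0 + k1

/-- A contiguous relation splits the series into two. After the change of base, their sum is a
multiple of the series with smaller parameters `p` and `p ^ 2`, to which the cubic summation
applies. -/
theorem qPochInf_mul_seriesPhi_one_five_one {ω p : ℂ} (hω : ω ^ 2 + ω + 1 = 0) (hp0 : p ≠ 0)
    (hp : ‖p‖ < 1) :
    qPochInf (p ^ 5) (p ^ 4) * seriesPhi ω (p ^ 2) p (p ^ 5) p
      = 1 / (qPochInf (p ^ 3) (p ^ 4) * (qPochInf p (p ^ 12) * qPochInf (p ^ 8) (p ^ 12))) := by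
  have hq := norm_pow_lt_one hp two_ne_zero
  have hQ := norm_pow_lt_one hp four_ne_zero
  have hN : ∀ n : ℕ, n ≠ 0 → ‖p ^ n‖ < 1 := fun n hn => norm_pow_lt_one hp hn
  have hA := seriesA_eq_seriesPhi hω hq (hN 3 (by norm_num)) hp (b := p ^ 5) (by ring)
  have hA' := seriesA_eq_seriesPhi hω hq (hN 3 (by norm_num)) (hN 3 (by norm_num)) (b := p ^ 9)
    (by ring)
  have hE := seriesA_eq_tsum_coeffC hω (pow_ne_zero 2 hp0) hq (hN 3 (by norm_num)) (e := p ^ 2)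
    (s := 1) (l := p ^ 5) (t := p)
    (by ring) (by ring) (by ring) hp
  have hE' := seriesA_eq_tsum_coeffC hω (pow_ne_zero 2 hp0) hq (hN 3 (by norm_num)) (e := 1)
    (s := p ^ 2) (l := p) (t := p ^ 3)
    (by ring) (by ring) (by ring) (hN 3 (by norm_num))
  have hS := tsum_coeffC_mul_div hω hQ hp (β := p ^ 3) (l := p) (b := p ^ 2) (by ring) (by ring)
    (mul_pow_ne_one hQ (hN 2 (by norm_num)))
  rw [one_mul, show (p ^ 2) ^ 2 = p ^ 4 by ring, show (p ^ 3) ^ 2 = p ^ 6 by ring] at hE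
  rw [show p ^ 2 * p ^ 3 = p ^ 5 by ring, show (p ^ 2) ^ 2 = p ^ 4 by ring,
    show (p ^ 3) ^ 2 = p ^ 6 by ring] at hE'
  rw [show (p ^ 4) ^ 3 = p ^ 12 by ring, show p * p ^ 4 = p ^ 5 by ring,
    show p * (p ^ 4) ^ 2 = p ^ 9 by ring, show p ^ 3 * p = p ^ 4 by ring] at hS
  rw [show (p ^ 2) ^ 2 = p ^ 4 by ring] at hA hA'
  have hc := seriesPhi_contiguous hω hp
  have hω5 := qPochInf_omega_succ hω hQ p
  rw [show p * p ^ 4 = p ^ 5 by ring] at hω5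
  have h59 := qPochInf_succ (p ^ 5) hQ
  rw [show p ^ 5 * p ^ 4 = p ^ 9 by ring] at h59
  -- The two series add up to a single one, with parameters `p` and `p ^ 2`.
  have hadd : seriesA ω (p ^ 2) (p ^ 3) p
      + p * (1 + p + p ^ 2) * seriesA ω (p ^ 2) (p ^ 3) (p ^ 3)
      = (1 + p) * (qPochInf (p * ω) (p ^ 4) * qPochInf (p * ω ^ 2) (p ^ 4)
        * ∑' m, coeffC ω (p ^ 4) (p ^ 3) m * p ^ m
          * (qPoch p (p ^ 4) m / qPoch (p ^ 2) (p ^ 4) m)) := by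
    have b6 := mul_pow_ne_one hQ (hN 6 (by norm_num))
    have b2 := mul_pow_ne_one hQ (hN 2 (by norm_num))
    have t1 := summable_coeffC_mul (β := p ^ 3) (l := p ^ 5) hω hQ hp b6
    have t2 := summable_coeffC_mul (β := p ^ 3) (l := p) hω hQ (hN 5 (by norm_num)) b6
    have hT : (∑' m, coeffC ω (p ^ 4) (p ^ 3) m * p ^ m
          * (qPoch (p ^ 5) (p ^ 4) m / qPoch (p ^ 6) (p ^ 4) m))
        + p * (∑' m, coeffC ω (p ^ 4) (p ^ 3) m * (p ^ 5) ^ m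
          * (qPoch p (p ^ 4) m / qPoch (p ^ 6) (p ^ 4) m))
        = (1 + p) * ∑' m, coeffC ω (p ^ 4) (p ^ 3) m * p ^ m
          * (qPoch p (p ^ 4) m / qPoch (p ^ 2) (p ^ 4) m) := by
      rw [← tsum_mul_left, ← tsum_mul_left, ← t1.tsum_add (t2.mul_left p)]
      refine tsum_congr fun m => ?_
      have g1 : (1 - p) * qPoch (p ^ 5) (p ^ 4) m = qPoch p (p ^ 4) m * (1 - p * (p ^ 4) ^ m) := by
        rw [← qPoch_succ, qPoch_succ', show p * p ^ 4 = p ^ 5 by ring]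
      have g2 : (1 - p ^ 2) * qPoch (p ^ 6) (p ^ 4) m
          = qPoch (p ^ 2) (p ^ 4) m * (1 - p ^ 2 * (p ^ 4) ^ m) := by
        rw [← qPoch_succ, qPoch_succ', show p ^ 2 * p ^ 4 = p ^ 6 by ring]
      have m1 : 1 - p ≠ 0 := by simpa using one_sub_pow_succ_ne_zero hp 0
      have m2 : 1 - p ^ 2 ≠ 0 := one_sub_pow_succ_ne_zero hp 1
      have m3 := qPoch_ne_zero b2 m
      have m4 := qPoch_ne_zero b6 m
      rw [show (p ^ 5) ^ m = p ^ m * (p ^ 4) ^ m by ring]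
      rw [mul_comm, ← eq_div_iff m1] at g1
      rw [g1]
      generalize qPoch (p ^ 6) (p ^ 4) m = x1 at *
      generalize qPoch (p ^ 2) (p ^ 4) m = x2 at *
      generalize qPoch p (p ^ 4) m = x3 at *
      generalize (p ^ 4) ^ m = x at *
      field_simp
      linear_combination (-(coeffC ω (p ^ 4) (p ^ 3) m * x3)) * g2
    rw [hE, hE', hω5]
    linear_combination ((1 + p + p ^ 2) * (qPochInf (p ^ 5 * ω) (p ^ 4)
      * qPochInf (p ^ 5 * ω ^ 2) (p ^ 4))) * hT
  have k0 := qPochInf_omega_mul hω hp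
  have k1 : _ = qPochInf (p ^ 2) (p ^ 4) := qPochInf_pow_mul_neg hp 1
  have k2 : _ = _ * qPochInf (p ^ 3) (p ^ 4) := qPochInf_pow_two hp 1
  have k3 : _ = _ * qPochInf (p ^ 5) (p ^ 12) * qPochInf (p ^ 9) (p ^ 12) := qPochInf_pow_three hp 1
  rw [pow_one] at k1 k2 k3
  have k4 := qPochInf_succ (-p) hq
  rw [show -p * p ^ 2 = -p ^ 3 by ring] at k4
  have n6 := qPochInf_ne_zero_of_norm hQ (hN 2 (by norm_num))
  have n3 := qPochInf_ne_zero_of_norm hQ (hN 3 (by norm_num))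
  have n4 := qPochInf_ne_zero_of_norm (hN 12 (by norm_num)) hp
  have n5 := qPochInf_ne_zero_of_norm (hN 12 (by norm_num)) (hN 8 (by norm_num))
  rw [eq_div_iff (mul_ne_zero n3 (mul_ne_zero n4 n5))]
  refine mul_left_cancel₀ n6 ?_
  have hmain : qPochInf (p ^ 5) (p ^ 4) * seriesPhi ω (p ^ 2) p (p ^ 5) p
      = qPochInf (-p ^ 3) (p ^ 2) * (seriesA ω (p ^ 2) (p ^ 3) p
        + p * (1 + p + p ^ 2) * seriesA ω (p ^ 2) (p ^ 3) (p ^ 3)) := by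
    rw [mul_add, hA, mul_left_comm, hA', h59]
    linear_combination qPochInf (p ^ 9) (p ^ 4) * hc
  rw [hmain, hadd]
  rw [k2, k3, k4] at k1
  generalize qPochInf (p * ω) (p ^ 4) * qPochInf (p * ω ^ 2) (p ^ 4)
        * ∑' m, coeffC ω (p ^ 4) (p ^ 3) m * p ^ m
          * (qPoch p (p ^ 4) m / qPoch (p ^ 2) (p ^ 4) m) = A at *
  linear_combination (qPochInf (-p ^ 3) (p ^ 2) * (1 + p) * (qPochInf (p ^ 3) (p ^ 4)
    * (qPochInf p (p ^ 12) * qPochInf (p ^ 8) (p ^ 12)))) * hS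
    + (qPochInf (-p ^ 3) (p ^ 2) * (1 + p) * qPochInf (p ^ 3) (p ^ 4) * qPochInf p (p ^ 12)
      * qPochInf (p ^ 5) (p ^ 12) * qPochInf (p ^ 9) (p ^ 12)) * k0 + k1

theorem pow_ne_pow {p : ℂ} (hp0 : p ≠ 0) (hp : ‖p‖ < 1) {m n : ℕ} (h : m ≠ n) : p ^ m ≠ p ^ n := by
  intro h'
  have h1 := congrArg norm h'
  rw [norm_pow, norm_pow] at h1
  exact h ((pow_right_strictAnti₀ (norm_pos_iff.2 hp0) hp).injective h1)

theorem inv_pow_mul_pow_ne_one {p : ℂ} (hp0 : p ≠ 0) (hp : ‖p‖ < 1) {k : ℕ} (hk : ∀ n, 4 * n ≠ k)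
    (n : ℕ) : (p ^ k)⁻¹ * (p ^ 4) ^ n ≠ 1 := by
  intro h
  rw [inv_mul_eq_one₀ (pow_ne_zero k hp0), ← pow_mul] at h
  exact pow_ne_pow hp0 hp (hk n).symm h

/-- A contiguous relation writes the series as a difference of two. After the change of base,
summation by parts against the recurrence for `coeffC` turns the difference into the series with
parameters `p⁻⁵` and `p⁻²`, to which the cubic summation applies for `l = p⁻⁵`, outside the unit
disc. -/
theorem qPochInf_mul_seriesPhi_neg_one_three_three {ω p : ℂ} (hω : ω ^ 2 + ω + 1 = 0) (hp0 : p ≠ 0)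
    (hp : ‖p‖ < 1) :
    qPochInf (p ^ 3) (p ^ 4) * seriesPhi ω (p ^ 2) p⁻¹ (p ^ 3) (p ^ 3)
      = 1 / (qPochInf p (p ^ 4) * (qPochInf (p ^ 7) (p ^ 12) * qPochInf (p ^ 8) (p ^ 12))) := by
  have hq := norm_pow_lt_one hp two_ne_zero
  have hQ := norm_pow_lt_one hp four_ne_zero
  have hN : ∀ n : ℕ, n ≠ 0 → ‖p ^ n‖ < 1 := fun n hn => norm_pow_lt_one hp hn
  have hp3 := hN 3 (by norm_num)
  have hA := seriesA_eq_seriesPhi hω hq hp hp (b := p ^ 3) (by ring)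
  have hA' := seriesA_eq_seriesPhi hω hq hp hp3 (b := p ^ 7) (by ring)
  have hE := seriesA_eq_tsum_coeffC hω (pow_ne_zero 2 hp0) hq hp (e := 1) (s := p ^ 2) (l := p⁻¹)
    (t := p)
    (by ring) (by ring) (by field_simp) hp
  have hE' := seriesA_eq_tsum_coeffC hω (pow_ne_zero 2 hp0) hq hp (e := p ^ 2) (s := 1) (l := p ^ 3)
    (t := p ^ 3)
    (by ring) (by ring) (by ring) hp3
  have b2 := mul_pow_ne_one hQ (hN 2 (by norm_num))
  have c2 := inv_pow_mul_pow_ne_one hp0 hp (k := 2) (fun n => by omega)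
  have hS := tsum_coeffC_mul_div hω hQ hp3 (β := p) (l := (p ^ 5)⁻¹) (b := (p ^ 2)⁻¹) (by ring)
    (by field_simp) c2
  rw [show p ^ 2 * p = p ^ 3 by ring, show (p ^ 2) ^ 2 = p ^ 4 by ring] at hE
  rw [one_mul, show (p ^ 2) ^ 2 = p ^ 4 by ring] at hE'
  rw [show (p ^ 4) ^ 3 = p ^ 12 by ring, show (p ^ 5)⁻¹ * p ^ 4 = p⁻¹ by field_simp,
    show (p ^ 5)⁻¹ * (p ^ 4) ^ 2 = p ^ 3 by field_simp,
    show (p ^ 3) ^ 3 * (p ^ 5)⁻¹ = p ^ 4 by field_simp] at hS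
  rw [show (p ^ 2) ^ 2 = p ^ 4 by ring] at hA hA'
  have hc := seriesPhi_contiguous_inv hω hp0 hp
  have h37 := qPochInf_succ (p ^ 3) hQ
  rw [show p ^ 3 * p ^ 4 = p ^ 7 by ring] at h37
  have m1 : 1 - p ≠ 0 := by simpa using one_sub_pow_succ_ne_zero hp 0
  have m2 : 1 - p ^ 2 ≠ 0 := one_sub_pow_succ_ne_zero hp 1
  have m5 : 1 - p ^ 5 ≠ 0 := one_sub_pow_succ_ne_zero hp 4
  have m2' : p ^ 2 - 1 ≠ 0 := by rw [← neg_sub]; exact neg_ne_zero.2 m2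
  have m5' : p ^ 5 - 1 ≠ 0 := by rw [← neg_sub]; exact neg_ne_zero.2 m5
  set C := coeffC ω (p ^ 4) p with hC
  set w : ℕ → ℂ := fun m => qPoch (p ^ 5)⁻¹ (p ^ 4) m / qPoch (p ^ 2)⁻¹ (p ^ 4) m with hw
  -- The weights of the two series expressed through `w` (`w1`, `w2`), and the quotients of
  -- consecutive values of `w` (`w3`, `w4`).
  have w1 : ∀ m, qPoch p⁻¹ (p ^ 4) m / qPoch (p ^ 2) (p ^ 4) m
      = p ^ 3 * (1 - p ^ 2) / (1 - p ^ 5) * w (m + 1) := by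
    intro m
    have g1 : qPoch (p ^ 5)⁻¹ (p ^ 4) (m + 1) = (1 - (p ^ 5)⁻¹) * qPoch p⁻¹ (p ^ 4) m := by
      rw [qPoch_succ', show (p ^ 5)⁻¹ * p ^ 4 = p⁻¹ by field_simp]
    have g2 : qPoch (p ^ 2)⁻¹ (p ^ 4) (m + 1) = (1 - (p ^ 2)⁻¹) * qPoch (p ^ 2) (p ^ 4) m := by
      rw [qPoch_succ', show (p ^ 2)⁻¹ * p ^ 4 = p ^ 2 by field_simp]
    have n2 := qPoch_ne_zero b2 m
    simp only [hw]
    rw [g1, g2, show 1 - (p ^ 5)⁻¹ = (p ^ 5 - 1) / p ^ 5 by field_simp,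
      show 1 - (p ^ 2)⁻¹ = (p ^ 2 - 1) / p ^ 2 by field_simp]
    generalize qPoch p⁻¹ (p ^ 4) m = x1 at *
    generalize qPoch (p ^ 2) (p ^ 4) m = x2 at *
    rw [← neg_sub (p ^ 5) 1, ← neg_sub (p ^ 2) 1]
    generalize p ^ 5 - 1 = y1 at *
    generalize p ^ 2 - 1 = y2 at *
    field_simp
  have w2 : ∀ m, qPoch (p ^ 3) (p ^ 4) m / qPoch (p ^ 2) (p ^ 4) m
      = (p - (p ^ 4) ^ m) / (p - 1) * (qPoch p⁻¹ (p ^ 4) m / qPoch (p ^ 2) (p ^ 4) m) := by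
    intro m
    have g1 : (1 - p⁻¹) * qPoch (p ^ 3) (p ^ 4) m = qPoch p⁻¹ (p ^ 4) m
        * (1 - p⁻¹ * (p ^ 4) ^ m) := by
      rw [← qPoch_succ, qPoch_succ', show p⁻¹ * p ^ 4 = p ^ 3 by field_simp]
    have n2 := qPoch_ne_zero b2 m
    have m1' : p - 1 ≠ 0 := by rw [← neg_sub]; exact neg_ne_zero.2 m1
    generalize qPoch p⁻¹ (p ^ 4) m = x1 at *
    generalize qPoch (p ^ 3) (p ^ 4) m = x2 at *
    generalize qPoch (p ^ 2) (p ^ 4) m = x3 at *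
    generalize (p ^ 4) ^ m = x at *
    field_simp at g1 ⊢
    linear_combination g1
  have w3 : ∀ m, (1 - p ^ 2 * (p ^ 4) ^ m) * w (m + 2) = (1 - p⁻¹ * (p ^ 4) ^ m) * w (m + 1) := by
    intro m
    have g := qPoch_succ p⁻¹ (p ^ 4) m
    have g' := qPoch_succ (p ^ 2) (p ^ 4) m
    have e1 := w1 m
    have e2 := w1 (m + 1)
    have n2 := qPoch_ne_zero b2 m
    have n3 : 1 - p ^ 2 * (p ^ 4) ^ m ≠ 0 := sub_ne_zero.2 (b2 m).symm
    rw [g, g'] at e2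
    have hK : p ^ 3 * (1 - p ^ 2) / (1 - p ^ 5) ≠ 0 := by positivity
    generalize p ^ 3 * (1 - p ^ 2) / (1 - p ^ 5) = K at *
    apply mul_left_cancel₀ hK
    generalize 1 - p ^ 2 * (p ^ 4) ^ m = y at *
    generalize 1 - p⁻¹ * (p ^ 4) ^ m = z at *
    generalize qPoch p⁻¹ (p ^ 4) m = x1 at *
    generalize qPoch (p ^ 2) (p ^ 4) m = x2 at *
    rw [mul_left_comm, ← e2, mul_left_comm, ← e1]
    field_simp
  have w4 : ∀ m, (1 - (p ^ 2)⁻¹ * (p ^ 4) ^ m) * w (m + 1)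
      = (1 - (p ^ 5)⁻¹ * (p ^ 4) ^ m) * w m := by
    intro m
    simp only [hw]
    have n2 := qPoch_ne_zero c2 m
    have n3 : 1 - (p ^ 2)⁻¹ * (p ^ 4) ^ m ≠ 0 := sub_ne_zero.2 (c2 m).symm
    rw [qPoch_succ, qPoch_succ]
    generalize 1 - (p ^ 2)⁻¹ * (p ^ 4) ^ m = y at *
    generalize qPoch (p ^ 2)⁻¹ (p ^ 4) m = x1 at *
    field_simp
  have hwb : ∃ B : ℝ, ∀ m, ‖w m‖ ≤ B := by
    obtain ⟨L, hL0, hL⟩ := exists_norm_qPoch_le (p ^ 5)⁻¹ hQ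
    obtain ⟨D, hD0, hD⟩ := exists_norm_inv_qPoch_le hQ c2
    refine ⟨L * D, fun m => ?_⟩
    simp only [hw, div_eq_mul_inv, norm_mul]
    exact mul_le_mul (hL m) (hD m) (norm_nonneg _) hL0.le
  obtain ⟨B, hB⟩ := hwb
  have hparts := tsum_coeffC_by_parts (β := p) hω hQ hp3 hB
  have hsS := summable_coeffC_mul (β := p) (l := (p ^ 5)⁻¹) hω hQ hp3 c2
  have hs1 := summable_coeffC_mul (β := p) (l := p⁻¹) hω hQ hp3 b2
  have hs3 := summable_coeffC_mul (β := p) (l := p ^ 3) hω hQ hp3 b2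
  have m1' : p - 1 ≠ 0 := by rw [← neg_sub]; exact neg_ne_zero.2 m1
  have hsub : (1 + p + p ^ 2) * seriesA ω (p ^ 2) p (p ^ 3) - seriesA ω (p ^ 2) p p
      = qPochInf (p ^ 3 * ω) (p ^ 4) * qPochInf (p ^ 3 * ω ^ 2) (p ^ 4)
        * ((1 + p) * ∑' m, C m * (p ^ 3) ^ m * w m) := by
    have hT : (1 + p + p ^ 2) * (∑' m, C m * (p ^ 3) ^ m
          * (qPoch (p ^ 3) (p ^ 4) m / qPoch (p ^ 2) (p ^ 4) m))
        - (∑' m, C m * (p ^ 3) ^ m * (qPoch p⁻¹ (p ^ 4) m / qPoch (p ^ 2) (p ^ 4) m))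
        = (1 + p) * ∑' m, C m * (p ^ 3) ^ m * w m := by
      -- The defect is a multiple of the sum that vanishes by summation by parts.
      have hT' : (1 + p + p ^ 2) * (∑' m, C m * (p ^ 3) ^ m
            * (qPoch (p ^ 3) (p ^ 4) m / qPoch (p ^ 2) (p ^ 4) m))
          - (∑' m, C m * (p ^ 3) ^ m * (qPoch p⁻¹ (p ^ 4) m / qPoch (p ^ 2) (p ^ 4) m))
          - (1 + p) * ∑' m, C m * (p ^ 3) ^ m * w m
          = (1 - p ^ 2) / ((1 - p ^ 5) * (p - 1)) * ∑' m, C m * (p ^ 3) ^ m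
            * ((1 - (p ^ 4) ^ m) * w m + p ^ 3 * (1 - p * (p ^ 4) ^ m) * w (m + 1)
              + (p ^ 3) ^ 2 * (1 - p ^ 2 * (p ^ 4) ^ m) * w (m + 2)) := by
        rw [← tsum_mul_left, ← tsum_mul_left, ← tsum_mul_left,
          ← (hs3.mul_left (1 + p + p ^ 2)).tsum_sub hs1,
          ← ((hs3.mul_left (1 + p + p ^ 2)).sub hs1).tsum_sub (hsS.mul_left (1 + p))]
        refine tsum_congr fun m => ?_
        have e3 := w3 m
        have e4 := w4 m
        rw [w2 m, w1 m]
        change _ - (1 + p) * (C m * (p ^ 3) ^ m * w m) = _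
        have e5 : (1 - (p ^ 4) ^ m) * w m + p ^ 3 * (1 - p * (p ^ 4) ^ m) * w (m + 1)
              + (p ^ 3) ^ 2 * (1 - p ^ 2 * (p ^ 4) ^ m) * w (m + 2)
            = (1 - p ^ 5) * w m
              + p ^ 3 * (1 + p ^ 2 + p ^ 3 - (1 + p + p ^ 2) * (p ^ 4) ^ m) * w (m + 1) := by
          generalize (p ^ 4) ^ m = x at *
          field_simp at e3 e4
          linear_combination p ^ 5 * e3 - e4
        rw [e5]
        generalize (p ^ 4) ^ m = x at *
        generalize (p ^ 3) ^ m = y at *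
        obtain ⟨v, hv⟩ : ∃ v, v = 1 - p ^ 5 := ⟨_, rfl⟩
        rw [← hv] at m5 ⊢
        field_simp
        ring
      rw [hparts, mul_zero] at hT'
      exact sub_eq_zero.1 hT'
    rw [hE, hE']
    linear_combination (qPochInf (p ^ 3 * ω) (p ^ 4) * qPochInf (p ^ 3 * ω ^ 2) (p ^ 4)) * hT
  have hp1 := qPochInf_succ (p ^ 2)⁻¹ hQ
  rw [show (p ^ 2)⁻¹ * p ^ 4 = p ^ 2 by field_simp,
    show 1 - (p ^ 2)⁻¹ = (p ^ 2 - 1) / p ^ 2 by field_simp] at hp1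
  have hp2 := qPochInf_succ p⁻¹ (hN 12 (by norm_num))
  rw [show p⁻¹ * p ^ 12 = p ^ 11 by field_simp,
    show 1 - p⁻¹ = (p - 1) / p by field_simp] at hp2
  have k0 := qPochInf_omega_mul hω hp
  have k1 : _ = qPochInf (p ^ 2) (p ^ 4) := qPochInf_pow_mul_neg hp 1
  have k2 : _ = _ * qPochInf (p ^ 3) (p ^ 4) := qPochInf_pow_two hp 1
  have k3 : _ = _ * qPochInf (p ^ 7) (p ^ 12) * qPochInf (p ^ 11) (p ^ 12) :=
    qPochInf_pow_three hp 3
  rw [pow_one] at k1 k2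
  have n6 := qPochInf_ne_zero_of_norm hQ (hN 2 (by norm_num))
  have n3 := qPochInf_ne_zero_of_norm hQ hp
  have n4 := qPochInf_ne_zero_of_norm (hN 12 (by norm_num)) (hN 7 (by norm_num))
  have n5 := qPochInf_ne_zero_of_norm (hN 12 (by norm_num)) (hN 8 (by norm_num))
  have hmain : p * (qPochInf (p ^ 3) (p ^ 4) * seriesPhi ω (p ^ 2) p⁻¹ (p ^ 3) (p ^ 3))
      = qPochInf (-p) (p ^ 2) * ((1 + p + p ^ 2) * seriesA ω (p ^ 2) p (p ^ 3)
        - seriesA ω (p ^ 2) p p) := by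
    have hc' : (1 - p) * (p * seriesPhi ω (p ^ 2) p⁻¹ (p ^ 3) (p ^ 3)
        + seriesPhi ω (p ^ 2) p (p ^ 3) p) = seriesPhi ω (p ^ 2) (p ^ 3) (p ^ 7) p := by
      rw [hc]; field_simp
    refine mul_left_cancel₀ m1 ?_
    linear_combination qPochInf (p ^ 3) (p ^ 4) * hc'
      + seriesPhi ω (p ^ 2) (p ^ 3) (p ^ 7) p * h37 - (1 - p ^ 3) * hA' + (1 - p) * hA
  rw [hsub] at hmain
  rw [hp1, hp2] at hS
  rw [eq_div_iff (mul_ne_zero n3 (mul_ne_zero n4 n5))]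
  refine mul_left_cancel₀ n6 (mul_left_cancel₀ hp0 ?_)
  rw [k2, k3] at k1
  change _ * (_ * ∑' m, C m * (p ^ 3) ^ m * w m) = _ at hS
  generalize (∑' m, C m * (p ^ 3) ^ m * w m) = S at *
  generalize seriesPhi ω (p ^ 2) p⁻¹ (p ^ 3) (p ^ 3) = Φ at *
  have hS' : (1 + p) * (qPochInf (p ^ 2) (p ^ 4)
      * (qPochInf (p ^ 3 * ω) (p ^ 4) * qPochInf (p ^ 3 * ω ^ 2) (p ^ 4) * S))
      = p * (qPochInf (p ^ 4 * ω) (p ^ 4) * qPochInf (p ^ 4 * ω ^ 2) (p ^ 4)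
        * (qPochInf (p ^ 11) (p ^ 12) * qPochInf (p ^ 3) (p ^ 12)
          * qPochInf (p ^ 4) (p ^ 12))) := by
    refine mul_left_cancel₀ m1' ?_
    rw [show p ^ 2 - 1 = (p - 1) * (1 + p) by ring] at hS
    generalize qPochInf (p ^ 2) (p ^ 4) = x1 at *
    generalize qPochInf (p ^ 3 * ω) (p ^ 4) = x2 at *
    generalize qPochInf (p ^ 3 * ω ^ 2) (p ^ 4) = x3 at *
    generalize qPochInf (p ^ 4 * ω) (p ^ 4) = x4 at *
    generalize qPochInf (p ^ 4 * ω ^ 2) (p ^ 4) = x5 at *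
    calc _ = p ^ 2 * ((p - 1) * (1 + p) / p ^ 2 * x1 * (x2 * x3 * S)) := by field_simp
      _ = _ := by rw [hS]; field_simp
  linear_combination (qPochInf (p ^ 2) (p ^ 4) * (qPochInf p (p ^ 4)
      * (qPochInf (p ^ 7) (p ^ 12) * qPochInf (p ^ 8) (p ^ 12)))) * hmain
    + (qPochInf (-p) (p ^ 2) * (qPochInf p (p ^ 4)
      * (qPochInf (p ^ 7) (p ^ 12) * qPochInf (p ^ 8) (p ^ 12)))) * hS'
    + (p * qPochInf (-p) (p ^ 2) * qPochInf p (p ^ 4) * qPochInf (p ^ 3) (p ^ 12)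
      * qPochInf (p ^ 7) (p ^ 12) * qPochInf (p ^ 11) (p ^ 12)) * k0 + p * k1

/-! ### Reduction of the triple series -/

theorem two_mul_choose_two (n : ℕ) : 2 * n.choose 2 + n = n * n := by
  induction n with
  | zero => rfl
  | succ n ih =>
    rw [Nat.choose_succ_succ' n 1, Nat.choose_one_right]
    linarith

theorem mul_pred_eq (n : ℕ) : n * (n - 1) = 2 * n.choose 2 := by
  have := two_mul_choose_two n
  rcases n with _ | n
  · rfl
  · rw [Nat.add_sub_cancel]; linarith

/-- The coefficients of `(w z³; p⁶)_∞` as a power series in `z`. -/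
noncomputable def cubeCoeff (p w : ℂ) (n : ℕ) : ℂ :=
  if 3 ∣ n then (-1) ^ (n / 3) * (p ^ 6) ^ (n / 3).choose 2 * w ^ (n / 3)
    / qPoch (p ^ 6) (p ^ 6) (n / 3)
  else 0

theorem cubeCoeff_mul (p w : ℂ) (k : ℕ) : cubeCoeff p w (3 * k)
    = (-1) ^ k * (p ^ 6) ^ k.choose 2 * w ^ k / qPoch (p ^ 6) (p ^ 6) k := by
  rw [cubeCoeff, if_pos (dvd_mul_right 3 k), Nat.mul_div_cancel_left k three_pos]

theorem cubeCoeff_of_not_dvd (p w : ℂ) {n : ℕ} (h : ¬ 3 ∣ n) : cubeCoeff p w n = 0 := if_neg h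

open PowerSeries in
/-- The left-hand side is the coefficient of `z ^ n` in `(s³ z³; p⁶)_∞ / (u z; p)_∞`. The hypotheses
on `u` say that `u` and `u p` are `A` and `s` in some order, so that the denominator is
`(A z, s z; p²)_∞`. The factors `(s z; p²)_∞` cancel, and the right-hand side is the coefficient of
`(s ω z, s ω² z; p²)_∞ / (A z; p²)_∞` provided by `qGauss_coeff`. -/
theorem sum_antidiagonal_cubeCoeff {ω p s A α u : ℂ} (hω : ω ^ 2 + ω + 1 = 0) (hp : ‖p‖ < 1)
    (hα : α * A = s) (hu : u + u * p = A + s) (hu' : u * (u * p) = A * s) (n : ℕ) :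
    ∑ x ∈ antidiagonal n, u ^ x.1 / qPoch p p x.1 * cubeCoeff p (s ^ 3) x.2
      = ∑ x ∈ antidiagonal n, A ^ n * (qPoch (α * ω) (p ^ 2) x.1 * qPoch (α * ω ^ 2) (p ^ 2) x.1
          / qPoch (p ^ 2) (p ^ 2) x.1 * ((-(α ^ 2 * (p ^ 2) ^ x.1)) ^ x.2
            * (p ^ 2) ^ x.2.choose 2 / qPoch (p ^ 2) (p ^ 2) x.2)) := by
  have h3 : ω ^ 3 = 1 := by linear_combination (ω - 1) * hω
  have hq := norm_pow_lt_one hp two_ne_zero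
  have hp6 := norm_pow_lt_one hp (n := 6) (by norm_num)
  have hg := qGauss_coeff hq (α * ω) (α * ω ^ 2) n
  rw [show α * ω * (α * ω ^ 2) = α ^ 2 by linear_combination α ^ 2 * h3] at hg
  rw [← Finset.mul_sum, ← hg]
  set E : PowerSeries ℂ := mk fun n => u ^ n / qPoch p p n with hE
  set K : PowerSeries ℂ := mk (cubeCoeff p (s ^ 3)) with hK
  set P : PowerSeries ℂ := mk fun n => qPoch (α * ω) (p ^ 2) n / qPoch (p ^ 2) (p ^ 2) n with hP
  set R : PowerSeries ℂ := mk fun n : ℕ => (-(α * ω ^ 2)) ^ n * (p ^ 2) ^ n.choose 2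
    / qPoch (p ^ 2) (p ^ 2) n with hR
  have hErec : rescale p E = E - C u * (X * E) := by
    ext n
    rcases n with _ | n
    · simp [hE, qPoch_zero]
    · simp only [hE, map_sub, coeff_C_mul, coeff_succ_X_mul, coeff_rescale, coeff_mk,
        qPoch_self_succ]
      have h1 := qPoch_self_ne_zero hp n
      have h2 := one_sub_pow_succ_ne_zero hp n
      field_simp
      ring
  have hErec2 : rescale (p ^ 2) E = rescale p E - C (u * p) * (X * rescale p E) := by
    rw [pow_two, ← rescale_rescale]
    conv_lhs => rw [hErec]
    simp only [map_sub, map_mul, rescale_C, rescale_X]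
    ring
  have hKrec : K = rescale (p ^ 2) K - C (s ^ 3) * (X ^ 3 * rescale (p ^ 2) K) := by
    ext n
    simp only [hK, map_sub, coeff_C_mul, coeff_X_pow_mul', coeff_rescale, coeff_mk]
    by_cases hn : 3 ∣ n
    · obtain ⟨k, rfl⟩ := hn
      rcases k with _ | k
      · simp
      · rw [if_pos (by omega), show 3 * (k + 1) - 3 = 3 * k by omega, cubeCoeff_mul, cubeCoeff_mul,
          qPoch_self_succ, Nat.choose_succ_succ' k 1, Nat.choose_one_right,
          pow_add _ k (k.choose 2),
          show (p ^ 2) ^ (3 * (k + 1)) = (p ^ 6) ^ (k + 1) by ring,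
          show (p ^ 2) ^ (3 * k) = (p ^ 6) ^ k by ring]
        have h1 := qPoch_self_ne_zero hp6 k
        have h2 := one_sub_pow_succ_ne_zero hp6 k
        generalize p ^ 6 = y at *
        generalize s ^ 3 = z at *
        field_simp
        ring
    · rw [cubeCoeff_of_not_dvd p _ hn]
      split_ifs with h
      · rw [cubeCoeff_of_not_dvd p _ (by omega)]; ring
      · ring
  have hPrec : P - X * P = rescale (p ^ 2) P - C (α * ω) * (X * rescale (p ^ 2) P) := by
    ext n
    rcases n with _ | n
    · simp [hP, qPoch_zero, constantCoeff_rescale]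
    · simp only [hP, map_sub, coeff_C_mul, coeff_succ_X_mul, coeff_rescale, coeff_mk,
        qPoch_self_succ, qPoch_succ (α * ω)]
      have h1 := qPoch_self_ne_zero hq n
      have h2 := one_sub_pow_succ_ne_zero hq n
      generalize p ^ 2 = y at *
      generalize α * ω = z at *
      field_simp
      ring
  have hRrec : R = rescale (p ^ 2) R - C (α * ω ^ 2) * (X * rescale (p ^ 2) R) := by
    ext n
    rcases n with _ | n
    · simp [hR, qPoch_zero, constantCoeff_rescale]
    · simp only [hR, map_sub, coeff_C_mul, coeff_succ_X_mul, coeff_rescale, coeff_mk,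
        qPoch_self_succ, Nat.choose_succ_succ' n 1, Nat.choose_one_right, pow_add _ n (n.choose 2)]
      have h1 := qPoch_self_ne_zero hq n
      have h2 := one_sub_pow_succ_ne_zero hq n
      generalize p ^ 2 = y at *
      generalize α * ω ^ 2 = z at *
      field_simp
      ring
  have cs : (C α : PowerSeries ℂ) * C A = C s := by rw [← map_mul, hα]
  -- Both products satisfy the same first-order `q`-difference equation.
  have hL : (1 - C A * X) * (E * K)
      = (1 + C s * X + C s ^ 2 * X ^ 2) * rescale (p ^ 2) (E * K) := by
    have hne : (1 - C s * X : PowerSeries ℂ) ≠ 0 := by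
      intro h
      have := congrArg constantCoeff h
      simp at this
    have c1 : (C u : PowerSeries ℂ) + C u * C p = C A + C s := by
      rw [← map_mul, ← map_add, hu, map_add]
    have c2 : (C u : PowerSeries ℂ) * (C u * C p) = C A * C s := by
      rw [← map_mul, ← map_mul, hu', map_mul]
    apply mul_left_cancel₀ hne
    rw [map_mul, hErec2, hErec]
    simp only [map_mul, map_pow] at hKrec ⊢
    linear_combination (1 - C s * X) * (1 - C A * X) * E * hKrec
      + (X * c1 - X ^ 2 * c2) * (E * (rescale (p ^ 2) K - C s ^ 3 * (X ^ 3 * rescale (p ^ 2) K)))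
  have hM : (1 - C A * X) * rescale A (P * R)
      = (1 + C s * X + C s ^ 2 * X ^ 2) * rescale (p ^ 2) (rescale A (P * R)) := by
    have c1 : (C (α * ω) : PowerSeries ℂ) + C (α * ω ^ 2) = - C α := by
      rw [← map_add, ← map_neg]
      congr 1
      linear_combination α * hω
    have c2 : (C (α * ω) : PowerSeries ℂ) * C (α * ω ^ 2) = C α ^ 2 := by
      rw [← map_mul, ← map_pow]
      congr 1
      linear_combination α ^ 2 * h3
    have hPR : (1 - X) * (P * R) = (1 + C α * X + C α ^ 2 * X ^ 2) * rescale (p ^ 2) (P * R) := by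
      rw [map_mul]
      linear_combination R * hPrec + (rescale (p ^ 2) P - C (α * ω) * (X * rescale (p ^ 2) P))
        * hRrec
        + rescale (p ^ 2) P * rescale (p ^ 2) R * (X ^ 2 * c2 - X * c1)
    have h := congrArg (rescale A) hPR
    rw [map_mul, map_mul (rescale A) (1 + C α * X + C α ^ 2 * X ^ 2)] at h
    simp only [map_sub, map_add, map_one, map_pow, rescale_X, rescale_C, map_mul _ (C α),
      map_mul _ (C α ^ 2)] at h
    rw [rescale_rescale, mul_comm (p ^ 2), ← rescale_rescale] at h
    rw [h, ← cs]
    ring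
  have hzero : E * K - rescale A (P * R) = 0 := by
    refine eq_zero_of_rescale (q := p ^ 2) (P₀ := 1 - C A * X)
      (P₁ := 1 + C s * X + C s ^ 2 * X ^ 2) (P₂ := 0) ?_ ?_ ?_
    · rw [map_sub]
      linear_combination hL - hM
    · have : cubeCoeff p (s ^ 3) 0 = 1 := by simp [cubeCoeff, qPoch_zero]
      rw [map_sub, constantCoeff_rescale]
      simp [hE, hK, hP, hR, qPoch_zero, this]
    · intro n
      have h2 := one_sub_pow_succ_ne_zero hq n
      simpa using h2
  have := congrArg (coeff n) (sub_eq_zero.1 hzero)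
  rw [coeff_rescale, coeff_mul, coeff_mul] at this
  simpa only [hE, hK, hP, hR, coeff_mk] using this

open PowerSeries in
/-- A finite form of `(q z; q²)_∞ / (κ z; q)_∞ = 1 / (κ² z; q²)_∞` for `κ = 1` and `κ = q`. -/
theorem sum_antidiagonal_kappa {q κ : ℂ} (hq : ‖q‖ < 1) (hκ : κ = 1 ∨ κ = q) (m : ℕ) :
    ∑ x ∈ antidiagonal m, κ ^ x.1 / qPoch q q x.1
        * ((-1) ^ x.2 * q ^ (x.2 * x.2) / qPoch (q ^ 2) (q ^ 2) x.2)
      = (κ ^ 2) ^ m / qPoch (q ^ 2) (q ^ 2) m := by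
  have hQ := norm_pow_lt_one hq two_ne_zero
  have hgen : ∀ {r a : ℂ}, ‖r‖ < 1 → rescale r (mk fun n => a ^ n / qPoch r r n)
      = (mk fun n => a ^ n / qPoch r r n) - C a * (X * mk fun n => a ^ n / qPoch r r n) := by
    intro r a hr
    ext n
    rcases n with _ | n
    · simp [qPoch_zero]
    · simp only [map_sub, coeff_C_mul, coeff_succ_X_mul, coeff_rescale, coeff_mk, qPoch_self_succ]
      have h1 := qPoch_self_ne_zero hr n
      have h2 := one_sub_pow_succ_ne_zero hr n
      field_simp
      ring
  have hP := hgen (a := κ) hq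
  have hR := hgen (a := κ ^ 2) hQ
  set P : PowerSeries ℂ := mk fun n => κ ^ n / qPoch q q n with hPdef
  set R : PowerSeries ℂ := mk fun n => (κ ^ 2) ^ n / qPoch (q ^ 2) (q ^ 2) n with hRdef
  set E : PowerSeries ℂ := mk fun n => (-1) ^ n * q ^ (n * n) / qPoch (q ^ 2) (q ^ 2) n with hEdef
  have hP2 : rescale (q ^ 2) P = rescale q P - C (κ * q) * (X * rescale q P) := by
    rw [pow_two, ← rescale_rescale]
    conv_lhs => rw [hP]
    simp only [map_sub, map_mul, rescale_C, rescale_X]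
    ring
  have hE : E = rescale (q ^ 2) E - C q * (X * rescale (q ^ 2) E) := by
    ext n
    rcases n with _ | n
    · simp [hEdef, qPoch_zero, constantCoeff_rescale]
    · simp only [hEdef, map_sub, coeff_C_mul, coeff_succ_X_mul, coeff_rescale, coeff_mk,
        qPoch_self_succ]
      rw [show q ^ ((n + 1) * (n + 1)) = q ^ (n * n) * (q ^ 2) ^ n * q by ring]
      have h1 := qPoch_self_ne_zero hQ n
      have h2 := one_sub_pow_succ_ne_zero hQ n
      generalize q ^ (n * n) = z at *
      generalize q ^ 2 = y at *
      field_simp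
      ring
  have hPE : (1 - C (κ ^ 2) * X) * (P * E) = rescale (q ^ 2) (P * E) := by
    have hne : (1 - C q * X : PowerSeries ℂ) ≠ 0 := by
      intro h
      have := congrArg constantCoeff h
      simp at this
    apply mul_left_cancel₀ hne
    rw [map_mul, hP2, hP]
    rcases hκ with rfl | rfl
    · simp only [one_mul, one_pow, map_one] at hE ⊢
      linear_combination (1 - C q * X) * (1 - X) * P * hE
    · simp only [map_mul, map_pow] at hE ⊢
      linear_combination (1 - C κ * X) * (1 - C κ ^ 2 * X) * P * hE
  have hzero : P * E - R = 0 := by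
    refine eq_zero_of_rescale (q := q ^ 2) (P₀ := 1 - C (κ ^ 2) * X) (P₁ := 1) (P₂ := 0) ?_ ?_ ?_
    · rw [map_sub]
      linear_combination hPE + hR
    · simp [hPdef, hEdef, hRdef, qPoch_zero]
    · intro n
      have h2 := one_sub_pow_succ_ne_zero hQ n
      simpa using h2
  have := congrArg (coeff m) (sub_eq_zero.1 hzero)
  rw [coeff_mul] at this
  simpa only [hPdef, hEdef, hRdef, coeff_mk] using this

theorem summable_of_norm_le_choose_two {f : ℕ × ℕ × ℕ → ℂ} {C x M : ℝ} (hx0 : 0 ≤ x) (hx : x < 1)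
    (hM : 0 ≤ M) (hC : 0 ≤ C)
    (h : ∀ j k l, ‖f (j, k, l)‖ ≤ C * (x ^ (k + l + 2 * j).choose 2 * M ^ (k + l + 2 * j))) :
    Summable f := by
  obtain ⟨B, hB0, hB⟩ := exists_pow_choose_two_le hx0 hx hM
  have hg : Summable fun n : ℕ => (1 / 2 : ℝ) ^ n :=
    summable_geometric_of_lt_one (by norm_num) (by norm_num)
  have hg0 : ∀ n : ℕ, 0 ≤ (1 / 2 : ℝ) ^ n := fun n => by positivity
  have hg2 := hg.mul_of_nonneg hg hg0 hg0
  have hg3 := hg.mul_of_nonneg hg2 hg0 (fun x => by positivity)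
  refine Summable.of_norm_bounded (hg3.mul_left (C * B)) fun y => ?_
  obtain ⟨j, k, l⟩ := y
  refine (h j k l).trans ?_
  rw [mul_assoc C B]
  refine mul_le_mul_of_nonneg_left ((hB _).trans (mul_le_mul_of_nonneg_left ?_ hB0.le)) hC
  change _ ≤ (1 / 2 : ℝ) ^ j * ((1 / 2) ^ k * (1 / 2) ^ l)
  rw [← pow_add, ← pow_add]
  exact pow_le_pow_of_le_one (by norm_num) (by norm_num) (by omega)

theorem pow_le_one_add_pow {a : ℝ} (ha : 0 ≤ a) {m n : ℕ} (h : m ≤ n) : a ^ m ≤ (1 + a) ^ n :=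
  (pow_le_pow_left₀ ha (by linarith) m).trans (pow_le_pow_right₀ (by linarith) h)

/-- Two double sequences with equal antidiagonal sums can be exchanged in a triple series whose
weight depends only on the sum of the two indices. -/
theorem tsum_eq_of_antidiagonal_eq {a b : ℕ × ℕ → ℂ} {g : ℕ → ℕ → ℂ}
    (hab : ∀ n, ∑ x ∈ antidiagonal n, a x = ∑ x ∈ antidiagonal n, b x)
    (ha : Summable fun x : ℕ × ℕ × ℕ => g x.1 (x.2.1 + x.2.2) * a x.2)
    (hb : Summable fun x : ℕ × ℕ × ℕ => g x.1 (x.2.1 + x.2.2) * b x.2) :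
    ∑' x : ℕ × ℕ × ℕ, g x.1 (x.2.1 + x.2.2) * a x.2
      = ∑' x : ℕ × ℕ × ℕ, g x.1 (x.2.1 + x.2.2) * b x.2 := by
  rw [ha.tsum_prod, hb.tsum_prod]
  refine tsum_congr fun j => ?_
  have e : ∀ c : ℕ × ℕ → ℂ, (Summable fun x : ℕ × ℕ × ℕ => g x.1 (x.2.1 + x.2.2) * c x.2) →
      ∑' y : ℕ × ℕ, g j (y.1 + y.2) * c y = ∑' n, g j n * ∑ x ∈ antidiagonal n, c x := by
    intro c hc
    rw [← tsum_antidiagonal (hc.prod_factor j)]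
    refine tsum_congr fun n => ?_
    rw [Finset.mul_sum]
    refine Finset.sum_congr rfl fun x hx => ?_
    rw [← Finset.HasAntidiagonal.mem_antidiagonal.1 hx]
  rw [e a ha, e b hb]
  simp only [hab]

/-- The exponents of `q` on the two sides of the passage from `(k, l, j)` to `(k, l + j)`. -/
theorem choose_two_add (k l j : ℕ) : (k + l + 2 * j).choose 2 + k * l + l.choose 2
    = k.choose 2 + 2 * (k * (l + j)) + 2 * (l + j).choose 2 + j * j := by
  have h1 := two_mul_choose_two (k + l + 2 * j)
  have h2 := two_mul_choose_two k
  have h3 := two_mul_choose_two l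
  have h4 := two_mul_choose_two (l + j)
  nlinarith

/-- Reduction of the triple series to one variable. By `sum_antidiagonal_cubeCoeff`, the sum over
`i` and `k` is replaced by one over `k` and `l`. The condition on `κ` then lets
`sum_antidiagonal_kappa` merge the sums over `l` and `j` into an instance of Euler's expansion of
`(γ p ^ (4 k); p ^ 4)_∞`. -/
theorem summable_and_F_eq {ω p s A α u v γ κ : ℂ} (hω : ω ^ 2 + ω + 1 = 0) (hp : ‖p‖ < 1)
    (hα : α * A = s) (hu : u + u * p = A + s) (hu' : u * (u * p) = A * s)
    (hκ : κ = 1 ∨ κ = p ^ 2) (hD : A * α ^ 2 = κ * v) (hγ : κ ^ 2 * v = γ)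
    (hγ' : ∀ n : ℕ, γ * (p ^ 4) ^ n ≠ 1) :
    Summable (tripleTerm p u v (s ^ 3)) ∧
      F p u v (s ^ 3) = qPochInf γ (p ^ 4) * seriesPhi ω (p ^ 2) α γ A := by
  have hq := norm_pow_lt_one hp two_ne_zero
  have hQ := norm_pow_lt_one hp four_ne_zero
  have hp6 := norm_pow_lt_one hp (n := 6) (by norm_num)
  set g : ℕ → ℕ → ℂ := fun j n => v ^ j / qPoch (p ^ 4) (p ^ 4) j * (p ^ 2) ^ (n + 2 * j).choose 2
    with hg
  set a : ℕ × ℕ → ℂ := fun x => u ^ x.1 / qPoch p p x.1 * cubeCoeff p (s ^ 3) x.2 with ha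
  set b : ℕ × ℕ → ℂ := fun x => A ^ (x.1 + x.2) * (qPoch (α * ω) (p ^ 2) x.1
    * qPoch (α * ω ^ 2) (p ^ 2) x.1 / qPoch (p ^ 2) (p ^ 2) x.1 * ((-(α ^ 2 * (p ^ 2) ^ x.1)) ^ x.2
    * (p ^ 2) ^ x.2.choose 2 / qPoch (p ^ 2) (p ^ 2) x.2)) with hb
  obtain ⟨K₁, hK₁0, hK₁⟩ := exists_norm_inv_qPoch_le hp (mul_pow_ne_one hp hp)
  obtain ⟨K₂, hK₂0, hK₂⟩ := exists_norm_inv_qPoch_le hq (mul_pow_ne_one hq hq)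
  obtain ⟨K₄, hK₄0, hK₄⟩ := exists_norm_inv_qPoch_le hQ (mul_pow_ne_one hQ hQ)
  obtain ⟨K₆, hK₆0, hK₆⟩ := exists_norm_inv_qPoch_le hp6 (mul_pow_ne_one hp6 hp6)
  obtain ⟨A₁, hA₁0, hA₁⟩ := exists_norm_qPoch_le (α * ω) hq
  obtain ⟨A₂, hA₂0, hA₂⟩ := exists_norm_qPoch_le (α * ω ^ 2) hq
  have hsa : Summable fun x : ℕ × ℕ × ℕ => g x.1 (x.2.1 + x.2.2) * a x.2 := by
    refine summable_of_norm_le_choose_two (x := ‖p ^ 2‖)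
      (M := (1 + ‖v‖) * (1 + ‖u‖) * (1 + ‖s ^ 3‖)) (C := K₄ * K₁ * K₆) (norm_nonneg _) hq
      (by positivity) (by positivity) fun j i m => ?_
    have hc : ‖cubeCoeff p (s ^ 3) m‖ ≤ K₆ * (1 + ‖s ^ 3‖) ^ (i + m + 2 * j) := by
      rw [cubeCoeff]
      split_ifs
      · rw [div_eq_mul_inv, norm_mul, norm_mul, norm_mul, norm_pow, norm_neg, norm_one, one_pow,
          one_mul, norm_pow (p ^ 6), norm_pow (s ^ 3), mul_comm K₆]
        refine mul_le_mul ?_ (hK₆ _) (norm_nonneg _) (by positivity)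
        refine (mul_le_of_le_one_left (by positivity)
          (pow_le_one₀ (norm_nonneg _) hp6.le)).trans ?_
        exact pow_le_one_add_pow (norm_nonneg _) (by omega)
      · rw [norm_zero]; positivity
    have h1 : ‖v‖ ^ j ≤ (1 + ‖v‖) ^ (i + m + 2 * j) := pow_le_one_add_pow (norm_nonneg _) (by omega)
    have h2 : ‖u‖ ^ i ≤ (1 + ‖u‖) ^ (i + m + 2 * j) := pow_le_one_add_pow (norm_nonneg _) (by omega)
    simp only [hg, ha, div_eq_mul_inv]
    calc _ = ‖v‖ ^ j * ‖(qPoch (p ^ 4) (p ^ 4) j)⁻¹‖ * ‖p ^ 2‖ ^ (i + m + 2 * j).choose 2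
          * (‖u‖ ^ i * ‖(qPoch p p i)⁻¹‖ * ‖cubeCoeff p (s ^ 3) m‖) := by
          rw [norm_mul, norm_mul, norm_mul, norm_mul, norm_mul, norm_pow v, norm_pow u,
            norm_pow (p ^ 2)]
      _ ≤ (1 + ‖v‖) ^ (i + m + 2 * j) * K₄ * ‖p ^ 2‖ ^ (i + m + 2 * j).choose 2
          * ((1 + ‖u‖) ^ (i + m + 2 * j) * K₁ * (K₆ * (1 + ‖s ^ 3‖) ^ (i + m + 2 * j))) := by
          gcongr
          exacts [hK₄ j, hK₁ i]
      _ = _ := by rw [mul_pow, mul_pow]; ring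
  have hsb : Summable fun x : ℕ × ℕ × ℕ => g x.1 (x.2.1 + x.2.2) * b x.2 := by
    refine summable_of_norm_le_choose_two (x := ‖p ^ 2‖)
      (M := (1 + ‖v‖) * (1 + ‖A‖) * (1 + ‖α ^ 2‖)) (C := K₄ * (A₁ * A₂ * K₂ * K₂))
        (norm_nonneg _) hq
      (by positivity) (by positivity) fun j k l => ?_
    have h1 : ‖v‖ ^ j ≤ (1 + ‖v‖) ^ (k + l + 2 * j) := pow_le_one_add_pow (norm_nonneg _) (by omega)
    have h2 : ‖A‖ ^ (k + l) ≤ (1 + ‖A‖) ^ (k + l + 2 * j) :=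
      pow_le_one_add_pow (norm_nonneg _) (by omega)
    have h3 : ‖α ^ 2 * (p ^ 2) ^ k‖ ^ l ≤ (1 + ‖α ^ 2‖) ^ (k + l + 2 * j) := by
      refine le_trans ?_ (pow_le_one_add_pow (norm_nonneg (α ^ 2))
        (show l ≤ k + l + 2 * j by omega))
      refine pow_le_pow_left₀ (norm_nonneg _) ?_ l
      rw [norm_mul, norm_pow (p ^ 2)]
      exact mul_le_of_le_one_right (norm_nonneg _) (pow_le_one₀ (norm_nonneg _) hq.le)
    have h4 : ‖p ^ 2‖ ^ l.choose 2 ≤ 1 := pow_le_one₀ (norm_nonneg _) hq.le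
    simp only [hg, hb, div_eq_mul_inv]
    calc _ = ‖v‖ ^ j * ‖(qPoch (p ^ 4) (p ^ 4) j)⁻¹‖ * ‖p ^ 2‖ ^ (k + l + 2 * j).choose 2
          * (‖A‖ ^ (k + l) * (‖qPoch (α * ω) (p ^ 2) k‖ * ‖qPoch (α * ω ^ 2) (p ^ 2) k‖
            * ‖(qPoch (p ^ 2) (p ^ 2) k)⁻¹‖ * (‖α ^ 2 * (p ^ 2) ^ k‖ ^ l * ‖p ^ 2‖ ^ l.choose 2
            * ‖(qPoch (p ^ 2) (p ^ 2) l)⁻¹‖))) := by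
          rw [norm_mul, norm_mul, norm_mul, norm_mul (A ^ (k + l)), norm_mul, norm_mul, norm_mul,
            norm_mul, norm_mul ((-(α ^ 2 * (p ^ 2) ^ k)) ^ l), norm_pow v, norm_pow A,
            norm_pow (p ^ 2) (_ : ℕ), norm_pow (-(α ^ 2 * (p ^ 2) ^ k)), norm_neg,
            norm_pow (p ^ 2) (l.choose 2)]
      _ ≤ (1 + ‖v‖) ^ (k + l + 2 * j) * K₄ * ‖p ^ 2‖ ^ (k + l + 2 * j).choose 2
          * ((1 + ‖A‖) ^ (k + l + 2 * j) * (A₁ * A₂ * K₂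
            * ((1 + ‖α ^ 2‖) ^ (k + l + 2 * j) * 1 * K₂))) := by
          gcongr
          exacts [hK₄ j, hA₁ k, hA₂ k, hK₂ k, hK₂ l]
      _ = _ := by rw [mul_pow, mul_pow]; ring
  -- The index `3 k` turns the triple series into one over `j`, `i` and the exponent of `z`.
  set ι : ℕ × ℕ × ℕ → ℕ × ℕ × ℕ := fun x => (x.2.1, x.1, 3 * x.2.2) with hι
  have hιi : Function.Injective ι := by
    rintro ⟨i, j, k⟩ ⟨i', j', k'⟩ h
    simp only [hι, Prod.mk.injEq] at h ⊢
    omega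
  have hterm : tripleTerm p u v (s ^ 3)
      = (fun x : ℕ × ℕ × ℕ => g x.1 (x.2.1 + x.2.2) * a x.2) ∘ ι := by
    funext x
    obtain ⟨i, j, k⟩ := x
    simp only [tripleTerm, Function.comp, hι, hg, ha, cubeCoeff_mul, mul_pred_eq]
    rw [show i + 3 * k + 2 * j = i + 2 * j + 3 * k by ring, pow_add p, ← pow_mul p 2, ← pow_mul p 6,
      show 3 * (2 * k.choose 2) = 6 * k.choose 2 by ring]
    ring
  have hsupp : Function.support (fun x : ℕ × ℕ × ℕ => g x.1 (x.2.1 + x.2.2) * a x.2)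
    ⊆ Set.range ι := by
    rintro ⟨j, i, m⟩ hx
    by_cases hm : 3 ∣ m
    · obtain ⟨k, rfl⟩ := hm
      exact ⟨(i, j, k), rfl⟩
    · exact absurd (by simp [ha, cubeCoeff_of_not_dvd p _ hm]) hx
  refine ⟨hterm ▸ hsa.comp_injective hιi, ?_⟩
  have hab : ∀ n, ∑ x ∈ antidiagonal n, a x = ∑ x ∈ antidiagonal n, b x := by
    intro n
    rw [sum_antidiagonal_cubeCoeff hω hp hα hu hu' n]
    refine Finset.sum_congr rfl fun x hx => ?_
    simp only [hb, Finset.HasAntidiagonal.mem_antidiagonal.1 hx]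
  -- The sum over `k` becomes the outermost one.
  let e : ℕ × ℕ × ℕ ≃ ℕ × ℕ × ℕ :=
    { toFun := fun x => (x.2.2, x.1, x.2.1)
      invFun := fun x => (x.2.1, x.2.2, x.1)
      left_inv := fun _ => rfl
      right_inv := fun _ => rfl }
  have hse : Summable fun x : ℕ × ℕ × ℕ => g x.2.2 (x.1 + x.2.1) * b (x.1, x.2.1) :=
    e.summable_iff.2 hsb
  have hte : ∑' x : ℕ × ℕ × ℕ, g x.1 (x.2.1 + x.2.2) * b x.2
      = ∑' x : ℕ × ℕ × ℕ, g x.2.2 (x.1 + x.2.1) * b (x.1, x.2.1) :=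
    (e.tsum_eq fun x : ℕ × ℕ × ℕ => g x.1 (x.2.1 + x.2.2) * b x.2).symm
  have ht : ∑' x, tripleTerm p u v (s ^ 3) x
      = ∑' x : ℕ × ℕ × ℕ, g x.1 (x.2.1 + x.2.2) * a x.2 := by
    rw [hterm]
    exact hιi.tsum_eq hsupp
  rw [F, ht, tsum_eq_of_antidiagonal_eq hab hsa hsb, hte, hse.tsum_prod,
    seriesPhi, ← tsum_mul_left]
  refine tsum_congr fun k => ?_
  rw [← tsum_antidiagonal (hse.prod_factor k)]
  -- The inner sum over `l + j = m` is a term of Euler's expansion.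
  have hm : ∀ m, ∑ x ∈ antidiagonal m, g x.2 (k + x.1) * b (k, x.1)
      = qPoch (α * ω) (p ^ 2) k * qPoch (α * ω ^ 2) (p ^ 2) k / qPoch (p ^ 2) (p ^ 2) k * A ^ k
        * (p ^ 2) ^ k.choose 2 * ((-1) ^ m * (p ^ 4) ^ m.choose 2 / qPoch (p ^ 4) (p ^ 4) m
          * (γ * (p ^ 4) ^ k) ^ m) := by
    intro m
    have hk := sum_antidiagonal_kappa hq hκ m
    rw [show (p ^ 2) ^ 2 = p ^ 4 by ring] at hk
    have h1 : qPoch (α * ω) (p ^ 2) k * qPoch (α * ω ^ 2) (p ^ 2) k / qPoch (p ^ 2) (p ^ 2) k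
      * A ^ k
        * (p ^ 2) ^ k.choose 2 * ((-1) ^ m * (p ^ 4) ^ m.choose 2 / qPoch (p ^ 4) (p ^ 4) m
          * (γ * (p ^ 4) ^ k) ^ m)
        = qPoch (α * ω) (p ^ 2) k * qPoch (α * ω ^ 2) (p ^ 2) k / qPoch (p ^ 2) (p ^ 2) k * A ^ k
        * (p ^ 2) ^ k.choose 2 * (p ^ 4) ^ m.choose 2 * ((p ^ 4) ^ k) ^ m * (-v) ^ m
          * ((κ ^ 2) ^ m / qPoch (p ^ 4) (p ^ 4) m) := by
      rw [← hγ, mul_pow _ _ m, mul_pow _ v m, neg_pow v]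
      ring
    rw [h1, ← hk, Finset.mul_sum]
    refine Finset.sum_congr rfl fun x hx => ?_
    rw [← Finset.HasAntidiagonal.mem_antidiagonal.1 hx]
    obtain ⟨l, j⟩ := x
    have hexp : (p ^ 2) ^ (k + l + 2 * j).choose 2 * ((p ^ 2) ^ k) ^ l * (p ^ 2) ^ l.choose 2
        = (p ^ 2) ^ k.choose 2 * ((p ^ 4) ^ k) ^ (l + j) * (p ^ 4) ^ (l + j).choose 2
          * (p ^ 2) ^ (j * j) := by
      rw [show p ^ 4 = (p ^ 2) ^ 2 by ring]
      simp only [← pow_mul, ← pow_add]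
      congr 1
      have := choose_two_add k l j
      linarith
    have hDl : A ^ l * (α ^ 2) ^ l = κ ^ l * v ^ l := by rw [← mul_pow, hD, mul_pow]
    have hone : (-1 : ℂ) ^ j * (-1) ^ j = 1 := by rw [← mul_pow]; simp
    simp only [hg, hb]
    rw [neg_pow (α ^ 2 * (p ^ 2) ^ k), mul_pow (α ^ 2), neg_pow v]
    calc _ = ((p ^ 2) ^ (k + l + 2 * j).choose 2 * ((p ^ 2) ^ k) ^ l * (p ^ 2) ^ l.choose 2)
          * (A ^ l * (α ^ 2) ^ l) * (qPoch (α * ω) (p ^ 2) k * qPoch (α * ω ^ 2) (p ^ 2) k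
          / qPoch (p ^ 2) (p ^ 2) k * A ^ k * (-1) ^ l * v ^ j / qPoch (p ^ 4) (p ^ 4) j
          / qPoch (p ^ 2) (p ^ 2) l) := by
          generalize p ^ 2 = y
          generalize p ^ 4 = z
          ring
      _ = ((-1 : ℂ) ^ j * (-1) ^ j) * ((p ^ 2) ^ k.choose 2 * ((p ^ 4) ^ k) ^ (l + j)
          * (p ^ 4) ^ (l + j).choose 2 * (p ^ 2) ^ (j * j) * (κ ^ l * v ^ l)
          * (qPoch (α * ω) (p ^ 2) k * qPoch (α * ω ^ 2) (p ^ 2) k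
          / qPoch (p ^ 2) (p ^ 2) k * A ^ k * (-1) ^ l * v ^ j / qPoch (p ^ 4) (p ^ 4) j
          / qPoch (p ^ 2) (p ^ 2) l)) := by
          rw [hexp, hDl, hone, one_mul]
      _ = _ := by
          generalize p ^ 2 = y
          generalize p ^ 4 = z
          ring
  simp only [hm]
  rw [tsum_mul_left, euler hQ, qPochInf_eq_mul γ hQ k, termPhi, show (p ^ 2) ^ 2 = p ^ 4 by ring]
  have hne := qPoch_ne_zero hγ' k
  generalize qPoch γ (p ^ 4) k = y at *
  field_simp

/-! ### Passage to the basic hypergeometric series -/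

theorem phiTerm_two_one (a ω β q z : ℂ) (n : ℕ) :
    phiTerm [a * ω, -a * ω] [-β] q z n
      = qPoch (a ^ 2 * ω ^ 2) (q ^ 2) n / (qPoch q q n * qPoch (-β) q n) * z ^ n := by
  have h : qPoch (a * ω) q n * qPoch (-a * ω) q n = qPoch (a ^ 2 * ω ^ 2) (q ^ 2) n := by
    rw [neg_mul, qPoch_mul_neg, mul_pow]
  simp [phiTerm, qPochList, ← h]

theorem summable_phiTerm_two_one {q β z : ℂ} (hq : ‖q‖ < 1) (hβ : ‖β‖ < 1) (hz : ‖z‖ < 1)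
    (a ω : ℂ) :
    Summable (phiTerm [a * ω, -a * ω] [-β] q z) := by
  obtain ⟨C₁, hC₁, h₁⟩ := exists_norm_qPoch_le (a ^ 2 * ω ^ 2) (q := q ^ 2)
    (norm_pow_lt_one hq two_ne_zero)
  obtain ⟨C₂, hC₂, h₂⟩ := exists_norm_inv_qPoch_le hq (mul_pow_ne_one hq hq)
  obtain ⟨C₃, -, h₃⟩ := exists_norm_inv_qPoch_le hq
    (mul_pow_ne_one hq (a := -β) (by rwa [norm_neg]))
  refine summable_of_norm_le_geom (C := C₁ * (C₂ * C₃)) (norm_nonneg z) hz fun n => ?_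
  rw [phiTerm_two_one, div_eq_mul_inv, mul_inv, norm_mul, norm_mul, norm_mul, norm_pow]
  gcongr
  exacts [h₁ n, h₂ n, h₃ n]

theorem qPochInf_mul_phi_two_one {a β : ℂ} (h : a ^ 2 = β) (ω q t : ℂ) :
    qPochInf (t * ω ^ 2) q * phi [a * ω, -a * ω] [-β] q (t * ω ^ 2) = seriesA ω q β t := by
  simp only [phi, seriesA, phiTerm_two_one, h]

theorem phiTerm_two_two (t ω c d q : ℂ) (n : ℕ) :
    phiTerm [t * ω, t * ω ^ 2] [c, -c] q (-d) n = termPhi ω q t (c ^ 2) d n := by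
  have h : (-1 : ℂ) ^ n * (-d) ^ n = d ^ n := by rw [← mul_pow, neg_one_mul, neg_neg]
  simp only [phiTerm, qPochList, termPhi, ← qPoch_mul_neg, List.map_cons, List.map_nil,
    List.prod_cons, List.prod_nil, mul_one, List.length_cons, List.length_nil, ← h]
  norm_num
  ring

theorem summable_phiTerm_two_two {q c : ℂ} (hq : ‖q‖ < 1) (hc : ‖c‖ < 1) (t ω d : ℂ) :
    Summable (phiTerm [t * ω, t * ω ^ 2] [c, -c] q (-d)) := by
  rw [funext (phiTerm_two_two t ω c d q)]
  exact summable_termPhi hq (mul_pow_ne_one (norm_pow_lt_one hq two_ne_zero)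
    (norm_pow_lt_one hc two_ne_zero)) ω t d

theorem phi_two_two (t ω c d q : ℂ) :
    phi [t * ω, t * ω ^ 2] [c, -c] q (-d) = seriesPhi ω q t (c ^ 2) d :=
  tsum_congr (phiTerm_two_two t ω c d q)

theorem seriesA_three_one {ω p : ℂ} (hω : ω ^ 2 + ω + 1 = 0) (hp0 : p ≠ 0) (hp : ‖p‖ < 1) :
    seriesA ω (p ^ 2) (p ^ 3) p = (1 + p) * (qPochInf p (p ^ 12) * qPochInf (p ^ 9) (p ^ 12))
      / (qPochInf (p ^ 2) (p ^ 4) * qPochInf (p ^ 4) (p ^ 12)) := by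
  have hN : ∀ {m n : ℕ}, m ≠ 0 → n ≠ 0 → qPochInf (p ^ m) (p ^ n) ≠ 0 := fun hm hn =>
    qPochInf_ne_zero_of_norm (norm_pow_lt_one hp hn) (norm_pow_lt_one hp hm)
  have h1 := seriesA_eq_seriesPhi hω (norm_pow_lt_one hp two_ne_zero)
    (norm_pow_lt_one hp three_ne_zero) hp (b := p ^ 5) (by ring)
  rw [show (p ^ 2) ^ 2 = p ^ 4 by ring, qPochInf_mul_seriesPhi_one_five_three hω hp0 hp] at h1
  have h2 : qPochInf p (p ^ 2) * qPochInf (-p) (p ^ 2) = qPochInf (p ^ 2) (p ^ 4) := by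
    simpa using qPochInf_pow_mul_neg hp 1
  have h3 : qPochInf p (p ^ 2) = qPochInf p (p ^ 4) * qPochInf (p ^ 3) (p ^ 4) := by
    simpa using qPochInf_pow_two hp 1
  have h4 : qPochInf p (p ^ 4) = qPochInf p (p ^ 12) * qPochInf (p ^ 5) (p ^ 12)
      * qPochInf (p ^ 9) (p ^ 12) := by
    simpa using qPochInf_pow_three hp 1
  have h5 := qPochInf_succ (-p) (norm_pow_lt_one hp two_ne_zero)
  rw [show -p * p ^ 2 = -p ^ 3 by ring, sub_neg_eq_add] at h5
  have n3 := hN (m := 3) (n := 4) (by norm_num) (by norm_num)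
  have n4 := hN (m := 4) (n := 12) (by norm_num) (by norm_num)
  have n5 := hN (m := 5) (n := 12) (by norm_num) (by norm_num)
  have n2 := hN (m := 2) (n := 4) (by norm_num) (by norm_num)
  rw [eq_div_iff (mul_ne_zero n3 (mul_ne_zero n4 n5))] at h1
  rw [eq_div_iff (mul_ne_zero n2 n4), ← h2, h5, h3, h4]
  linear_combination ((1 + p) * qPochInf p (p ^ 12) * qPochInf (p ^ 9) (p ^ 12)) * h1

theorem seriesA_one_one {ω p : ℂ} (hω : ω ^ 2 + ω + 1 = 0) (hp0 : p ≠ 0) (hp : ‖p‖ < 1) :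
    seriesA ω (p ^ 2) p p = qPochInf (p ^ 3) (p ^ 12) * qPochInf (p ^ 7) (p ^ 12)
      / (qPochInf (p ^ 2) (p ^ 4) * qPochInf (p ^ 4) (p ^ 12)) := by
  have hN : ∀ {m n : ℕ}, m ≠ 0 → n ≠ 0 → qPochInf (p ^ m) (p ^ n) ≠ 0 := fun hm hn =>
    qPochInf_ne_zero_of_norm (norm_pow_lt_one hp hn) (norm_pow_lt_one hp hm)
  have h1 := seriesA_eq_seriesPhi hω (norm_pow_lt_one hp two_ne_zero) hp hp (b := p ^ 3) (by ring)
  rw [show (p ^ 2) ^ 2 = p ^ 4 by ring, qPochInf_mul_seriesPhi_one_three_one hω hp0 hp] at h1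
  have h2 : qPochInf p (p ^ 2) * qPochInf (-p) (p ^ 2) = qPochInf (p ^ 2) (p ^ 4) := by
    simpa using qPochInf_pow_mul_neg hp 1
  have h3 : qPochInf p (p ^ 2) = qPochInf p (p ^ 4) * qPochInf (p ^ 3) (p ^ 4) := by
    simpa using qPochInf_pow_two hp 1
  have h4 : qPochInf (p ^ 3) (p ^ 4) = qPochInf (p ^ 3) (p ^ 12) * qPochInf (p ^ 7) (p ^ 12)
      * qPochInf (p ^ 11) (p ^ 12) := qPochInf_pow_three hp 3
  have n1 := qPochInf_ne_zero_of_norm (norm_pow_lt_one hp four_ne_zero) hp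
  have n4 := hN (m := 4) (n := 12) (by norm_num) (by norm_num)
  have n11 := hN (m := 11) (n := 12) (by norm_num) (by norm_num)
  have n2 := hN (m := 2) (n := 4) (by norm_num) (by norm_num)
  rw [eq_div_iff (mul_ne_zero n1 (mul_ne_zero n4 n11))] at h1
  rw [eq_div_iff (mul_ne_zero n2 n4), ← h2, h3, h4]
  linear_combination (qPochInf (p ^ 3) (p ^ 12) * qPochInf (p ^ 7) (p ^ 12)) * h1

theorem seriesPhi_one_five_one {ω p : ℂ} (hω : ω ^ 2 + ω + 1 = 0) (hp0 : p ≠ 0) (hp : ‖p‖ < 1) :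
    seriesPhi ω (p ^ 2) p (p ^ 5) p
      = (1 - p) / (qPochInf p (p ^ 2) * (qPochInf p (p ^ 12) * qPochInf (p ^ 8) (p ^ 12))) := by
  have h1 := qPochInf_mul_seriesPhi_one_five_one hω hp0 hp
  have h3 : qPochInf p (p ^ 2) = qPochInf p (p ^ 4) * qPochInf (p ^ 3) (p ^ 4) := by
    simpa using qPochInf_pow_two hp 1
  have h5 := qPochInf_succ p (norm_pow_lt_one hp four_ne_zero)
  rw [← pow_succ'] at h5
  have n2 := qPochInf_ne_zero_of_norm (norm_pow_lt_one hp two_ne_zero) hp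
  have n3 := qPochInf_ne_zero_of_norm (norm_pow_lt_one hp four_ne_zero)
    (norm_pow_lt_one hp three_ne_zero)
  have hp12 := norm_pow_lt_one hp (n := 12) (by norm_num)
  have n1 := qPochInf_ne_zero_of_norm hp12 hp
  have n8 := qPochInf_ne_zero_of_norm hp12 (norm_pow_lt_one hp (n := 8) (by norm_num))
  rw [eq_div_iff (mul_ne_zero n3 (mul_ne_zero n1 n8))] at h1
  rw [eq_div_iff (mul_ne_zero n2 (mul_ne_zero n1 n8)), h3, h5]
  linear_combination (1 - p) * h1

theorem seriesPhi_neg_one_three_three {ω p : ℂ} (hω : ω ^ 2 + ω + 1 = 0) (hp0 : p ≠ 0)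
    (hp : ‖p‖ < 1) :
    seriesPhi ω (p ^ 2) p⁻¹ (p ^ 3) (p ^ 3)
      = 1 / (qPochInf p (p ^ 2) * (qPochInf (p ^ 7) (p ^ 12) * qPochInf (p ^ 8) (p ^ 12))) := by
  have h1 := qPochInf_mul_seriesPhi_neg_one_three_three hω hp0 hp
  have h3 : qPochInf p (p ^ 2) = qPochInf p (p ^ 4) * qPochInf (p ^ 3) (p ^ 4) := by
    simpa using qPochInf_pow_two hp 1
  have n2 := qPochInf_ne_zero_of_norm (norm_pow_lt_one hp two_ne_zero) hp
  have n1 := qPochInf_ne_zero_of_norm (norm_pow_lt_one hp four_ne_zero) hp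
  have hp12 := norm_pow_lt_one hp (n := 12) (by norm_num)
  have n7 := qPochInf_ne_zero_of_norm hp12 (norm_pow_lt_one hp (n := 7) (by norm_num))
  have n8 := qPochInf_ne_zero_of_norm hp12 (norm_pow_lt_one hp (n := 8) (by norm_num))
  rw [eq_div_iff (mul_ne_zero n1 (mul_ne_zero n7 n8))] at h1
  rw [eq_div_iff (mul_ne_zero n2 (mul_ne_zero n7 n8)), h3]
  linear_combination h1

theorem qPochInfList_pair (a b q : ℂ) : qPochInfList [a, b] q = qPochInf a q * qPochInf b q := by
  simp [qPochInfList]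

theorem omega_of_isPrimitiveRoot {ω : ℂ} (h : IsPrimitiveRoot ω 3) : ω ^ 2 + ω + 1 = 0 := by
  have h1 : ω - 1 ≠ 0 := sub_ne_zero.2 (h.ne_one (by norm_num))
  exact mul_left_cancel₀ h1 (by linear_combination h.pow_eq_one)

end KanadeRussell

theorem mainTheorem1 (q : ℂ) (hq0 : 0 < ‖q‖) (hq1 : ‖q‖ < 1) :
    -- the four triple-sum identities, with absolute convergence of the series
    ((Summable (KanadeRussell.tripleTerm q (q ^ 3) (q ^ 5) (q ^ 12)) ∧
        KanadeRussell.F q (q ^ 3) (q ^ 5) (q ^ 12) =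
          1 / (KanadeRussell.qPochInf (q ^ 3) (q ^ 4) *
            KanadeRussell.qPochInfList [q ^ 4, q ^ 5] (q ^ 12))) ∧
      (Summable (KanadeRussell.tripleTerm q q (q ^ 3) (q ^ 6)) ∧
        KanadeRussell.F q q (q ^ 3) (q ^ 6) =
          1 / (KanadeRussell.qPochInf q (q ^ 4) *
            KanadeRussell.qPochInfList [q ^ 4, q ^ 11] (q ^ 12))) ∧
      (Summable (KanadeRussell.tripleTerm q q q (q ^ 6)) ∧
        KanadeRussell.F q q q (q ^ 6) =
          1 / (KanadeRussell.qPochInf (q ^ 3) (q ^ 4) *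
            KanadeRussell.qPochInfList [q, q ^ 8] (q ^ 12))) ∧
      (Summable (KanadeRussell.tripleTerm q (q ^ 2) q⁻¹ (q ^ 6)) ∧
        KanadeRussell.F q (q ^ 2) q⁻¹ (q ^ 6) =
          1 / (KanadeRussell.qPochInf q (q ^ 4) *
            KanadeRussell.qPochInfList [q ^ 7, q ^ 8] (q ^ 12)))) ∧
    -- the four one-variable summations, where `r` is a fixed fourth root `q ^ (1 / 4)`
    (∀ r ω : ℂ, r ^ 4 = q → IsPrimitiveRoot ω 3 →
      (Summable (KanadeRussell.phiTerm [r ^ 3 * ω, -r ^ 3 * ω] [-r ^ 6] q (r ^ 2 * ω ^ 2)) ∧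
        KanadeRussell.phi [r ^ 3 * ω, -r ^ 3 * ω] [-r ^ 6] q (r ^ 2 * ω ^ 2) =
          (1 + r ^ 2) * KanadeRussell.qPochInfList [r ^ 2, r ^ 18] (q ^ 6) /
            (KanadeRussell.qPochInf (r ^ 2 * ω ^ 2) q * KanadeRussell.qPochInf q (q ^ 2) *
              KanadeRussell.qPochInf (q ^ 2) (q ^ 6))) ∧
      (Summable (KanadeRussell.phiTerm [r * ω, -r * ω] [-r ^ 2] q (r ^ 2 * ω ^ 2)) ∧
        KanadeRussell.phi [r * ω, -r * ω] [-r ^ 2] q (r ^ 2 * ω ^ 2) =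
          KanadeRussell.qPochInfList [r ^ 6, r ^ 14] (q ^ 6) /
            (KanadeRussell.qPochInf (r ^ 2 * ω ^ 2) q * KanadeRussell.qPochInf q (q ^ 2) *
              KanadeRussell.qPochInf (q ^ 2) (q ^ 6))) ∧
      (Summable (KanadeRussell.phiTerm [r ^ 2 * ω, r ^ 2 * ω ^ 2] [r ^ 5, -r ^ 5] q (-r ^ 2)) ∧
        KanadeRussell.phi [r ^ 2 * ω, r ^ 2 * ω ^ 2] [r ^ 5, -r ^ 5] q (-r ^ 2) =
          (1 - r ^ 2) /
            (KanadeRussell.qPochInf (r ^ 2) q *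
              KanadeRussell.qPochInfList [r ^ 2, q ^ 4] (q ^ 6))) ∧
      (Summable (KanadeRussell.phiTerm [(r ^ 2)⁻¹ * ω, (r ^ 2)⁻¹ * ω ^ 2] [r ^ 3, -r ^ 3] q
          (-r ^ 6)) ∧
        KanadeRussell.phi [(r ^ 2)⁻¹ * ω, (r ^ 2)⁻¹ * ω ^ 2] [r ^ 3, -r ^ 3] q (-r ^ 6) =
          1 / (KanadeRussell.qPochInf (r ^ 2) q *
            KanadeRussell.qPochInfList [r ^ 14, q ^ 4] (q ^ 6)))) := by
  have hq : q ≠ 0 := norm_pos_iff.1 hq0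
  refine ⟨?_, fun r ω hr hω' => ?_⟩
  · have hω := KanadeRussell.omega_of_isPrimitiveRoot (Complex.isPrimitiveRoot_exp 3 three_ne_zero)
    have hne : ∀ k ≠ 0, ∀ n, q ^ k * (q ^ 4) ^ n ≠ 1 := fun k hk =>
      KanadeRussell.mul_pow_ne_one (KanadeRussell.norm_pow_lt_one hq1 four_ne_zero)
        (KanadeRussell.norm_pow_lt_one hq1 hk)
    simp only [KanadeRussell.qPochInfList_pair]
    -- In the first two cases `u = A` and `κ = 1`; in the third `κ = q ^ 2`; in the last `u = s`, so
    -- that `α = s / A = q⁻¹`.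
    have h₁ := KanadeRussell.summable_and_F_eq hω hq1 (s := q ^ 4) (A := q ^ 3) (α := q)
      (u := q ^ 3) (v := q ^ 5) (κ := 1) (γ := q ^ 5) (by ring) (by ring) (by ring) (.inl rfl)
      (by ring) (by ring) (hne 5 (by norm_num))
    have h₂ := KanadeRussell.summable_and_F_eq hω hq1 (s := q ^ 2) (A := q) (α := q)
      (u := q) (v := q ^ 3) (κ := 1) (γ := q ^ 3) (by ring) (by ring) (by ring) (.inl rfl)
      (by ring) (by ring) (hne 3 (by norm_num))
    have h₃ := KanadeRussell.summable_and_F_eq hω hq1 (s := q ^ 2) (A := q) (α := q)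
      (u := q) (v := q) (κ := q ^ 2) (γ := q ^ 5) (by ring) (by ring) (by ring) (.inr rfl)
      (by ring) (by ring) (hne 5 (by norm_num))
    have h₄ := KanadeRussell.summable_and_F_eq hω hq1 (s := q ^ 2) (A := q ^ 3) (α := q⁻¹)
      (u := q ^ 2) (v := q⁻¹) (κ := q ^ 2) (γ := q ^ 3) (by field_simp) (by ring) (by ring)
      (.inr rfl) (by field_simp) (by field_simp) (hne 3 (by norm_num))
    rw [KanadeRussell.qPochInf_mul_seriesPhi_one_five_three hω hq hq1, ← pow_mul] at h₁
    rw [KanadeRussell.qPochInf_mul_seriesPhi_one_three_one hω hq hq1, ← pow_mul] at h₂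
    rw [KanadeRussell.qPochInf_mul_seriesPhi_one_five_one hω hq hq1, ← pow_mul] at h₃
    rw [KanadeRussell.qPochInf_mul_seriesPhi_neg_one_three_three hω hq hq1, ← pow_mul] at h₄
    exact ⟨h₁, h₂, h₃, h₄⟩
  · have hω := KanadeRussell.omega_of_isPrimitiveRoot hω'
    have hr0 : r ≠ 0 := by
      rintro rfl
      exact hq (by rw [← hr]; simp)
    have hr1 : ‖r‖ < 1 := by
      rw [← hr, norm_pow] at hq1
      exact (pow_lt_one_iff_of_nonneg (norm_nonneg r) four_ne_zero).1 hq1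
    -- In terms of `p`, the square root of `q`, the base is `p ^ 2`, as in the evaluations.
    obtain ⟨p, hp⟩ : ∃ p, p = r ^ 2 := ⟨_, rfl⟩
    have hp0 : p ≠ 0 := hp ▸ pow_ne_zero 2 hr0
    have hp1 : ‖p‖ < 1 := hp ▸ KanadeRussell.norm_pow_lt_one hr1 two_ne_zero
    have hqp : q = p ^ 2 := by rw [← hr, hp]; ring
    have hz : ‖p * ω ^ 2‖ < 1 := by
      rwa [norm_mul, norm_pow, KanadeRussell.norm_omega hω, one_pow, mul_one]
    have hne := KanadeRussell.qPochInf_ne_zero_of_norm hq1 hz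
    have e₁ := KanadeRussell.seriesA_three_one hω hp0 hp1
    have e₂ := KanadeRussell.seriesA_one_one hω hp0 hp1
    have e₃ := KanadeRussell.seriesPhi_one_five_one hω hp0 hp1
    have e₄ := KanadeRussell.seriesPhi_neg_one_three_three hω hp0 hp1
    rw [← KanadeRussell.qPochInf_mul_phi_two_one (a := r ^ 3) (by rw [hp]; ring), ← hqp] at e₁
    rw [← KanadeRussell.qPochInf_mul_phi_two_one (a := r) hp.symm, ← hqp] at e₂
    rw [show p ^ 5 = (r ^ 5) ^ 2 by rw [hp]; ring, ← KanadeRussell.phi_two_two, ← hqp] at e₃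
    nth_rw 1 [show p ^ 3 = (r ^ 3) ^ 2 by rw [hp]; ring] at e₄
    rw [← KanadeRussell.phi_two_two, ← hqp] at e₄
    simp only [KanadeRussell.qPochInfList_pair]
    rw [show r ^ 6 = p ^ 3 by rw [hp]; ring, show r ^ 18 = p ^ 9 by rw [hp]; ring,
      show r ^ 14 = p ^ 7 by rw [hp]; ring, show q ^ 6 = p ^ 12 by rw [hqp]; ring,
      show q ^ 2 = p ^ 4 by rw [hqp]; ring, show q ^ 4 = p ^ 8 by rw [hqp]; ring, ← hp]
    refine ⟨⟨?_, ?_⟩, ⟨?_, ?_⟩, ⟨?_, e₃⟩, ⟨?_, e₄⟩⟩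
    · exact KanadeRussell.summable_phiTerm_two_one hq1
        (KanadeRussell.norm_pow_lt_one hp1 three_ne_zero) hz _ ω
    · rw [mul_assoc (KanadeRussell.qPochInf _ q), div_mul_eq_div_div_swap, eq_div_iff hne,
        mul_comm, e₁]
    · exact KanadeRussell.summable_phiTerm_two_one hq1 hp1 hz _ ω
    · rw [mul_assoc (KanadeRussell.qPochInf _ q), div_mul_eq_div_div_swap, eq_div_iff hne,
        mul_comm, e₂]
    · exact KanadeRussell.summable_phiTerm_two_two hq1
        (KanadeRussell.norm_pow_lt_one hr1 (by norm_num)) p ω p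
    · exact KanadeRussell.summable_phiTerm_two_two hq1
        (KanadeRussell.norm_pow_lt_one hr1 three_ne_zero) p⁻¹ ω (p ^ 3)
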